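/- **Balancing condition for the mean curvature of constant curvature balls.** Let $\kappa\in\mathbb R$, let $B^3$ be the closed unit ball with boundary $S^2$, and let $\gamma_{+1}$ be the round metric of $S^2(1)$. 1. Let $g$ be a Riemannian metric on $B^3$, of class $C^2$ up to the boundary (for instance $C^{m,\alpha}$ with $m\ge 2$), of constant sectional curvature $\kappa$. Let $\gamma=g|_{TS^2}$ be the induced boundary metric and let $H$ be the mean curvature of $S^2=\partial B^3\subset(B^3,g)$ with respect to the outward unit normal, that is, the $\gamma$-trace of the second fundamental form $A(u,v)=g(\nabla_u\nu,v)$. Then $H$ is of class $C^1$, and for every ($C^1$) conformal Killing field $X$ of $(S^2,\gamma)$, that is, every tangent field with $\mathcal L_X\gamma=\mu\gamma$ for some function $\mu$, the function $X(H)$ is integrable and $$\int_{S^2}X(H)\,dV_\gamma=0 .$$ 2. If moreover $\gamma$ is pointwise conformal to $\gamma_{+1}$, then $H$ is not a non-constant monotone function of a height function on $S^2(1)$. That is, there are no unit vector $a\in\mathbb R^3$ and monotone (non-decreasing or non-increasing) function $f:[-1,1]\to\mathbb R$ such that $H$ is non-constant and $H(x)=f(\langle a,x\rangle)$ for all $x\in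 S^2$. 3. More generally, let $(N,g)$ be any smooth Riemannian $3$-manifold of constant sectional curvature $\kappa$ (for instance a space form), and let $F:S^2(1)\to N$ be a conformal immersion of class $C^3$ (that is, $F^*g=\rho\,\gamma_{+1}$ with $\rho>0$), not necessarily extending to a ball. Then the mean curvature of $F$ with respect to a continuous unit normal field is not a non-constant monotone function of a height function on $S^2(1)$. -/

import Mathlib

open Set Metric MeasureTheory
open scoped Manifold ContDiff RealInnerProductSpace

noncomputable section

namespace Balancing

/-- Euclidean three-space. -/
abbrev E3 : Type := EuclideanSpace ℝ (Fin 3)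

/-- The unit sphere `S²` in Euclidean three-space. -/
abbrev S2 : Type := sphere (0 : E3) 1

/-- The closed unit ball `B³` in Euclidean three-space. -/
abbrev B3 : Set E3 := closedBall (0 : E3) 1

/-! ### Metrics and curvature in coordinates

A metric in coordinates on `s ⊆ ℝ³` is a field of symmetric positive definite matrices
`G x = (g_{ij}(x))`, `x ∈ s`; only its values on `s` matter. -/

/-- The bilinear form `∑ m_{ij} u^i v^j` of a matrix. -/
def form (m : Matrix (Fin 3) (Fin 3) ℝ) (u v : E3) : ℝ :=
  ∑ i, ∑ j, m i j * u i * v j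

/-- The partial derivative `∂_i f` at `x`, taken within `s`
(one-sided at boundary points of `s`). -/
def pd (s : Set E3) (i : Fin 3) (f : E3 → ℝ) (x : E3) : ℝ :=
  fderivWithin ℝ f s x (EuclideanSpace.single i 1)

/-- The Christoffel symbols
`Γ^k_{ij} = ½ ∑_l g^{kl} (∂_i g_{jl} + ∂_j g_{il} - ∂_l g_{ij})`. -/
def christoffel (s : Set E3) (G : E3 → Matrix (Fin 3) (Fin 3) ℝ) (k i j : Fin 3) (x : E3) : ℝ :=
  (1 / 2) * ∑ l, (G x)⁻¹ k l *
    (pd s i (fun y => G y j l) x + pd s j (fun y => G y i l) x - pd s l (fun y => G y i j) x)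

/-- The components `R^l_{kij}` of the curvature tensor, `R(∂_i, ∂_j) ∂_k = ∑_l R^l_{kij} ∂_l`. -/
def riemann (s : Set E3) (G : E3 → Matrix (Fin 3) (Fin 3) ℝ) (l k i j : Fin 3) (x : E3) : ℝ :=
  pd s i (christoffel s G l j k) x - pd s j (christoffel s G l i k) x
    + ∑ m, (christoffel s G l i m x * christoffel s G m j k x
        - christoffel s G l j m x * christoffel s G m i k x)

/-- `g(R(u, v) v, u)`, the numerator of the sectional curvature of the plane spanned by `u, v`. -/
def curvNum (s : Set E3) (G : E3 → Matrix (Fin 3) (Fin 3) ℝ) (x u v : E3) : ℝ :=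
  ∑ p, ∑ l, ∑ k, ∑ i, ∑ j, G x p l * riemann s G l k i j x * u i * v j * v k * u p

/-- All sectional curvatures `g(R(u,v)v,u) / (|u|²|v|² - ⟨u,v⟩²)` on `s` are equal to `κ`. -/
def HasConstCurv (s : Set E3) (G : E3 → Matrix (Fin 3) (Fin 3) ℝ) (κ : ℝ) : Prop :=
  ∀ x ∈ s, ∀ u v : E3, LinearIndependent ℝ ![u, v] →
    curvNum s G x u v / (form (G x) u u * form (G x) v v - form (G x) u v ^ 2) = κ

/-! ### Calculus on the sphere

Maps on `S²` are differentiated through their extensions that are constant along rays; on vectors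
tangent to `S²` this is the differential of the map. -/

/-- The radial projection `y ↦ y / |y|` onto `S²` (with an irrelevant value at the origin). -/
def radialProj (y : E3) : S2 :=
  if h : y = 0 then ⟨EuclideanSpace.single 0 1, by simp⟩
  else ⟨‖y‖⁻¹ • y, by simp [norm_smul, h]⟩

variable {V : Type*} [NormedAddCommGroup V] [NormedSpace ℝ V]

/-- The derivative of `f : S² → V` at `x` in the direction of a tangent vector `u ⟂ x`. -/
def sD (f : S2 → V) (x : S2) (u : E3) : V :=
  fderiv ℝ (fun y : E3 => f (radialProj y)) (x : E3) u

/-- The second derivative of `f : S² → V` at `x` on tangent vectors `u, v ⟂ x`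
(its Hessian with respect to the round metric). -/
def sD2 (f : S2 → V) (x : S2) (u v : E3) : V :=
  fderiv ℝ (fun y : E3 => fderiv ℝ (fun z : E3 => f (radialProj z)) y u) (x : E3) v

/-- A basis of `T_x S² = x^⊥`, orthonormal for the round metric. -/
def frame (x : S2) :
    OrthonormalBasis (Fin (Module.finrank ℝ (ℝ ∙ (x : E3))ᗮ)) ℝ (ℝ ∙ (x : E3))ᗮ :=
  stdOrthonormalBasis ℝ (ℝ ∙ (x : E3))ᗮ

/-! ### Second fundamental form and mean curvature -/

/-- The vector `Γ_p(u, v) = (∑ Γ^k_{ij}(p) u^i v^j)_k`. -/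
def christoffelVec (s : Set E3) (G : E3 → Matrix (Fin 3) (Fin 3) ℝ) (p u v : E3) : E3 :=
  WithLp.toLp 2 fun k => ∑ i, ∑ j, christoffel s G k i j p * u i * v j

/-- The second fundamental form at `x` of a map `f` of `S²` into `(s, G)`, with respect to the unit
normal `n` at `f x`: `A(u, v) = -g(∇_u df(v), n) = g(∇_u n, df(v))`. -/
def secondFF (s : Set E3) (G : E3 → Matrix (Fin 3) (Fin 3) ℝ) (f : S2 → E3) (n : E3) (x : S2)
    (u v : E3) : ℝ :=
  - form (G (f x)) (sD2 f x u v + christoffelVec s G (f x) (sD f x u) (sD f x v)) n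

/-- The mean curvature `H = tr A = ∑ γ^{ab} A_{ab}`, the trace being taken with respect to the first
fundamental form `γ_{ab} = g(df(e_a), df(e_b))`. -/
def meanCurv (s : Set E3) (G : E3 → Matrix (Fin 3) (Fin 3) ℝ) (f : S2 → E3) (n : E3)
    (x : S2) : ℝ :=
  Matrix.trace
    ((Matrix.of fun a b => form (G (f x)) (sD f x (frame x a)) (sD f x (frame x b)))⁻¹ *
      (Matrix.of fun a b => secondFF s G f n x (frame x a) (frame x b)))

/-! ### Constant curvature metrics on the ball and their boundary data -/

/-- `G` is a Riemannian metric on the closed ball `B³`, of class `C²` up to the boundary, of constant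
sectional curvature `κ`. -/
structure IsConstCurvMetricOnBall (G : E3 → Matrix (Fin 3) (Fin 3) ℝ) (κ : ℝ) : Prop where
  contDiffOn : ∀ i j, ContDiffOn ℝ 2 (fun x => G x i j) B3
  posDef : ∀ x ∈ B3, (G x).PosDef
  constCurv : HasConstCurv B3 G κ

/-- `ν` is the outward unit normal field of `∂B³ = S²` with respect to the metric `G`. -/
structure IsOutwardUnitNormal (G : E3 → Matrix (Fin 3) (Fin 3) ℝ) (ν : S2 → E3) : Prop where
  unit : ∀ x : S2, form (G x) (ν x) (ν x) = 1
  normal : ∀ x : S2, ∀ u : E3, ⟪(x : E3), u⟫ = 0 → form (G x) (ν x) u = 0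
  outward : ∀ x : S2, 0 < ⟪(x : E3), ν x⟫

/-- The mean curvature of `∂B³ ⊂ (B³, G)` with respect to the normal field `ν`. -/
def boundaryMeanCurv (G : E3 → Matrix (Fin 3) (Fin 3) ℝ) (ν : S2 → E3) (x : S2) : ℝ :=
  meanCurv B3 G (fun y : S2 => (y : E3)) (ν x) x

/-! The boundary metric `γ` is the restriction of `G x`, `x ∈ S²`, to pairs of tangent vectors. -/

/-- The density `dV_γ / dA` of the area form of `γ = G|_{TS²}` with respect to the area `dA` of the
round metric: the square root of the determinant of `γ` in a round orthonormal frame. -/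
def areaDensity (G : E3 → Matrix (Fin 3) (Fin 3) ℝ) (x : S2) : ℝ :=
  Real.sqrt (Matrix.det (Matrix.of fun a b => form (G x) (frame x a) (frame x b)))

/-- The area measure of the round unit sphere. -/
def roundArea : Measure S2 := (volume : Measure E3).toSphere

/-- The Lie derivative `(L_X γ)(u, v)` of `γ = G|_{TS²}`, for `u, v` tangent to `S²` at `x`. -/
def lieDeriv (G : E3 → Matrix (Fin 3) (Fin 3) ℝ) (X : S2 → E3) (x : S2) (u v : E3) : ℝ :=
  sD (fun y : S2 => form (G y) u v) x (X x)
    + form (G x) (sD X x u) v + form (G x) u (sD X x v)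

/-- `X` is a (`C¹`, tangential) conformal Killing field of `(S², γ)`, where `γ = G|_{TS²}`:
`L_X γ = μ γ` for some function `μ`. -/
structure IsConformalKilling (G : E3 → Matrix (Fin 3) (Fin 3) ℝ) (X : S2 → E3) : Prop where
  contMDiff : ContMDiff (𝓡 2) 𝓘(ℝ, E3) 1 X
  tangent : ∀ x : S2, ⟪(x : E3), X x⟫ = 0
  conformal : ∃ μ : S2 → ℝ, ∀ x : S2, ∀ u v : E3, ⟪(x : E3), u⟫ = 0 → ⟪(x : E3), v⟫ = 0 →
    lieDeriv G X x u v = μ x * form (G x) u v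

/-- The boundary metric `γ = G|_{TS²}` is (pointwise) conformal to the round metric of `S²(1)`. -/
def IsConformalToRound (G : E3 → Matrix (Fin 3) (Fin 3) ℝ) : Prop :=
  ∃ ρ : S2 → ℝ, (∀ x, 0 < ρ x) ∧ ∀ x : S2, ∀ u v : E3,
    ⟪(x : E3), u⟫ = 0 → ⟪(x : E3), v⟫ = 0 → form (G x) u v = ρ x * ⟪u, v⟫

/-- `H` is a non-constant monotone (non-decreasing or non-increasing) function of a height function
`x ↦ ⟪a, x⟫`, `|a| = 1`, on `S²(1)`. -/
def IsMonotoneOfHeight (H : S2 → ℝ) : Prop :=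
  (∃ x y, H x ≠ H y) ∧
    ∃ a : E3, ‖a‖ = 1 ∧ ∃ f : ℝ → ℝ,
      (MonotoneOn f (Icc (-1) 1) ∨ AntitoneOn f (Icc (-1) 1)) ∧ ∀ x : S2, H x = f ⟪a, (x : E3)⟫

/-! ### Conformal immersions of the sphere in three-manifolds of constant curvature -/

section Immersion

variable {N : Type*} [TopologicalSpace N] [ChartedSpace E3 N] [IsManifold (𝓡 3) ∞ N]

/-- Smooth Riemannian metrics on the three-manifold `N`. -/
abbrev SmoothMetric (N : Type*) [TopologicalSpace N] [ChartedSpace E3 N] [IsManifold (𝓡 3) ∞ N] :=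
  Bundle.ContMDiffRiemannianMetric (𝓡 3) ∞ E3 (fun p : N => TangentSpace (𝓡 3) p)

/-- The matrix field of a metric in the coordinates of a chart `φ`, on `φ.target`. -/
def metricInChart (g : SmoothMetric N) (φ : OpenPartialHomeomorph N E3) (y : E3) :
    Matrix (Fin 3) (Fin 3) ℝ :=
  Matrix.of fun i j => g.inner (φ.symm y)
    (mfderiv (𝓡 3) (𝓡 3) φ.symm y (EuclideanSpace.single i (1 : ℝ) : E3))
    (mfderiv (𝓡 3) (𝓡 3) φ.symm y (EuclideanSpace.single j (1 : ℝ) : E3))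

/-- `(N, g)` has constant sectional curvature `κ`. -/
def IsConstCurvMetric (g : SmoothMetric N) (κ : ℝ) : Prop :=
  ∀ φ ∈ atlas E3 N, HasConstCurv φ.target (metricInChart g φ) κ

/-- `F : S²(1) → (N, g)` is a conformal immersion (of class `C³`): `F^* g = ρ γ_{+1}` with a positive
function `ρ`, where `γ_{+1}` is the round metric. -/
structure IsConformalImmersion (g : SmoothMetric N) (F : S2 → N) : Prop where
  contMDiff : ContMDiff (𝓡 2) (𝓡 3) 3 F
  conformal : ∃ ρ : S2 → ℝ, (∀ x, 0 < ρ x) ∧ ∀ (x : S2) (u v : TangentSpace (𝓡 2) x),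
    g.inner (F x) (mfderiv (𝓡 2) (𝓡 3) F x u) (mfderiv (𝓡 2) (𝓡 3) F x v) =
      ρ x * @inner ℝ E3 _ (mfderiv (𝓡 2) 𝓘(ℝ, E3) (fun y : S2 => (y : E3)) x u)
        (mfderiv (𝓡 2) 𝓘(ℝ, E3) (fun y : S2 => (y : E3)) x v)

/-- `ν` is a continuous unit normal field along `F`. -/
structure IsUnitNormalAlong (g : SmoothMetric N) (F : S2 → N)
    (ν : ∀ x : S2, TangentSpace (𝓡 3) (F x)) : Prop where
  continuous : Continuous fun x : S2 => (⟨F x, ν x⟩ : TangentBundle (𝓡 3) N)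
  unit : ∀ x : S2, g.inner (F x) (ν x) (ν x) = 1
  normal : ∀ (x : S2) (u : TangentSpace (𝓡 2) x),
    g.inner (F x) (ν x) (mfderiv (𝓡 2) (𝓡 3) F x u) = 0

/-- `H` is the mean curvature of `F` with respect to the unit normal field `ν`, as computed in the
charts of `N`. -/
def HasMeanCurv (g : SmoothMetric N) (F : S2 → N) (ν : ∀ x : S2, TangentSpace (𝓡 3) (F x))
    (H : S2 → ℝ) : Prop :=
  ∀ φ ∈ atlas E3 N, ∀ x : S2, F x ∈ φ.source →
    H x = meanCurv φ.target (metricInChart g φ) (fun y => φ (F y))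
      (mfderiv (𝓡 3) (𝓡 3) φ (F x) (ν x) : E3) x

end Immersion

end Balancing

end

/-!
Let `γ` and `A` be the first and second fundamental forms of a surface in a space of constant
curvature, `H` its mean curvature, and `A₀ = A - ½ H γ` the traceless second fundamental form. For a
conformal Killing field `X`, rotated by a right angle to `JX`, consider the one-form
`η = A₀(JX, ·)`. The ambient curvature does not contribute to the Codazzi equation, so the exterior
derivative of `η` on the frame `X, JX` only involves `dH` and the contraction of `A₀` with the
derivative of `JX`. The latter vanishes because `A₀` is traceless and `X` is conformal Killing; what
remains is `dη(X, JX) = -½ X(H) |X|²`, that is, `X(H) dV_γ = -2 dη`. Integration over the closed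
surface gives the balancing condition.

If `γ` is conformal to the round metric, the round gradient of every height function is a conformal
Killing field. The derivative along it of a mean curvature that is a monotone function of the height
has constant sign; by the balancing condition it vanishes, so the mean curvature is constant.
-/

noncomputable section

namespace Balancing

open Filter Topology

/-! ### Calculus on the sphere through radial extensions -/

/-- The extension of a map on `S²` to `ℝ³` that is constant along rays, through which `sD` and `sD2`
differentiate. -/
def radialExt {W : Type*} (f : S2 → W) (y : E3) : W := f (radialProj y)

/-- The standard basis vectors of `ℝ³`. -/
abbrev stdVec (i : Fin 3) : E3 := EuclideanSpace.single i 1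

section RadialExt

variable {V : Type*} [NormedAddCommGroup V] [NormedSpace ℝ V] {W : Type*}

lemma S2.norm_eq (x : S2) : ‖(x : E3)‖ = 1 := norm_eq_of_mem_sphere x

lemma S2.ne_zero (x : S2) : (x : E3) ≠ 0 := ne_zero_of_mem_unit_sphere x

lemma S2.inner_self (x : S2) : ⟪(x : E3), (x : E3)⟫ = 1 := by simp

lemma coe_radialProj {y : E3} (hy : y ≠ 0) : (radialProj y : E3) = ‖y‖⁻¹ • y := by
  simp [radialProj, hy]

@[simp] lemma radialProj_coe (x : S2) : radialProj (x : E3) = x := by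
  ext1
  rw [coe_radialProj x.ne_zero, x.norm_eq, inv_one, one_smul]

lemma radialProj_smul {t : ℝ} (ht : 0 < t) (y : E3) : radialProj (t • y) = radialProj y := by
  by_cases hy : y = 0
  · simp [hy]
  · ext1
    rw [coe_radialProj hy, coe_radialProj (smul_ne_zero ht.ne' hy), norm_smul, smul_smul,
      Real.norm_of_nonneg ht.le]
    congr 1
    field_simp

lemma norm_smul_radialProj {y : E3} (hy : y ≠ 0) : ‖y‖ • (radialProj y : E3) = y := by
  rw [coe_radialProj hy, smul_inv_smul₀ (norm_ne_zero_iff.2 hy)]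

lemma contDiffAt_radialProj {n : ℕ∞ω} {y : E3} (hy : y ≠ 0) :
    ContDiffAt ℝ n (fun z => (radialProj z : E3)) y := by
  have h : ContDiffAt ℝ n (fun z : E3 => ‖z‖⁻¹ • z) y :=
    ((contDiffAt_norm ℝ hy).inv (norm_ne_zero_iff.2 hy)).smul contDiffAt_id
  exact h.congr_of_eventuallyEq ((eventually_ne_nhds hy).mono fun z => coe_radialProj)

lemma continuousAt_radialProj {y : E3} (hy : y ≠ 0) : ContinuousAt radialProj y :=
  Topology.IsInducing.subtypeVal.continuousAt_iff.2 (contDiffAt_radialProj (n := 0) hy).continuousAt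

@[simp] lemma radialExt_coe (f : S2 → W) (x : S2) : radialExt f (x : E3) = f x := by
  simp [radialExt]

lemma radialExt_smul (f : S2 → W) {t : ℝ} (ht : 0 < t) (y : E3) :
    radialExt f (t • y) = radialExt f y := by
  simp [radialExt, radialProj_smul ht]

lemma eventually_ne_zero (x : S2) : ∀ᶠ y in 𝓝 (x : E3), y ≠ 0 := eventually_ne_nhds x.ne_zero

lemma eventually_radialProj {p : S2 → Prop} {x : S2} (h : ∀ᶠ z in 𝓝 x, p z) :
    ∀ᶠ y in 𝓝 (x : E3), p (radialProj y) :=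
  (continuousAt_radialProj x.ne_zero).eventually (by rwa [radialProj_coe])

lemma eventually_coe {p : E3 → Prop} {x : S2} (h : ∀ᶠ y in 𝓝 (x : E3), p y) :
    ∀ᶠ z : S2 in 𝓝 x, p (z : E3) :=
  continuous_subtype_val.continuousAt.eventually h

/-- `ℝ³` has the dimension that the manifold structure of `S²` is built on. -/
instance : Fact (Module.finrank ℝ E3 = 2 + 1) := ⟨by simp⟩

lemma contMDiffAt_radialProj {n : ℕ∞ω} {y : E3} (hy : y ≠ 0) :
    ContMDiffAt 𝓘(ℝ, E3) (𝓡 2) n radialProj y := by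
  let U : TopologicalSpace.Opens E3 := ⟨{0}ᶜ, isOpen_compl_singleton⟩
  have hcoe : ContMDiff 𝓘(ℝ, E3) 𝓘(ℝ, E3) n (fun z : U => (radialProj z : E3)) := fun z =>
    contMDiffAt_subtype_iff.2 (contDiffAt_radialProj z.2).contMDiffAt
  have hU : ContMDiff 𝓘(ℝ, E3) (𝓡 2) n (fun z : U => radialProj z) :=
    hcoe.codRestrict_sphere (n := 2) fun z => (radialProj (z : E3)).2
  exact contMDiffAt_subtype_iff.1 (hU ⟨y, hy⟩)

lemma contMDiffAt_iff_radialExt {n : ℕ∞ω} {f : S2 → V} {x : S2} :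
    ContMDiffAt (𝓡 2) 𝓘(ℝ, V) n f x ↔ ContDiffAt ℝ n (radialExt f) (x : E3) := by
  refine ⟨fun h => ?_, fun h => ?_⟩
  · have hx : ContMDiffAt (𝓡 2) 𝓘(ℝ, V) n f (radialProj (x : E3)) := by rwa [radialProj_coe]
    exact (hx.comp (x : E3) (contMDiffAt_radialProj x.ne_zero)).contDiffAt
  · refine (h.contMDiffAt.comp x (contMDiff_coe_sphere (n := 2) x)).congr_of_eventuallyEq ?_
    exact .of_forall fun z => (radialExt_coe f z).symm

lemma contMDiff_iff_radialExt {n : ℕ∞ω} {f : S2 → V} :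
    ContMDiff (𝓡 2) 𝓘(ℝ, V) n f ↔ ∀ x : S2, ContDiffAt ℝ n (radialExt f) (x : E3) :=
  forall_congr' fun _ => contMDiffAt_iff_radialExt

lemma contDiffAt_radialExt {n : ℕ∞ω} {f : S2 → V} (hf : ContMDiff (𝓡 2) 𝓘(ℝ, V) n f) {y : E3}
    (hy : y ≠ 0) : ContDiffAt ℝ n (radialExt f) y :=
  ((hf _).comp y (contMDiffAt_radialProj hy)).contDiffAt

lemma sD_eq_fderiv (f : S2 → V) (x : S2) (u : E3) : sD f x u = fderiv ℝ (radialExt f) (x : E3) u :=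
  rfl

lemma fderiv_radialExt {f : S2 → V} {y : E3} (hy : y ≠ 0)
    (hf : DifferentiableAt ℝ (radialExt f) (radialProj y : E3)) (u : E3) :
    fderiv ℝ (radialExt f) y u = ‖y‖⁻¹ • sD f (radialProj y) u := by
  rw [coe_radialProj hy] at hf
  have hcomp : radialExt f ∘ (fun z : E3 => ‖y‖⁻¹ • z) = radialExt f :=
    funext fun z => radialExt_smul f (by positivity) z
  have hderiv := (congrArg (fderiv ℝ · y) hcomp).symm.trans
    (hf.hasFDerivAt.comp y ((hasFDerivAt_id y).const_smul ‖y‖⁻¹)).fderiv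
  rw [hderiv, sD_eq_fderiv, coe_radialProj hy]
  simp

lemma sD_self {f : S2 → V} {x : S2} (hf : DifferentiableAt ℝ (radialExt f) (x : E3)) :
    sD f x (x : E3) = 0 := by
  have hray : HasDerivAt (fun t : ℝ => t • (x : E3)) (x : E3) 1 := by
    simpa using (hasDerivAt_id (1 : ℝ)).smul_const (x : E3)
  have hext : HasFDerivAt (radialExt f) (fderiv ℝ (radialExt f) x) ((1 : ℝ) • (x : E3)) := by
    simpa using hf.hasFDerivAt
  refine (hext.comp_hasDerivAt 1 hray).unique ((hasDerivAt_const 1 (f x)).congr_of_eventuallyEq ?_)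
  filter_upwards [Ioi_mem_nhds (zero_lt_one' ℝ)] with t ht
  rw [Function.comp_apply, radialExt_smul f ht, radialExt_coe]

lemma continuous_fderiv_radialExt {f : S2 → V} (hf : ContMDiff (𝓡 2) 𝓘(ℝ, V) 1 f) :
    Continuous fun x : S2 => fderiv ℝ (radialExt f) (x : E3) :=
  continuous_iff_continuousAt.2 fun x =>
    ((contMDiff_iff_radialExt.1 hf x).continuousAt_fderiv one_ne_zero).comp
      (f := fun x : S2 => (x : E3)) continuous_subtype_val.continuousAt

lemma hasFDerivAt_radialProj_coe (x : S2) :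
    HasFDerivAt (fun z => (radialProj z : E3)) (.id ℝ E3 - (innerSL ℝ (x : E3)).smulRight (x : E3))
      (x : E3) := by
  have hnorm : HasFDerivAt (fun z : E3 => ‖z‖⁻¹) (-innerSL ℝ (x : E3)) (x : E3) := by
    have hsq : HasFDerivAt (fun z : E3 => ‖z‖ ^ 2) (2 • innerSL ℝ (x : E3)) (x : E3) :=
      (hasStrictFDerivAt_norm_sq (x : E3)).hasFDerivAt
    have hsqrt := ((Real.hasDerivAt_sqrt (x := ‖(x : E3)‖ ^ 2) (by simp)).inv
      (by simp)).comp_hasFDerivAt (x : E3) hsq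
    refine (hsqrt.congr_fderiv ?_).congr_of_eventuallyEq (.of_forall fun z => ?_)
    · ext u
      simp
    · simp
  refine ((hnorm.smul (hasFDerivAt_id (x : E3))).congr_fderiv ?_).congr_of_eventuallyEq
    ((eventually_ne_zero x).mono fun z => coe_radialProj)
  ext1 u
  simp [x.norm_eq, sub_eq_add_neg]

lemma sD_coe (x : S2) (u : E3) :
    sD (fun z : S2 => (z : E3)) x u = u - ⟪(x : E3), u⟫ • (x : E3) := by
  rw [sD, (hasFDerivAt_radialProj_coe x).fderiv]
  simp

end RadialExt

/-! ### The divergence theorem on the sphere -/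

/-- The divergence of a field along `S²`, computed from its radial extension. For a tangential field
this is the divergence of the round metric. -/
def sDiv (Z : S2 → E3) (x : S2) : ℝ := ∑ i, sD Z x (stdVec i) i

instance : IsFiniteMeasure roundArea := inferInstanceAs (IsFiniteMeasure (Measure.toSphere _))

lemma integrable_of_continuous {f : S2 → ℝ} (hf : Continuous f) : Integrable f roundArea :=
  hf.integrable_of_hasCompactSupport (HasCompactSupport.of_compactSpace f)

theorem integral_fderiv_apply_eq_zero {E : Type*} [NormedAddCommGroup E] [NormedSpace ℝ E]
    [FiniteDimensional ℝ E] [MeasurableSpace E] [BorelSpace E] (μ : Measure E) [μ.IsAddHaarMeasure]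
    {f : E → ℝ} (hf : ContDiff ℝ 1 f) (hc : HasCompactSupport f) (v : E) :
    ∫ y, fderiv ℝ f y v ∂μ = 0 := by
  have hcont : Continuous fun y => fderiv ℝ f y v :=
    (hf.continuous_fderiv one_ne_zero).clm_apply continuous_const
  have hparts := integral_mul_fderiv_eq_neg_fderiv_mul_of_integrable (μ := μ)
    (f := fun _ => (1 : ℝ)) (g := f) (v := v) (by simp)
    (by simpa using hcont.integrable_of_hasCompactSupport (hc.fderiv_apply ℝ v))
    (by simpa using hf.continuous.integrable_of_hasCompactSupport hc)
    (by fun_prop) (fun y _ => hf.differentiable one_ne_zero y)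
  simpa using hparts

lemma integral_sum_fderiv_apply_eq_zero {W : E3 → E3} (hW : ContDiff ℝ 1 W)
    (hc : HasCompactSupport W) : ∫ y, ∑ i, fderiv ℝ W y (stdVec i) i = 0 := by
  have hcomp : ∀ i y, fderiv ℝ W y (stdVec i) i = fderiv ℝ (fun z => W z i) y (stdVec i) := by
    intro i y
    have hy := (EuclideanSpace.proj i : E3 →L[ℝ] ℝ).hasFDerivAt.comp y
      (hW.differentiable one_ne_zero y).hasFDerivAt
    exact (congrArg (fun L : E3 →L[ℝ] ℝ => L (stdVec i)) hy.fderiv).symm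
  have hWi : ∀ i, ContDiff ℝ 1 fun z => W z i := fun i => by fun_prop
  have hci : ∀ i, HasCompactSupport fun z => W z i := fun i =>
    hc.comp_left (g := fun w : E3 => w i) rfl
  simp_rw [hcomp]
  rw [integral_finsetSum]
  · exact Finset.sum_eq_zero fun i _ => integral_fderiv_apply_eq_zero _ (hWi i) (hci i) _
  · exact fun i _ => (((hWi i).continuous_fderiv one_ne_zero).clm_apply
      continuous_const).integrable_of_hasCompactSupport ((hci i).fderiv_apply ℝ _)

theorem integral_radialExt_mul_norm (D : S2 → ℝ) (k : ℝ → ℝ) :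
    ∫ y, radialExt D y * k ‖y‖ = (∫ x, D x ∂roundArea) *
      ∫ r : Ioi (0 : ℝ), k r ∂(Measure.volumeIoiPow (Module.finrank ℝ E3 - 1)) := by
  calc ∫ y, radialExt D y * k ‖y‖
      = ∫ y : ({(0)}ᶜ : Set E3), radialExt D y * k ‖(y : E3)‖ ∂(volume.comap Subtype.val) := by
        rw [integral_subtype_comap (measurableSet_singleton (0 : E3)).compl
          fun y => radialExt D y * k ‖y‖, restrict_compl_singleton]
    _ = ∫ x : S2 × Ioi (0 : ℝ), D x.1 * k x.2 ∂roundArea.prod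
          (Measure.volumeIoiPow (Module.finrank ℝ E3 - 1)) := by
        rw [roundArea, ← Measure.measurePreserving_homeomorphUnitSphereProd
          (volume : Measure E3) |>.integral_comp (Homeomorph.measurableEmbedding _)]
        refine integral_congr_ae (.of_forall fun y => ?_)
        have hy : radialProj y = (homeomorphUnitSphereProd E3 y).1 :=
          Subtype.ext ((coe_radialProj y.2).trans (by simp))
        simp [radialExt, hy]
    _ = _ := integral_prod_mul D fun r : Ioi (0 : ℝ) => k r

/-- A bump function around `1`, which makes a cut-off of `ℝ³` supported in an annulus when evaluated
at `|y|²`. -/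
def annulusBump : ContDiffBump (1 : ℝ) := ⟨1 / 4, 1 / 2, by norm_num, by norm_num⟩

lemma contDiff_annulusBump_norm_sq : ContDiff ℝ 1 fun y : E3 => annulusBump (‖y‖ ^ 2) :=
  annulusBump.contDiff.comp (contDiff_norm_sq ℝ)

lemma annulusBump_norm_sq_eventuallyEq_zero :
    (fun y : E3 => annulusBump (‖y‖ ^ 2)) =ᶠ[𝓝 0] fun _ => 0 := by
  filter_upwards [ball_mem_nhds (0 : E3) one_half_pos] with y hy
  refine annulusBump.zero_of_le_dist ?_
  rw [mem_ball_zero_iff] at hy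
  rw [Real.dist_eq, abs_sub_comm]
  refine le_trans ?_ (le_abs_self _)
  change (1 / 2 : ℝ) ≤ _
  nlinarith [norm_nonneg y]

lemma hasCompactSupport_annulusBump_norm_sq :
    HasCompactSupport fun y : E3 => annulusBump (‖y‖ ^ 2) := by
  refine .of_support_subset_isCompact (isCompact_closedBall (0 : E3) 2) fun y hy => ?_
  have hy : ‖y‖ ^ 2 ∈ ball (1 : ℝ) (1 / 2) := annulusBump.support_eq ▸ hy
  rw [Real.ball_eq_Ioo, mem_Ioo] at hy
  rw [mem_closedBall_zero_iff]
  nlinarith [norm_nonneg y]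

lemma integral_annulusBump_norm_sq_pos : 0 < ∫ y : E3, annulusBump (‖y‖ ^ 2) := by
  refine contDiff_annulusBump_norm_sq.continuous.integral_pos_of_hasCompactSupport_nonneg_nonzero
    (x := stdVec 0) hasCompactSupport_annulusBump_norm_sq (fun y => annulusBump.nonneg) ?_
  rw [annulusBump.one_of_mem_closedBall (by simp [annulusBump])]
  exact one_ne_zero

/-- The field `b(|y|²) |y| Z(y / |y|)`, with `b` a bump function around `1`: a compactly supported
`C¹` extension of a tangential field whose divergence separates in polar coordinates. -/
def cutoffExt (Z : S2 → E3) (y : E3) : E3 := (annulusBump (‖y‖ ^ 2) * ‖y‖) • radialExt Z y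

lemma contDiff_cutoffExt {Z : S2 → E3} (hZ : ContMDiff (𝓡 2) 𝓘(ℝ, E3) 1 Z) :
    ContDiff ℝ 1 (cutoffExt Z) := by
  refine contDiff_iff_contDiffAt.2 fun y => ?_
  by_cases hy : y = 0
  · refine (contDiffAt_const (c := (0 : E3))).congr_of_eventuallyEq ?_
    rw [hy]
    filter_upwards [annulusBump_norm_sq_eventuallyEq_zero] with z hz
    rw [cutoffExt, hz, zero_mul, zero_smul]
  · exact (contDiff_annulusBump_norm_sq.contDiffAt.mul (contDiffAt_norm ℝ hy)).smul
      (contDiffAt_radialExt hZ hy)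

lemma exists_hasFDerivAt_annulusBump_mul_norm {y : E3} (hy : y ≠ 0) :
    ∃ c : ℝ, HasFDerivAt (fun z : E3 => annulusBump (‖z‖ ^ 2) * ‖z‖) (c • innerSL ℝ y) y := by
  have hsq : HasFDerivAt (fun z : E3 => ‖z‖ ^ 2) (2 • innerSL ℝ y) y :=
    (hasStrictFDerivAt_norm_sq y).hasFDerivAt
  have hscalar : DifferentiableAt ℝ (fun t => annulusBump t * √t) (‖y‖ ^ 2) :=
    (annulusBump.contDiff (n := 1)).differentiable one_ne_zero _ |>.mul
      (Real.hasDerivAt_sqrt (by positivity)).differentiableAt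
  refine ⟨deriv (fun t => annulusBump t * √t) (‖y‖ ^ 2) * 2,
    ((hscalar.hasDerivAt.comp_hasFDerivAt y hsq).congr_fderiv ?_).congr_of_eventuallyEq
      (.of_forall fun z => ?_)⟩
  · ext u
    simp [mul_assoc]
  · simp

/-- The scalar factor of `cutoffExt` is radial, so its gradient is orthogonal to `Z`. -/
lemma sum_fderiv_cutoffExt {Z : S2 → E3} (hZ : ContMDiff (𝓡 2) 𝓘(ℝ, E3) 1 Z)
    (ht : ∀ x : S2, ⟪(x : E3), Z x⟫ = 0) (y : E3) :
    ∑ i, fderiv ℝ (cutoffExt Z) y (stdVec i) i = radialExt (sDiv Z) y * annulusBump (‖y‖ ^ 2) := by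
  by_cases hy : y = 0
  · have hzero : cutoffExt Z =ᶠ[𝓝 y] fun _ => 0 := by
      rw [hy]
      filter_upwards [annulusBump_norm_sq_eventuallyEq_zero] with z hz
      rw [cutoffExt, hz, zero_mul, zero_smul]
    have hbump : annulusBump (‖(0 : E3)‖ ^ 2) = 0 :=
      annulusBump_norm_sq_eventuallyEq_zero.self_of_nhds
    rw [hzero.fderiv_eq, hy, hbump]
    simp
  have hn : ‖y‖ ≠ 0 := norm_ne_zero_iff.2 hy
  have hyZ : ⟪y, radialExt Z y⟫ = 0 := by
    rw [← norm_smul_radialProj hy, real_inner_smul_left, norm_smul_radialProj hy, radialExt, ht,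
      mul_zero]
  obtain ⟨c, hc⟩ := exists_hasFDerivAt_annulusBump_mul_norm hy
  have hprod := hc.smul ((contDiffAt_radialExt hZ hy).differentiableAt one_ne_zero).hasFDerivAt
  have hsum : ∑ i, y i * radialExt Z y i = 0 := by
    simpa [PiLp.inner_apply, mul_comm] using hyZ
  calc ∑ i, fderiv ℝ (cutoffExt Z) y (stdVec i) i
      = ∑ i, (annulusBump (‖y‖ ^ 2) * sD Z (radialProj y) (stdVec i) i
          + c * (y i * radialExt Z y i)) := by
        refine Finset.sum_congr rfl fun i _ => ?_
        rw [show cutoffExt Z = (fun z : E3 => annulusBump (‖z‖ ^ 2) * ‖z‖) • radialExt Z from rfl,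
          hprod.fderiv]
        simp [fderiv_radialExt hy ((contMDiff_iff_radialExt.1 hZ _).differentiableAt one_ne_zero),
          EuclideanSpace.inner_single_right]
        field_simp
    _ = radialExt (sDiv Z) y * annulusBump (‖y‖ ^ 2) := by
        rw [Finset.sum_add_distrib, ← Finset.mul_sum, ← Finset.mul_sum, hsum, radialExt, sDiv]
        ring

theorem integral_sDiv_eq_zero {Z : S2 → E3} (hZ : ContMDiff (𝓡 2) 𝓘(ℝ, E3) 1 Z)
    (ht : ∀ x : S2, ⟪(x : E3), Z x⟫ = 0) : ∫ x, sDiv Z x ∂roundArea = 0 := by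
  have hcompact : HasCompactSupport (cutoffExt Z) :=
    (hasCompactSupport_annulusBump_norm_sq.mul_right (f' := fun y => ‖y‖)).smul_right
  have hzero := integral_sum_fderiv_apply_eq_zero (contDiff_cutoffExt hZ) hcompact
  have hone := integral_radialExt_mul_norm (fun _ => 1) fun r => annulusBump (r ^ 2)
  have hpos := integral_annulusBump_norm_sq_pos
  simp_rw [sum_fderiv_cutoffExt hZ ht] at hzero
  rw [integral_radialExt_mul_norm (sDiv Z) fun r => annulusBump (r ^ 2)] at hzero
  refine (mul_eq_zero.1 hzero).resolve_right fun hr => hpos.ne' ?_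
  simp only [radialExt, one_mul] at hone
  exact hone.trans (by rw [hr, mul_zero])

lemma continuous_sDiv {Z : S2 → E3} (hZ : ContMDiff (𝓡 2) 𝓘(ℝ, E3) 1 Z) : Continuous (sDiv Z) := by
  have hderiv := continuous_fderiv_radialExt hZ
  change Continuous fun x : S2 => ∑ i, fderiv ℝ (radialExt Z) (x : E3) (stdVec i) i
  fun_prop

/-! ### Bilinear forms of matrices and their derivatives -/

section Form

variable (m : Matrix (Fin 3) (Fin 3) ℝ) (u u' v v' : E3) (c : ℝ)

lemma form_eq_dotProduct : form m u v = u.ofLp ⬝ᵥ m.mulVec v.ofLp := by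
  simp only [form, dotProduct, Matrix.mulVec, Finset.mul_sum]
  exact Finset.sum_congr rfl fun i _ => Finset.sum_congr rfl fun j _ => by ring

lemma form_add_left : form m (u + u') v = form m u v + form m u' v := by
  simp [form_eq_dotProduct, add_dotProduct]

lemma form_add_right : form m u (v + v') = form m u v + form m u v' := by
  simp [form_eq_dotProduct, Matrix.mulVec_add]

lemma form_smul_left : form m (c • u) v = c * form m u v := by
  simp [form_eq_dotProduct, smul_dotProduct]

lemma form_smul_right : form m u (c • v) = c * form m u v := by
  simp [form_eq_dotProduct, Matrix.mulVec_smul]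

lemma form_neg_left : form m (-u) v = -form m u v := by
  simp [form_eq_dotProduct]

lemma form_sub_left : form m (u - u') v = form m u v - form m u' v := by
  simp [form_eq_dotProduct, sub_dotProduct]

lemma form_sub_right : form m u (v - v') = form m u v - form m u v' := by
  simp [form_eq_dotProduct, Matrix.mulVec_sub]

@[simp] lemma form_zero_left : form m 0 v = 0 := by simp [form_eq_dotProduct]

@[simp] lemma form_zero_right : form m u 0 = 0 := by simp [form_eq_dotProduct]

lemma form_stdVec (i j : Fin 3) : form m (stdVec i) (stdVec j) = m i j := by
  simp [form_eq_dotProduct]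

variable {m}

lemma form_symm (hm : m.IsSymm) : form m u v = form m v u := by
  rw [form_eq_dotProduct, form_eq_dotProduct, Matrix.dotProduct_mulVec, dotProduct_comm,
    ← Matrix.mulVec_transpose, hm.eq]

lemma isSymm_of_posDef (hm : m.PosDef) : m.IsSymm := by
  simpa [Matrix.IsHermitian, Matrix.IsSymm] using hm.isHermitian

variable {u u'}

lemma form_pos (hm : m.PosDef) (hu : u ≠ 0) : 0 < form m u u := by
  rw [form_eq_dotProduct]
  simpa using hm.dotProduct_mulVec_pos (x := u.ofLp) (by simpa using hu)

lemma eq_of_form_eq (hm : m.PosDef) (h : ∀ w, form m u w = form m u' w) : u = u' := by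
  by_contra hne
  refine (form_pos hm (sub_ne_zero.2 hne)).ne' ?_
  rw [form_sub_left, h, sub_self]

variable (m) in
lemma linearIndependent_of_form_eq_zero {ι : Type*} {b : ι → E3}
    (hpos : ∀ i, 0 < form m (b i) (b i)) (hb : Pairwise fun i j => form m (b i) (b j) = 0) :
    LinearIndependent ℝ b :=
  LinearMap.linearIndependent_of_isOrthoᵢ (B := LinearMap.mk₂ ℝ (form m) (form_add_left m)
    (fun c u v => form_smul_left m u v c) (form_add_right m) fun c u v => form_smul_right m u v c)
    hb fun i => (hpos i).ne'

end Form

section FormDeriv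

variable {E : Type*} [NormedAddCommGroup E] [NormedSpace ℝ E] {t : Set E} {x : E}
  {M : E → Matrix (Fin 3) (Fin 3) ℝ} {P Q : E → E3}

/-- The derivative of a matrix field within `t` at `x` in the direction `w`. -/
def dMat (t : Set E) (M : E → Matrix (Fin 3) (Fin 3) ℝ) (x w : E) : Matrix (Fin 3) (Fin 3) ℝ :=
  Matrix.of fun i j => fderivWithin ℝ (fun y => M y i j) t x w

lemma form_dMat_add (x a b : E) (u v : E3) :
    form (dMat t M x (a + b)) u v = form (dMat t M x a) u v + form (dMat t M x b) u v := by
  simp only [form, dMat, Matrix.of_apply, map_add, add_mul, Finset.sum_add_distrib]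

lemma form_dMat_smul (x a : E) (c : ℝ) (u v : E3) :
    form (dMat t M x (c • a)) u v = c * form (dMat t M x a) u v := by
  simp only [form, dMat, Matrix.of_apply, map_smul, smul_eq_mul, mul_assoc, Finset.mul_sum]

lemma isSymm_dMat (hM : ∀ y ∈ t, (M y).IsSymm) (hx : x ∈ t) (w : E) :
    (dMat t M x w).IsSymm := by
  ext i j
  simp only [dMat, Matrix.transpose_apply, Matrix.of_apply]
  rw [fderivWithin_congr (fun y hy => (hM y hy).apply i j) ((hM x hx).apply i j)]

lemma dMat_comp {F : E → E3} {s : Set E3} {G : E3 → Matrix (Fin 3) (Fin 3) ℝ}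
    (hG : ∀ i j, DifferentiableWithinAt ℝ (fun q => G q i j) s (F x)) (hF : DifferentiableAt ℝ F x)
    (hFs : ∀ᶠ y in 𝓝 x, F y ∈ s) (w : E) :
    dMat univ (fun y => G (F y)) x w = dMat s G (F x) (fderiv ℝ F x w) := by
  ext i j
  have hij := (hG i j).hasFDerivWithinAt.comp_hasFDerivAt x hF.hasFDerivAt hFs
  simp only [dMat, Matrix.of_apply, fderivWithin_univ]
  exact congrArg (· w) hij.fderiv

lemma differentiableWithinAt_form (hM : ∀ i j, DifferentiableWithinAt ℝ (fun y => M y i j) t x)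
    (hP : DifferentiableWithinAt ℝ P t x) (hQ : DifferentiableWithinAt ℝ Q t x) :
    DifferentiableWithinAt ℝ (fun y => form (M y) (P y) (Q y)) t x := by
  unfold form
  fun_prop

lemma fderivWithin_form (ht : UniqueDiffWithinAt ℝ t x)
    (hM : ∀ i j, DifferentiableWithinAt ℝ (fun y => M y i j) t x)
    (hP : DifferentiableWithinAt ℝ P t x) (hQ : DifferentiableWithinAt ℝ Q t x) (w : E) :
    fderivWithin ℝ (fun y => form (M y) (P y) (Q y)) t x w =
      form (dMat t M x w) (P x) (Q x) + form (M x) (fderivWithin ℝ P t x w) (Q x)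
        + form (M x) (P x) (fderivWithin ℝ Q t x w) := by
  have hproj : ∀ {R : E → E3} (k : Fin 3), DifferentiableWithinAt ℝ R t x →
      HasFDerivWithinAt (fun y => R y k)
        ((EuclideanSpace.proj k : E3 →L[ℝ] ℝ).comp (fderivWithin ℝ R t x)) t x := fun k hR =>
    (EuclideanSpace.proj k : E3 →L[ℝ] ℝ).hasFDerivAt.comp_hasFDerivWithinAt x hR.hasFDerivWithinAt
  have hform := HasFDerivWithinAt.fun_sum (u := Finset.univ) fun i _ =>
    HasFDerivWithinAt.fun_sum (u := Finset.univ) fun j _ =>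
      ((hM i j).hasFDerivWithinAt.mul (hproj i hP)).mul (hproj j hQ)
  refine (congrArg (· w) (hform.fderivWithin ht)).trans ?_
  simp only [form, dMat, add_apply, smul_apply, smul_eq_mul, Matrix.of_apply, Pi.mul_apply,
    ContinuousLinearMap.comp_apply, PiLp.proj_apply, Fin.sum_univ_three]
  ring

/-- The vector-valued bilinear map whose components are the forms of the matrices `K k`. -/
def vecForm (K : Fin 3 → Matrix (Fin 3) (Fin 3) ℝ) (u v : E3) : E3 :=
  WithLp.toLp 2 fun k => form (K k) u v

@[simp] lemma vecForm_zero_left (K : Fin 3 → Matrix (Fin 3) (Fin 3) ℝ) (v : E3) :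
    vecForm K 0 v = 0 := by
  ext k
  simp [vecForm]

@[simp] lemma vecForm_zero_right (K : Fin 3 → Matrix (Fin 3) (Fin 3) ℝ) (u : E3) :
    vecForm K u 0 = 0 := by
  ext k
  simp [vecForm]

lemma vecForm_add_left (K : Fin 3 → Matrix (Fin 3) (Fin 3) ℝ) (u v w : E3) :
    vecForm K (u + v) w = vecForm K u w + vecForm K v w := by
  ext k
  simp [vecForm, form_add_left]

lemma vecForm_add_right (K : Fin 3 → Matrix (Fin 3) (Fin 3) ℝ) (u v w : E3) :
    vecForm K u (v + w) = vecForm K u v + vecForm K u w := by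
  ext k
  simp [vecForm, form_add_right]

lemma vecForm_smul_left (K : Fin 3 → Matrix (Fin 3) (Fin 3) ℝ) (u v : E3) (c : ℝ) :
    vecForm K (c • u) v = c • vecForm K u v := by
  ext k
  simp [vecForm, form_smul_left]

lemma vecForm_smul_right (K : Fin 3 → Matrix (Fin 3) (Fin 3) ℝ) (u v : E3) (c : ℝ) :
    vecForm K u (c • v) = c • vecForm K u v := by
  ext k
  simp [vecForm, form_smul_right]

variable {K : E → Fin 3 → Matrix (Fin 3) (Fin 3) ℝ}

lemma differentiableWithinAt_vecForm
    (hK : ∀ k i j, DifferentiableWithinAt ℝ (fun y => K y k i j) t x)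
    (hP : DifferentiableWithinAt ℝ P t x) (hQ : DifferentiableWithinAt ℝ Q t x) :
    DifferentiableWithinAt ℝ (fun y => vecForm (K y) (P y) (Q y)) t x :=
  differentiableWithinAt_euclidean.2 fun k => differentiableWithinAt_form (hK k) hP hQ

lemma fderivWithin_vecForm (ht : UniqueDiffWithinAt ℝ t x)
    (hK : ∀ k i j, DifferentiableWithinAt ℝ (fun y => K y k i j) t x)
    (hP : DifferentiableWithinAt ℝ P t x) (hQ : DifferentiableWithinAt ℝ Q t x) (w : E) :
    fderivWithin ℝ (fun y => vecForm (K y) (P y) (Q y)) t x w =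
      vecForm (fun k => dMat t (fun y => K y k) x w) (P x) (Q x)
        + vecForm (K x) (fderivWithin ℝ P t x w) (Q x)
        + vecForm (K x) (P x) (fderivWithin ℝ Q t x w) := by
  ext k
  have hk := (EuclideanSpace.proj k : E3 →L[ℝ] ℝ).hasFDerivAt.comp_hasFDerivWithinAt x
    (differentiableWithinAt_vecForm hK hP hQ).hasFDerivWithinAt
  exact (congrArg (· w) (hk.fderivWithin ht)).symm.trans (fderivWithin_form ht (hK k) hP hQ w)

end FormDeriv

lemma contDiffOn_inv_apply {G : E3 → Matrix (Fin 3) (Fin 3) ℝ} {s : Set E3} {k : ℕ∞ω}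
    (hG : ∀ i j, ContDiffOn ℝ k (fun x => G x i j) s) (hd : ∀ x ∈ s, (G x).det ≠ 0) (i j : Fin 3) :
    ContDiffOn ℝ k (fun x => (G x)⁻¹ i j) s := by
  have hdet : ContDiffOn ℝ k (fun x => (G x).det) s := by
    simp only [Matrix.det_fin_three]
    fun_prop
  have hadj : ContDiffOn ℝ k (fun x => (G x).adjugate i j) s := by
    simp only [Matrix.adjugate_fin_succ_eq_det_submatrix, Matrix.det_fin_two,
      Matrix.submatrix_apply]
    fun_prop
  simp only [Matrix.inv_def, Ring.inverse_eq_inv', Matrix.smul_apply, smul_eq_mul]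
  exact (hdet.inv hd).mul hadj

/-! ### The Levi-Civita connection and the curvature tensor -/

section Curvature

/-- `G` is a `C²` Riemannian metric on `s`, where `s` is such that derivatives within `s` are unique
and second derivatives symmetric. -/
structure IsMetricOn (s : Set E3) (G : E3 → Matrix (Fin 3) (Fin 3) ℝ) : Prop where
  uniqueDiffOn : UniqueDiffOn ℝ s
  subset_closure : s ⊆ closure (interior s)
  contDiffOn : ∀ i j, ContDiffOn ℝ 2 (fun x => G x i j) s
  posDef : ∀ x ∈ s, (G x).PosDef

variable (s : Set E3) (G : E3 → Matrix (Fin 3) (Fin 3) ℝ)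

/-- The second derivative of a matrix field, in the directions `b` (first) and `a`. -/
def ddMat (p a b : E3) : Matrix (Fin 3) (Fin 3) ℝ := dMat s (fun q => dMat s G q b) p a

/-- The Christoffel symbols with upper index `k`, as a matrix. -/
def christoffelMat (p : E3) (k : Fin 3) : Matrix (Fin 3) (Fin 3) ℝ :=
  Matrix.of fun i j => christoffel s G k i j p

/-- The derivative in the direction `a` of the Christoffel vector, its arguments being fixed. -/
def dChristoffelVec (p a u v : E3) : E3 :=
  vecForm (fun k => dMat s (fun q => christoffelMat s G q k) p a) u v

/-- The curvature tensor `R(a, b) c`. -/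
def riemannVec (p a b c : E3) : E3 :=
  dChristoffelVec s G p a b c - dChristoffelVec s G p b a c
    + christoffelVec s G p a (christoffelVec s G p b c)
    - christoffelVec s G p b (christoffelVec s G p a c)

lemma christoffelVec_eq_vecForm (p u v : E3) :
    christoffelVec s G p u v = vecForm (christoffelMat s G p) u v := rfl

lemma clm_apply_eq_sum (L : E3 →L[ℝ] ℝ) (w : E3) : L w = ∑ k, w k * L (stdVec k) := by
  conv_lhs => rw [← (EuclideanSpace.basisFun (Fin 3) ℝ).sum_repr w, map_sum]
  simp

lemma dMat_apply_eq_sum (p w : E3) (i j : Fin 3) :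
    dMat s G p w i j = ∑ k, w k * pd s k (fun y => G y i j) p :=
  clm_apply_eq_sum _ w

lemma curvNum_eq (p u v : E3) : curvNum s G p u v = form (G p) u (riemannVec s G p u v v) := by
  have hcomponents : ∀ l, riemannVec s G p u v v l =
      ∑ k, ∑ i, ∑ j, riemann s G l k i j p * u i * v j * v k := by
    intro l
    have hd : ∀ a b : E3, dChristoffelVec s G p a b v l = ∑ i, ∑ j,
        (∑ k, a k * pd s k (christoffel s G l i j) p) * b i * v j := fun a b => by
      simp only [dChristoffelVec, vecForm, form, dMat_apply_eq_sum]
      rfl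
    simp only [riemannVec, PiLp.add_apply, PiLp.sub_apply, hd, christoffelVec, riemann,
      Fin.sum_univ_three]
    ring
  simp only [curvNum, form, hcomponents, Finset.mul_sum]
  refine Finset.sum_congr rfl fun a _ => Finset.sum_congr rfl fun l _ => Finset.sum_congr rfl
    fun k _ => Finset.sum_congr rfl fun i _ => Finset.sum_congr rfl fun j _ => by ring

lemma riemannVec_antisymm (p a b c : E3) : riemannVec s G p a b c = -riemannVec s G p b a c := by
  simp only [riemannVec]
  abel

lemma riemannVec_add_smul (p a a' b c : E3) (r : ℝ) : riemannVec s G p (a + r • a') b c =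
    riemannVec s G p a b c + r • riemannVec s G p a' b c := by
  ext k
  simp only [riemannVec, dChristoffelVec, christoffelVec_eq_vecForm, vecForm, PiLp.add_apply,
    PiLp.sub_apply, PiLp.smul_apply, smul_eq_mul, form_dMat_add, form_dMat_smul, form_add_left,
    form_smul_left]
  simp only [form, Fin.sum_univ_three]
  ring

variable {s G} (h : IsMetricOn s G) {p : E3} (hp : p ∈ s)
include h hp

lemma IsMetricOn.isSymm : (G p).IsSymm := isSymm_of_posDef (h.posDef p hp)

lemma IsMetricOn.form_symm (u v : E3) : form (G p) u v = form (G p) v u :=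
  Balancing.form_symm u v (h.isSymm hp)

lemma IsMetricOn.form_dMat_symm (w u v : E3) : form (dMat s G p w) u v = form (dMat s G p w) v u :=
  Balancing.form_symm u v (isSymm_dMat (fun _ => h.isSymm) hp w)

lemma IsMetricOn.form_ddMat_symm (a b u v : E3) :
    form (ddMat s G p a b) u v = form (ddMat s G p a b) v u :=
  Balancing.form_symm u v
    (isSymm_dMat (fun _ hq => isSymm_dMat (fun _ => h.isSymm) hq b) hp a)

lemma IsMetricOn.differentiableWithinAt (i j : Fin 3) :
    DifferentiableWithinAt ℝ (fun q => G q i j) s p :=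
  (h.contDiffOn i j).differentiableOn two_ne_zero p hp

lemma lower_christoffel (m i j : Fin 3) :
    ((G p).mulVec fun k => christoffel s G k i j p) m =
      (1 / 2) * (pd s i (fun y => G y j m) p + pd s j (fun y => G y i m) p
        - pd s m (fun y => G y i j) p) := by
  have hraise : (fun k => christoffel s G k i j p) = (G p)⁻¹.mulVec fun l => (1 / 2) *
      (pd s i (fun y => G y j l) p + pd s j (fun y => G y i l) p
        - pd s l (fun y => G y i j) p) := by
    ext k
    simp only [christoffel, Matrix.mulVec, dotProduct, Finset.mul_sum]
    exact Finset.sum_congr rfl fun l _ => by ring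
  rw [hraise, Matrix.mulVec_mulVec, Matrix.mul_nonsing_inv _ (h.posDef p hp).det_pos.ne'.isUnit,
    Matrix.one_mulVec]

lemma form_christoffelVec (u v w : E3) :
    form (G p) (christoffelVec s G p u v) w = (1 / 2) * (form (dMat s G p u) v w
      + form (dMat s G p v) u w - form (dMat s G p w) u v) := by
  have hsum : form (G p) (christoffelVec s G p u v) w = ∑ m, ∑ i, ∑ j,
      ((G p).mulVec fun k => christoffel s G k i j p) m * u i * v j * w m := by
    rw [h.form_symm hp]
    simp only [form, christoffelVec, Matrix.mulVec, dotProduct, Fin.sum_univ_three]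
    ring
  rw [hsum, h.form_dMat_symm hp w u v]
  simp only [lower_christoffel h hp, form, dMat_apply_eq_sum, Fin.sum_univ_three]
  have hsymm : ∀ k i j, pd s k (fun y => G y i j) p = pd s k (fun y => G y j i) p := fun k i j => by
    rw [pd, pd, fderivWithin_congr (fun y hy => (h.isSymm hy).apply j i) ((h.isSymm hp).apply j i)]
  simp only [hsymm _ 1 0, hsymm _ 2 0, hsymm _ 2 1]
  ring

lemma christoffelVec_symm (u v : E3) : christoffelVec s G p u v = christoffelVec s G p v u := by
  refine eq_of_form_eq (h.posDef p hp) fun w => ?_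
  rw [form_christoffelVec h hp, form_christoffelVec h hp, h.form_dMat_symm hp w u v]
  ring

lemma form_dMat_eq_add (w u v : E3) :
    form (dMat s G p w) u v = form (G p) (christoffelVec s G p w u) v
      + form (G p) u (christoffelVec s G p w v) := by
  rw [h.form_symm hp u, form_christoffelVec h hp, form_christoffelVec h hp,
    h.form_dMat_symm hp w v u, h.form_dMat_symm hp u w v, h.form_dMat_symm hp v w u]
  ring

omit hp in
lemma IsMetricOn.contDiffOn_dMat (w : E3) (i j : Fin 3) :
    ContDiffOn ℝ 1 (fun q => dMat s G q w i j) s :=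
  ((h.contDiffOn i j).fderivWithin h.uniqueDiffOn (by norm_num)).clm_apply contDiffOn_const

omit hp in
lemma IsMetricOn.contDiffOn_christoffel (k i j : Fin 3) :
    ContDiffOn ℝ 1 (christoffel s G k i j) s := by
  have hpd : ∀ k i j, ContDiffOn ℝ 1 (pd s k fun y => G y i j) s := fun k i j =>
    h.contDiffOn_dMat (stdVec k) i j
  have hinv := fun l => contDiffOn_inv_apply (fun i j => (h.contDiffOn i j).of_le one_le_two)
    (fun x hx => (h.posDef x hx).det_pos.ne') k l
  exact contDiffOn_const.mul (ContDiffOn.sum fun l _ => (hinv l).mul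
    (((hpd i j l).add (hpd j i l)).sub (hpd l i j)))

lemma IsMetricOn.differentiableWithinAt_christoffelMat (k i j : Fin 3) :
    DifferentiableWithinAt ℝ (fun q => christoffelMat s G q k i j) s p :=
  (h.contDiffOn_christoffel k i j).differentiableOn one_ne_zero p hp

lemma IsMetricOn.ddMat_comm (a b : E3) : ddMat s G p a b = ddMat s G p b a := by
  ext i j
  have hd := ((h.contDiffOn i j).fderivWithin h.uniqueDiffOn (m := 1)
    (by norm_num)).differentiableOn one_ne_zero p hp
  have hswap : ∀ a b, ddMat s G p a b i j =
      fderivWithin ℝ (fderivWithin ℝ (fun z => G z i j) s) s p a b := fun a b => by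
    have := (hd.hasFDerivWithinAt.clm_apply (hasFDerivWithinAt_const b p s)).fderivWithin
      (h.uniqueDiffOn p hp)
    simpa [ddMat, dMat] using congrArg (· a) this
  rw [hswap, hswap]
  exact (h.contDiffOn i j p hp).isSymmSndFDerivWithinAt (by simp) h.uniqueDiffOn
    (h.subset_closure hp) hp a b

lemma form_dChristoffelVec (a b c d : E3) :
    form (G p) (dChristoffelVec s G p a b c) d =
      (1 / 2) * (form (ddMat s G p a b) c d + form (ddMat s G p a c) b d
        - form (ddMat s G p a d) b c)
      - form (dMat s G p a) (christoffelVec s G p b c) d := by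
  have hu := h.uniqueDiffOn p hp
  have hconst : ∀ w : E3, DifferentiableWithinAt ℝ (fun _ : E3 => w) s p := fun w => by fun_prop
  have hK := h.differentiableWithinAt_christoffelMat hp
  have hΓ := fderivWithin_vecForm hu hK (hconst b) (hconst c) a
  have hleft := fderivWithin_form hu (h.differentiableWithinAt hp)
    (differentiableWithinAt_vecForm hK (hconst b) (hconst c)) (hconst d) a
  have hdM := fun w i j => (h.contDiffOn_dMat w i j).differentiableOn one_ne_zero p hp
  have hdform : ∀ w u v, HasFDerivWithinAt (fun q => form (dMat s G q w) u v)
      (fderivWithin ℝ (fun q => form (dMat s G q w) u v) s p) s p := fun w u v =>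
    (differentiableWithinAt_form (hdM w) (hconst u) (hconst v)).hasFDerivWithinAt
  have hddform : ∀ w u v, fderivWithin ℝ (fun q => form (dMat s G q w) u v) s p a =
      form (ddMat s G p a w) u v := fun w u v => by
    simp [fderivWithin_form hu (hdM w) (hconst u) (hconst v), ddMat]
  have hright := ((((hdform b c d).add (hdform c b d)).sub (hdform d b c)).const_mul
    (1 / 2 : ℝ)).fderivWithin hu
  have hkoszul := congrArg (· a) ((fderivWithin_congr (𝕜 := ℝ) (s := s) (fun q hq =>
    form_christoffelVec h hq b c d) (form_christoffelVec h hp b c d)).trans hright)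
  simp only [smul_apply, add_apply, sub_apply, hddform, smul_eq_mul] at hkoszul
  rw [hΓ, ← christoffelVec_eq_vecForm] at hleft
  rw [← hkoszul]
  refine eq_sub_of_add_eq' ((Eq.symm ?_).trans hleft.symm)
  simp [dChristoffelVec]

lemma form_riemannVec (a b c d : E3) :
    form (G p) (riemannVec s G p a b c) d =
      (1 / 2) * (form (ddMat s G p a c) b d - form (ddMat s G p a d) b c
        - form (ddMat s G p b c) a d + form (ddMat s G p b d) a c)
      - form (G p) (christoffelVec s G p a d) (christoffelVec s G p b c)
      + form (G p) (christoffelVec s G p b d) (christoffelVec s G p a c) := by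
  simp only [riemannVec, form_add_left, form_sub_left, form_dChristoffelVec h hp,
    form_dMat_eq_add h hp]
  rw [h.ddMat_comm hp b a, h.form_symm hp (christoffelVec s G p b c),
    h.form_symm hp (christoffelVec s G p a c)]
  ring

lemma form_riemannVec_antisymm (a b c d : E3) :
    form (G p) (riemannVec s G p a b c) d = -form (G p) (riemannVec s G p a b d) c := by
  rw [form_riemannVec h hp, form_riemannVec h hp, h.form_symm hp (christoffelVec s G p a d),
    h.form_symm hp (christoffelVec s G p b d)]
  ring

lemma form_riemannVec_pair_symm (a b c d : E3) :
    form (G p) (riemannVec s G p a b c) d = form (G p) (riemannVec s G p c d a) b := by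
  rw [form_riemannVec h hp, form_riemannVec h hp, h.ddMat_comm hp c a, h.ddMat_comm hp c b,
    h.ddMat_comm hp d a, h.ddMat_comm hp d b, h.form_ddMat_symm hp a c d b,
    h.form_ddMat_symm hp b c d a, h.form_ddMat_symm hp a d c b, h.form_ddMat_symm hp b d c a,
    christoffelVec_symm h hp c b, christoffelVec_symm h hp d a, christoffelVec_symm h hp d b,
    christoffelVec_symm h hp c a, h.form_symm hp (christoffelVec s G p a d)]
  ring

variable {κ : ℝ} (hκ : HasConstCurv s G κ) {V U n : E3} (hU : U ≠ 0) (hV : V ≠ 0)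
  (hVU : form (G p) V U = 0) (hnU : form (G p) n U = 0) (hnV : form (G p) n V = 0)
include hκ hU hV hVU hnU hnV

lemma curvNum_add_smul_normal (t : ℝ) : curvNum s G p (V + t • n) U =
    κ * ((form (G p) V V + t ^ 2 * form (G p) n n) * form (G p) U U) := by
  have hUU := form_pos (h.posDef p hp) hU
  have hsq : form (G p) (V + t • n) (V + t • n) = form (G p) V V + t ^ 2 * form (G p) n n := by
    simp only [form_add_left, form_add_right, form_smul_left, form_smul_right, hnV,
      h.form_symm hp V n]
    ring
  have hperp : form (G p) (V + t • n) U = 0 := by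
    simp only [form_add_left, form_smul_left, hVU, hnU, mul_zero, add_zero]
  have hpos : 0 < form (G p) (V + t • n) (V + t • n) := by
    refine form_pos (h.posDef p hp) fun hzero => (form_pos (h.posDef p hp) hV).ne' ?_
    have := congrArg (form (G p) · V) hzero
    simpa only [form_add_left, form_smul_left, hnV, mul_zero, add_zero, form_zero_left] using this
  have hcurv := hκ p hp (V + t • n) U <| linearIndependent_of_form_eq_zero (G p)
    (by simp [Fin.forall_fin_two, hpos, hUU])
    (by simp [Pairwise, Fin.forall_fin_two, hperp, h.form_symm hp U])
  rw [hperp, div_eq_iff (by nlinarith [mul_pos hpos hUU])] at hcurv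
  rw [hcurv, hsq]
  ring

/-- Polarization: the sectional curvatures of the planes through `U` and `V ± n` agree. -/
lemma form_riemannVec_normal : form (G p) (riemannVec s G p V U n) U = 0 := by
  have hplus := curvNum_add_smul_normal h hp hκ hU hV hVU hnU hnV 1
  have hminus := curvNum_add_smul_normal h hp hκ hU hV hVU hnU hnV (-1)
  have hnUUV : form (G p) V (riemannVec s G p n U U) = -form (G p) (riemannVec s G p V U n) U := by
    rw [h.form_symm hp, form_riemannVec_pair_symm h hp, riemannVec_antisymm, form_neg_left]
  have hVUUn : form (G p) n (riemannVec s G p V U U) = -form (G p) (riemannVec s G p V U n) U := by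
    rw [h.form_symm hp, form_riemannVec_antisymm h hp]
  rw [curvNum_eq, riemannVec_add_smul] at hplus hminus
  simp only [form_add_left, form_add_right, form_smul_left, form_smul_right, hnUUV, hVUUn]
    at hplus hminus
  linarith

end Curvature

/-! ### Covariant derivatives along a map -/

section Along

/-- The covariant derivative, in direction `u`, of a vector field `P` along a map `F`. -/
def cov (s : Set E3) (G : E3 → Matrix (Fin 3) (Fin 3) ℝ) (F P : E3 → E3) (y u : E3) : E3 :=
  fderiv ℝ P y u + christoffelVec s G (F y) (fderiv ℝ F y u) (P y)

/-- The traceless shape operator `c ↦ ∇_c n - ½ H dF(c)` of a map `F` with unit normal `n` and mean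
curvature `H`. -/
def tracelessShape (s : Set E3) (G : E3 → Matrix (Fin 3) (Fin 3) ℝ) (F n : E3 → E3) (H : E3 → ℝ)
    (y c : E3) : E3 :=
  cov s G F n y c + (-(1 / 2) * H y) • fderiv ℝ F y c

variable {s : Set E3} {G : E3 → Matrix (Fin 3) (Fin 3) ℝ} {F P Q : E3 → E3} {y : E3}

lemma differentiableAt_fderiv_apply {f : E3 → E3} (hf : ContDiffAt ℝ 2 f y) (b : E3) :
    DifferentiableAt ℝ (fun z => fderiv ℝ f z b) y :=
  ((hf.fderiv_right (m := 1) (by norm_num)).differentiableAt one_ne_zero).clm_apply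
    (differentiableAt_const b)

lemma fderiv_fderiv_apply_comm {f : E3 → E3} (hf : ContDiffAt ℝ 2 f y) (a b : E3) :
    fderiv ℝ (fun z => fderiv ℝ f z b) y a = fderiv ℝ (fun z => fderiv ℝ f z a) y b := by
  have hd := (hf.fderiv_right (m := 1) (by norm_num)).differentiableAt one_ne_zero
  have happly : ∀ a b, fderiv ℝ (fun z => fderiv ℝ f z b) y a = fderiv ℝ (fderiv ℝ f) y a b :=
    fun a b => by simp [fderiv_clm_apply hd (differentiableAt_const b)]
  rw [happly, happly, hf.isSymmSndFDerivAt (by simp) a b]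

lemma cov_add (hP : DifferentiableAt ℝ P y) (hQ : DifferentiableAt ℝ Q y) (u : E3) :
    cov s G F (fun z => P z + Q z) y u = cov s G F P y u + cov s G F Q y u := by
  simp only [cov, fderiv_fun_add hP hQ, add_apply, christoffelVec_eq_vecForm, vecForm_add_right]
  abel

lemma cov_smul {f : E3 → ℝ} (hf : DifferentiableAt ℝ f y) (hP : DifferentiableAt ℝ P y) (u : E3) :
    cov s G F (fun z => f z • P z) y u = fderiv ℝ f y u • P y + f y • cov s G F P y u := by
  simp only [cov, fderiv_fun_smul hf hP, add_apply, smul_apply,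
    ContinuousLinearMap.smulRight_apply, christoffelVec_eq_vecForm, vecForm_smul_right]
  module

section Compatibility

variable (hM : IsMetricOn s G) (hF : DifferentiableAt ℝ F y) (hFs : ∀ᶠ z in 𝓝 y, F z ∈ s)
  (hP : DifferentiableAt ℝ P y) (hQ : DifferentiableAt ℝ Q y)
include hM hF hFs hP hQ

lemma fderiv_form_comp (u : E3) : fderiv ℝ (fun z => form (G (F z)) (P z) (Q z)) y u =
    form (G (F y)) (cov s G F P y u) (Q y) + form (G (F y)) (P y) (cov s G F Q y u) := by
  have hy : F y ∈ s := hFs.self_of_nhds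
  have hG : ∀ i j, DifferentiableWithinAt ℝ (fun z => G (F z) i j) univ y := fun i j =>
    ((hM.differentiableWithinAt hy i j).hasFDerivWithinAt.comp_hasFDerivAt y hF.hasFDerivAt
      hFs).differentiableAt.differentiableWithinAt
  have := fderivWithin_form uniqueDiffWithinAt_univ hG hP.differentiableWithinAt
    hQ.differentiableWithinAt u
  rw [dMat_comp (hM.differentiableWithinAt hy) hF hFs, form_dMat_eq_add hM hy] at this
  simp only [fderivWithin_univ] at this
  rw [this, cov, cov, form_add_left, form_add_right]
  ring

lemma form_cov_add_eq_zero {c : ℝ} (h : ∀ᶠ z in 𝓝 y, form (G (F z)) (P z) (Q z) = c) (u : E3) :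
    form (G (F y)) (cov s G F P y u) (Q y) + form (G (F y)) (P y) (cov s G F Q y u) = 0 := by
  rw [← fderiv_form_comp hM hF hFs hP hQ, EventuallyEq.fderiv_eq (f := fun _ => c) h]
  simp

lemma form_cov_self_eq
    (h : ∀ᶠ z in 𝓝 y, form (G (F z)) (P z) (P z) = form (G (F z)) (Q z) (Q z)) (u : E3) :
    form (G (F y)) (cov s G F P y u) (P y) = form (G (F y)) (cov s G F Q y u) (Q y) := by
  have hy : F y ∈ s := hFs.self_of_nhds
  have hfderiv := congrArg (· u) (EventuallyEq.fderiv_eq (𝕜 := ℝ) h)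
  simp only [fderiv_form_comp hM hF hFs hP hP, fderiv_form_comp hM hF hFs hQ hQ] at hfderiv
  rw [hM.form_symm hy (P y), hM.form_symm hy (Q y)] at hfderiv
  linarith

lemma differentiableAt_christoffelVec_comp :
    DifferentiableAt ℝ (fun z => christoffelVec s G (F z) (P z) (Q z)) y :=
  (differentiableWithinAt_vecForm (K := fun z => christoffelMat s G (F z)) (t := univ)
    (fun k i j => ((hM.differentiableWithinAt_christoffelMat hFs.self_of_nhds k i
      j).hasFDerivWithinAt.comp_hasFDerivAt y hF.hasFDerivAt
        hFs).differentiableAt.differentiableWithinAt)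
    hP.differentiableWithinAt hQ.differentiableWithinAt).differentiableAt univ_mem

lemma fderiv_christoffelVec_comp (u : E3) :
    fderiv ℝ (fun z => christoffelVec s G (F z) (P z) (Q z)) y u =
      dChristoffelVec s G (F y) (fderiv ℝ F y u) (P y) (Q y)
        + christoffelVec s G (F y) (fderiv ℝ P y u) (Q y)
        + christoffelVec s G (F y) (P y) (fderiv ℝ Q y u) := by
  have hK := hM.differentiableWithinAt_christoffelMat hFs.self_of_nhds
  have := fderivWithin_vecForm (K := fun z => christoffelMat s G (F z)) uniqueDiffWithinAt_univ
    (fun k i j => ((hK k i j).hasFDerivWithinAt.comp_hasFDerivAt y hF.hasFDerivAt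
      hFs).differentiableAt.differentiableWithinAt)
    hP.differentiableWithinAt hQ.differentiableWithinAt u
  simp only [fderivWithin_univ, ← christoffelVec_eq_vecForm] at this
  rw [this, dChristoffelVec]
  simp only [dMat_comp (G := fun q => christoffelMat s G q _) (hK _) hF hFs]

end Compatibility

section Ricci

variable (hM : IsMetricOn s G) (hF : ContDiffAt ℝ 2 F y) (hFs : ∀ᶠ z in 𝓝 y, F z ∈ s)
include hM hF hFs

lemma cov_fderiv_comm (a b : E3) :
    cov s G F (fun z => fderiv ℝ F z b) y a = cov s G F (fun z => fderiv ℝ F z a) y b := by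
  rw [cov, cov, fderiv_fderiv_apply_comm hF, christoffelVec_symm hM hFs.self_of_nhds]

variable {n : E3 → E3} (hn : ContDiffAt ℝ 2 n y)
include hn

lemma differentiableAt_cov (b : E3) : DifferentiableAt ℝ (fun z => cov s G F n z b) y :=
  (differentiableAt_fderiv_apply hn b).add (differentiableAt_christoffelVec_comp hM
    (hF.differentiableAt two_ne_zero) hFs (differentiableAt_fderiv_apply hF b)
    (hn.differentiableAt two_ne_zero))

lemma ricci_identity (a b : E3) :
    cov s G F (fun z => cov s G F n z b) y a - cov s G F (fun z => cov s G F n z a) y b =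
      riemannVec s G (F y) (fderiv ℝ F y a) (fderiv ℝ F y b) (n y) := by
  have hF1 := hF.differentiableAt two_ne_zero
  have hn1 := hn.differentiableAt two_ne_zero
  have hcov : ∀ a b, fderiv ℝ (fun z => cov s G F n z b) y a =
      fderiv ℝ (fun z => fderiv ℝ n z b) y a
        + (dChristoffelVec s G (F y) (fderiv ℝ F y a) (fderiv ℝ F y b) (n y)
        + christoffelVec s G (F y) (fderiv ℝ (fun z => fderiv ℝ F z b) y a) (n y)
        + christoffelVec s G (F y) (fderiv ℝ F y b) (fderiv ℝ n y a)) := fun a b => by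
    have hdF := differentiableAt_fderiv_apply hF b
    rw [← fderiv_christoffelVec_comp hM hF1 hFs hdF hn1, ← add_apply, ← fderiv_fun_add
      (differentiableAt_fderiv_apply hn b)
      (differentiableAt_christoffelVec_comp hM hF1 hFs hdF hn1)]
    rfl
  rw [cov, cov.eq_def s G F (fun z => cov s G F n z a), hcov a b, hcov b a,
    fderiv_fderiv_apply_comm hn b a,
    fderiv_fderiv_apply_comm hF b a, riemannVec]
  simp only [cov, christoffelVec_eq_vecForm, vecForm_add_right]
  abel

variable {H : E3 → ℝ} (hH : DifferentiableAt ℝ H y)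
include hH

lemma differentiableAt_tracelessShape (c : E3) :
    DifferentiableAt ℝ (fun z => tracelessShape s G F n H z c) y :=
  (differentiableAt_cov hM hF hFs hn c).add
    ((hH.const_mul _).smul (differentiableAt_fderiv_apply hF c))

lemma codazzi_tracelessShape (a b : E3) :
    cov s G F (fun z => tracelessShape s G F n H z b) y a
        - cov s G F (fun z => tracelessShape s G F n H z a) y b =
      riemannVec s G (F y) (fderiv ℝ F y a) (fderiv ℝ F y b) (n y)
        - (1 / 2 * fderiv ℝ H y a) • fderiv ℝ F y b
        + (1 / 2 * fderiv ℝ H y b) • fderiv ℝ F y a := by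
  have hcov : ∀ a b, cov s G F (fun z => tracelessShape s G F n H z b) y a =
      cov s G F (fun z => cov s G F n z b) y a + ((-(1 / 2) * fderiv ℝ H y a) • fderiv ℝ F y b
        + (-(1 / 2) * H y) • cov s G F (fun z => fderiv ℝ F z b) y a) := fun a b => by
    have hdF := differentiableAt_fderiv_apply hF b
    have hH2 := hH.const_mul (-(1 / 2))
    simp only [tracelessShape]
    rw [cov_add (differentiableAt_cov hM hF hFs hn b) (hH2.fun_smul hdF), cov_smul hH2 hdF,
      fderiv_const_mul hH]
    rfl
  rw [hcov a b, hcov b a, ← ricci_identity hM hF hFs hn, cov_fderiv_comm hM hF hFs b a]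
  module

end Ricci

section FrameAlgebra

variable {m : Matrix (Fin 3) (Fin 3) ℝ} (hm : m.PosDef) {V U n : E3} {l : ℝ} (hl : 0 < l)
  (hVV : form m V V = l) (hUU : form m U U = l) (hnn : form m n n = 1) (hUV : form m U V = 0)
  (hnU : form m n U = 0) (hnV : form m n V = 0)
include hm hl hVV hUU hnn hUV hnU hnV

lemma eq_zero_of_form_orthogonal_eq_zero {r : E3} (hrV : form m r V = 0) (hrU : form m r U = 0)
    (hrn : form m r n = 0) : r = 0 := by
  have hs := fun u v => form_symm u v (isSymm_of_posDef hm)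
  have hli : LinearIndependent ℝ ![V, U, n] := by
    refine linearIndependent_of_form_eq_zero m (fun i => ?_) fun i j hij => ?_
    · fin_cases i <;> simp [hVV, hUU, hnn, hl]
    · fin_cases i <;> fin_cases j <;> simp_all
  refine eq_of_form_eq hm fun w => ?_
  have hw : w ∈ Submodule.span ℝ (range ![V, U, n]) := by
    rw [hli.span_eq_top_of_card_eq_finrank (by simp)]
    exact Submodule.mem_top
  rw [form_zero_left]
  induction hw using Submodule.span_induction with
  | mem w hw =>
    obtain ⟨i, rfl⟩ := hw
    fin_cases i <;> assumption
  | zero => exact form_zero_right m r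
  | add a b _ _ ha hb => rw [form_add_right, ha, hb, add_zero]
  | smul c a _ ha => rw [form_smul_right, ha, mul_zero]

lemma mul_form_eq_of_orthogonal {p : E3} (hpn : form m p n = 0) (q : E3) :
    l * form m p q = form m p V * form m q V + form m p U * form m q U := by
  have hs := fun u v => form_symm u v (isSymm_of_posDef hm)
  have hq : l • q - form m q V • V - form m q U • U - (l * form m q n) • n = 0 := by
    refine eq_zero_of_form_orthogonal_eq_zero hm hl hVV hUU hnn hUV hnU hnV ?_ ?_ ?_ <;>
      simp only [form_sub_left, form_smul_left, hVV, hUU, hUV, hnV, hnU, hnn, hs V U, hs V n,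
        hs U n] <;> ring
  have hform := congrArg (form m p) hq
  simp only [form_sub_right, form_smul_right, hpn, form_zero_right] at hform
  linarith

/-- Here `p`, `q` are the values at `V`, `U` of a traceless symmetric endomorphism, and `p'`, `q'`
those of an endomorphism commuting with the rotation `V ↦ U`. -/
lemma form_eq_form_of_traceless {p q p' q' : E3} (hpn : form m p n = 0) (hqn : form m q n = 0)
    (hsymm : form m p U = form m q V) (htrace : form m p V + form m q U = 0)
    (hdiag : form m p' V = form m q' U) (hoff : form m p' U = -form m q' V) :
    form m q p' = form m p q' := by
  have hq := mul_form_eq_of_orthogonal hm hl hVV hUU hnn hUV hnU hnV hqn p'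
  have hp := mul_form_eq_of_orthogonal hm hl hVV hUU hnn hUV hnU hnV hpn q'
  refine mul_left_cancel₀ hl.ne' ?_
  rw [hp, hq, hsymm, hoff, hdiag]
  linear_combination -form m q' V * htrace

end FrameAlgebra

section StructureEquation

variable (hM : IsMetricOn s G) (hF : ContDiffAt ℝ 2 F y) (hFs : ∀ᶠ z in 𝓝 y, F z ∈ s)
  {n U V : E3 → E3} {H : E3 → ℝ} (hn : ContDiffAt ℝ 2 n y) (hU : DifferentiableAt ℝ U y)
  (hH : DifferentiableAt ℝ H y)
include hM hF hFs hn hU hH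

lemma fderiv_form_tracelessShape_sub (a b : E3) :
    fderiv ℝ (fun z => form (G (F z)) (tracelessShape s G F n H z b) (U z)) y a
        - fderiv ℝ (fun z => form (G (F z)) (tracelessShape s G F n H z a) (U z)) y b =
      form (G (F y)) (riemannVec s G (F y) (fderiv ℝ F y a) (fderiv ℝ F y b) (n y)) (U y)
        - 1 / 2 * fderiv ℝ H y a * form (G (F y)) (fderiv ℝ F y b) (U y)
        + 1 / 2 * fderiv ℝ H y b * form (G (F y)) (fderiv ℝ F y a) (U y)
        + (form (G (F y)) (tracelessShape s G F n H y b) (cov s G F U y a)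
        - form (G (F y)) (tracelessShape s G F n H y a) (cov s G F U y b)) := by
  have hF1 := hF.differentiableAt two_ne_zero
  have hθ := differentiableAt_tracelessShape hM hF hFs hn hH
  have hcodazzi := congrArg (form (G (F y)) · (U y)) (codazzi_tracelessShape hM hF hFs hn hH a b)
  simp only [form_sub_left, form_add_left, form_smul_left] at hcodazzi
  rw [fderiv_form_comp hM hF1 hFs (hθ b) hU, fderiv_form_comp hM hF1 hFs (hθ a) hU]
  linear_combination hcodazzi

variable {κ : ℝ} (hκ : HasConstCurv s G κ) (hV : DifferentiableAt ℝ V y) {a b : E3}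
  (hVa : V y = fderiv ℝ F y a) (hUb : U y = fderiv ℝ F y b)
  (hnn : ∀ᶠ z in 𝓝 y, form (G (F z)) (n z) (n z) = 1)
  (hnV : form (G (F y)) (n y) (V y) = 0) (hnU : form (G (F y)) (n y) (U y) = 0)
  (hUV : ∀ᶠ z in 𝓝 y, form (G (F z)) (U z) (V z) = 0)
  (hUU : ∀ᶠ z in 𝓝 y, form (G (F z)) (U z) (U z) = form (G (F z)) (V z) (V z))
include hκ hV hVa hUb hnn hnV hnU hUV hUU

/-- The hypotheses are the conformal Killing equations for `V`, where `U` is `V` rotated by a right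
angle. For `ω(c) = g(∇_c n - ½ H dF(c), U)` the conclusion reads `dω(V, U) = -½ V(H) |V|²`. -/
theorem fderiv_form_tracelessShape_rotated
    (hconf : form (G (F y)) (cov s G F V y a) (V y) = form (G (F y)) (cov s G F V y b) (U y))
    (hconf' : form (G (F y)) (cov s G F V y a) (U y) = -form (G (F y)) (cov s G F V y b) (V y))
    (hsymm : form (G (F y)) (cov s G F n y a) (U y) = form (G (F y)) (cov s G F n y b) (V y))
    (htrace : form (G (F y)) (cov s G F n y a) (V y) + form (G (F y)) (cov s G F n y b) (U y) =
      H y * form (G (F y)) (V y) (V y)) (hV0 : V y ≠ 0) :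
    fderiv ℝ (fun z => form (G (F z)) (tracelessShape s G F n H z b) (U z)) y a
        - fderiv ℝ (fun z => form (G (F z)) (tracelessShape s G F n H z a) (U z)) y b =
      -(1 / 2) * fderiv ℝ H y a * form (G (F y)) (V y) (V y) := by
  have hy : F y ∈ s := hFs.self_of_nhds
  have hp := hM.posDef _ hy
  have hs := hM.form_symm hy
  have hF1 := hF.differentiableAt two_ne_zero
  have hn1 := hn.differentiableAt two_ne_zero
  have hl := form_pos hp hV0
  have hUV0 : form (G (F y)) (U y) (V y) = 0 := hUV.self_of_nhds
  have hUU0 : form (G (F y)) (U y) (U y) = form (G (F y)) (V y) (V y) := hUU.self_of_nhds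
  have hU0 : U y ≠ 0 := fun h =>
    hl.ne (by rw [← hUU0, h, form_zero_left])
  have hR := form_riemannVec_normal hM hy hκ hU0 hV0 (by rw [hs, hUV0]) hnU hnV
  have hcovUV := form_cov_add_eq_zero hM hF1 hFs hU hV hUV
  have hcovUU := form_cov_self_eq hM hF1 hFs hU hV hUU
  have hcovn := fun c => form_cov_add_eq_zero hM hF1 hFs hn1 hn1 hnn c
  have hθn : ∀ c, form (G (F y)) (n y) (fderiv ℝ F y c) = 0 →
      form (G (F y)) (tracelessShape s G F n H y c) (n y) = 0 := fun c hc => by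
    have := hcovn c
    rw [tracelessShape, form_add_left, form_smul_left, hs (fderiv ℝ F y c), hc]
    rw [hs (n y)] at this
    linarith
  have hpair : form (G (F y)) (tracelessShape s G F n H y b) (cov s G F U y a) =
      form (G (F y)) (tracelessShape s G F n H y a) (cov s G F U y b) := by
    have hUVa := hcovUV a
    have hUVb := hcovUV b
    rw [hs (U y)] at hUVa hUVb
    refine form_eq_form_of_traceless hp hl rfl hUU0 hnn.self_of_nhds hUV0 hnU hnV
      (hθn a (hVa ▸ hnV)) (hθn b (hUb ▸ hnU)) ?_ ?_ (by linarith [hcovUU b])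
      (by linarith [hcovUU a]) <;>
    simp only [tracelessShape, form_add_left, form_smul_left, ← hVa, ← hUb]
    · rw [hsymm, hs (V y), hUV0]
    · linear_combination htrace - 1 / 2 * H y * hUU0
  rw [fderiv_form_tracelessShape_sub hM hF hFs hn hU hH, ← hVa, ← hUb, hR, hpair, hs (V y) (U y),
    hUV0, hUU0]
  ring

end StructureEquation

end Along

/-! ### The cross product and the curl of a one-form on the sphere -/

section Cross

/-- The cross product as a continuous bilinear map on Euclidean three-space. -/
def cross : E3 →L[ℝ] E3 →L[ℝ] E3 :=
  (LinearMap.mk₂ ℝ (fun u v : E3 => (WithLp.toLp 2 (crossProduct u.ofLp v.ofLp) : E3))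
    (fun u u' v => by simp) (fun c u v => by simp) (fun u v v' => by simp)
    (fun c u v => by simp)).toContinuousBilinearMap

lemma ofLp_cross (u v : E3) : (cross u v).ofLp = crossProduct u.ofLp v.ofLp := rfl

lemma inner_eq_dotProduct (u v : E3) : ⟪u, v⟫ = u.ofLp ⬝ᵥ v.ofLp := by
  rw [EuclideanSpace.inner_eq_star_dotProduct, star_trivial, dotProduct_comm]

lemma inner_stdVec (w : E3) (i : Fin 3) : ⟪w, stdVec i⟫ = w i := by
  simp [EuclideanSpace.inner_single_right]

lemma inner_cross_self_left (u v : E3) : ⟪u, cross u v⟫ = 0 := by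
  rw [inner_eq_dotProduct, ofLp_cross, dot_self_cross]

lemma inner_cross_self_right (u v : E3) : ⟪v, cross u v⟫ = 0 := by
  rw [inner_eq_dotProduct, ofLp_cross, dot_cross_self]

lemma inner_cross_left (u v w : E3) : ⟪cross u v, w⟫ = ⟪u, cross v w⟫ := by
  simp only [inner_eq_dotProduct, ofLp_cross]
  rw [dotProduct_comm, triple_product_permutation]

lemma inner_cross_cross (u v w z : E3) :
    ⟪cross u v, cross w z⟫ = ⟪u, w⟫ * ⟪v, z⟫ - ⟪u, z⟫ * ⟪v, w⟫ := by
  simp only [inner_eq_dotProduct, ofLp_cross, cross_dot_cross]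

lemma cross_anticomm_apply (u v : E3) : cross u v = -cross v u := by
  ext1
  rw [WithLp.ofLp_neg, ofLp_cross, ofLp_cross, cross_anticomm]

lemma cross_cross_right (u v w : E3) : cross u (cross v w) = ⟪u, w⟫ • v - ⟪u, v⟫ • w := by
  refine ext_inner_left ℝ fun z => ?_
  rw [← inner_cross_left, inner_cross_cross, inner_sub_right, inner_smul_right, inner_smul_right]
  ring

lemma cross_eq_smul {x u v : E3} (hx : ⟪x, x⟫ = 1) (hu : ⟪x, u⟫ = 0) (hv : ⟪x, v⟫ = 0) :
    cross u v = ⟪x, cross u v⟫ • x := by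
  have hparallel : cross x (cross u v) = 0 := by simp [cross_cross_right, hu, hv]
  have hdouble := cross_cross_right x x (cross u v)
  rw [hparallel, map_zero, hx, one_smul] at hdouble
  exact (sub_eq_zero.1 hdouble.symm).symm

lemma inner_clm_sub_inner_clm (L : E3 →L[ℝ] E3) (u v : E3) :
    ⟪L u, v⟫ - ⟪L v, u⟫ = ∑ i, ⟪L (stdVec i), cross (cross u v) (stdVec i)⟫ := by
  have hexpand : ∀ u v, ⟪L u, v⟫ = ∑ i, u i * ⟪L (stdVec i), v⟫ := fun u v => by
    simpa [real_inner_comm] using clm_apply_eq_sum ((innerSL ℝ v).comp L) u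
  rw [hexpand u, hexpand v, ← Finset.sum_sub_distrib]
  refine Finset.sum_congr rfl fun i _ => ?_
  rw [cross_anticomm_apply, cross_cross_right, neg_sub, inner_sub_right, inner_smul_right,
    inner_smul_right]
  simp only [real_inner_comm, inner_stdVec]

variable {η : S2 → E3} {x : S2}

lemma sD_cross_coe (hη : DifferentiableAt ℝ (radialExt η) (x : E3)) (w : E3) :
    sD (fun z : S2 => cross (η z) (z : E3)) x w =
      cross (sD η x w) (x : E3) + cross (η x) (w - ⟪(x : E3), w⟫ • (x : E3)) := by
  have hderiv := (cross.hasFDerivAt.comp (x : E3) hη.hasFDerivAt).clm_apply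
    (hasFDerivAt_radialProj_coe x)
  refine (congrArg (· w) hderiv.fderiv).trans ?_
  simp [add_comm, sD_eq_fderiv]

/-- The divergence of `η × x` is the normal component of the curl of `η`. -/
lemma inner_cross_mul_sDiv_cross (hη : DifferentiableAt ℝ (radialExt η) (x : E3)) {u v : E3}
    (hu : ⟪(x : E3), u⟫ = 0) (hv : ⟪(x : E3), v⟫ = 0) :
    ⟪(x : E3), cross u v⟫ * sDiv (fun z => cross (η z) (z : E3)) x =
      ⟪sD η x u, v⟫ - ⟪sD η x v, u⟫ := by
  have hnormal : ∑ i, ⟪cross (η x) (stdVec i - ⟪(x : E3), stdVec i⟫ • (x : E3)), stdVec i⟫ = 0 := by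
    have hterm : ∀ i, ⟪cross (η x) (stdVec i - ⟪(x : E3), stdVec i⟫ • (x : E3)), stdVec i⟫ =
        -((x : E3) i * cross (η x) (x : E3) i) := fun i => by
      rw [map_sub, map_smul, inner_sub_left, real_inner_comm, inner_cross_self_right,
        inner_smul_left, inner_stdVec, inner_stdVec, zero_sub]
      rfl
    have hperp := inner_cross_self_right (η x) (x : E3)
    rw [inner_eq_dotProduct] at hperp
    rw [Finset.sum_congr rfl fun i _ => hterm i, Finset.sum_neg_distrib, neg_eq_zero]
    exact hperp
  have hdiv : sDiv (fun z => cross (η z) (z : E3)) x =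
      ∑ i, ⟪sD η x (stdVec i), cross (x : E3) (stdVec i)⟫ := by
    simp only [sDiv, sD_cross_coe hη, ← inner_stdVec, inner_add_left, Finset.sum_add_distrib]
    rw [hnormal, add_zero]
    simp only [inner_cross_left]
  simp only [sD_eq_fderiv] at hdiv ⊢
  rw [inner_clm_sub_inner_clm, cross_eq_smul x.inner_self hu hv, hdiv, Finset.mul_sum]
  simp only [map_smul, smul_apply, inner_smul_right, x.inner_self, mul_one]

end Cross

/-! ### Traces and determinants in a frame -/

/-- The Gram determinant of `u, v` with respect to the bilinear form of `m`. -/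
def gramDet (m : Matrix (Fin 3) (Fin 3) ℝ) (u v : E3) : ℝ :=
  form m u u * form m v v - form m u v ^ 2

/-- The mixed discriminant of the forms of `m` and `q` on the pair `u, v`. It polarizes `gramDet`,
and dividing it by `gramDet m u v` gives the trace of `q` with respect to `m` on the span of
`u, v`. -/
def mixedDisc (m q : Matrix (Fin 3) (Fin 3) ℝ) (u v : E3) : ℝ :=
  form q u u * form m v v + form q v v * form m u u - 2 * form q u v * form m u v

/-- The matrix of the form of `m` in the frame of the tangent plane at `x`. -/
def frameGram (m : Matrix (Fin 3) (Fin 3) ℝ) (x : S2) :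
    Matrix (Fin (Module.finrank ℝ (ℝ ∙ (x : E3))ᗮ)) (Fin (Module.finrank ℝ (ℝ ∙ (x : E3))ᗮ)) ℝ :=
  Matrix.of fun a b => form m (frame x a) (frame x b)

/-- The trace of `q` with respect to `m` on the tangent plane at `x`. -/
def frameTrace (m q : Matrix (Fin 3) (Fin 3) ℝ) (x : S2) : ℝ :=
  Matrix.trace ((frameGram m x)⁻¹ * frameGram q x)

lemma finrank_tangent (x : S2) : Module.finrank ℝ (ℝ ∙ (x : E3))ᗮ = 2 :=
  Submodule.finrank_orthogonal_span_singleton x.ne_zero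

/-- The frame of the tangent plane at `x`, indexed by `Fin 2`. -/
def frameVec (x : S2) (i : Fin 2) : E3 :=
  frame x (finCongr (finrank_tangent x).symm i)

lemma inner_coe_of_mem_tangent {x : S2} (u : (ℝ ∙ (x : E3))ᗮ) : ⟪(x : E3), (u : E3)⟫ = 0 :=
  Submodule.mem_orthogonal_singleton_iff_inner_right.1 u.2

lemma inner_coe_frameVec (x : S2) (i : Fin 2) : ⟪(x : E3), frameVec x i⟫ = 0 :=
  inner_coe_of_mem_tangent _

lemma orthonormal_frameVec (x : S2) : Orthonormal ℝ (frameVec x) :=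
  ((frame x).orthonormal.comp_linearIsometry (ℝ ∙ (x : E3))ᗮ.subtypeₗᵢ).comp _
    (finCongr (finrank_tangent x).symm).injective

lemma eq_sum_frameVec (x : S2) (u : E3) : u = ⟪(x : E3), u⟫ • (x : E3) +
    (⟪frameVec x 0, u⟫ • frameVec x 0 + ⟪frameVec x 1, u⟫ • frameVec x 1) := by
  have hu : u - ⟪(x : E3), u⟫ • (x : E3) ∈ (ℝ ∙ (x : E3))ᗮ := by
    rw [Submodule.mem_orthogonal_singleton_iff_inner_right, inner_sub_right,
      real_inner_smul_right, x.inner_self, mul_one, sub_self]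
  have hrepr := congrArg Subtype.val ((frame x).sum_repr' ⟨_, hu⟩)
  rw [← (finCongr (finrank_tangent x).symm).sum_comp, Fin.sum_univ_two] at hrepr
  change ⟪frameVec x 0, u - _⟫ • frameVec x 0 + ⟪frameVec x 1, u - _⟫ • frameVec x 1 =
    u - _ at hrepr
  simp only [inner_sub_right, real_inner_smul_right, real_inner_comm (x : E3),
    inner_coe_frameVec, mul_zero, sub_zero] at hrepr
  rw [hrepr, add_sub_cancel]

lemma inner_cross_frameVec_sq (x : S2) :
    ⟪(x : E3), cross (frameVec x 0) (frameVec x 1)⟫ ^ 2 = 1 := by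
  have ho := orthonormal_iff_ite.1 (orthonormal_frameVec x)
  have hcross := inner_cross_cross (frameVec x 0) (frameVec x 1) (frameVec x 0) (frameVec x 1)
  rw [cross_eq_smul x.inner_self (inner_coe_frameVec x 0) (inner_coe_frameVec x 1),
    real_inner_smul_left, real_inner_smul_right, x.inner_self, ho, ho, ho, ho] at hcross
  simpa [sq] using hcross

lemma inner_coe_cross_add (x : S2) (b c : E3) (r r' α α' β β' : ℝ) :
    ⟪(x : E3), cross (r • (x : E3) + (α • b + β • c)) (r' • (x : E3) + (α' • b + β' • c))⟫ =
      (α * β' - β * α') * ⟪(x : E3), cross b c⟫ := by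
  have hself (u : E3) : cross u u = 0 := WithLp.ofLp_injective 2 (cross_self u.ofLp)
  simp only [map_add, map_smul, add_apply, smul_apply, inner_add_right, real_inner_smul_right,
    inner_cross_self_left, inner_cross_self_right, hself, cross_anticomm_apply c b,
    inner_neg_right, inner_zero_right]
  ring

section Frame

variable {m q : Matrix (Fin 3) (Fin 3) ℝ} {x : S2}

lemma mixedDisc_self (m : Matrix (Fin 3) (Fin 3) ℝ) (u v : E3) :
    mixedDisc m m u v = 2 * gramDet m u v := by
  unfold mixedDisc gramDet
  ring

lemma mixedDisc_eq_frameVec (hm : m.IsSymm) (hq : q.IsSymm) (hmx : ∀ w, form m (x : E3) w = 0)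
    (hqx : ∀ w, form q (x : E3) w = 0) (u v : E3) : mixedDisc m q u v =
      mixedDisc m q (frameVec x 0) (frameVec x 1) * ⟪(x : E3), cross u v⟫ ^ 2 := by
  have hcross := inner_cross_frameVec_sq x
  have hmx' := fun w => (form_symm w x hm).trans (hmx w)
  have hqx' := fun w => (form_symm w x hq).trans (hqx w)
  rw [eq_sum_frameVec x u, eq_sum_frameVec x v, inner_coe_cross_add, mul_pow, hcross]
  simp only [mixedDisc, form_add_left, form_add_right, form_smul_left, form_smul_right, hmx, hmx',
    hqx, hqx', form_symm (frameVec x 1) (frameVec x 0) hm,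
    form_symm (frameVec x 1) (frameVec x 0) hq]
  ring

lemma det_frameGram (hm : m.IsSymm) (x : S2) :
    (frameGram m x).det = gramDet m (frameVec x 0) (frameVec x 1) := by
  rw [← Matrix.det_submatrix_equiv_self (finCongr (finrank_tangent x).symm), Matrix.det_fin_two]
  change form m (frameVec x 0) (frameVec x 0) * form m (frameVec x 1) (frameVec x 1) -
    form m (frameVec x 0) (frameVec x 1) * form m (frameVec x 1) (frameVec x 0) = _
  rw [form_symm (frameVec x 1) (frameVec x 0) hm, gramDet, sq]

lemma frameTrace_eq (hm : m.IsSymm) (hq : q.IsSymm) (x : S2) : frameTrace m q x =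
    mixedDisc m q (frameVec x 0) (frameVec x 1) / (frameGram m x).det := by
  set e := finCongr (finrank_tangent x).symm
  have hreindex : frameTrace m q x =
      Matrix.trace (((frameGram m x).submatrix e e)⁻¹ * (frameGram q x).submatrix e e) := by
    rw [Matrix.inv_submatrix_equiv, Matrix.submatrix_mul_equiv]
    exact (e.sum_comp fun i => ((frameGram m x)⁻¹ * frameGram q x) i i).symm
  have hentry (p : Matrix (Fin 3) (Fin 3) ℝ) (i j : Fin 2) :
    frameGram p x (e i) (e j) = form p (frameVec x i) (frameVec x j) := rfl
  rw [hreindex, Matrix.inv_def, Matrix.det_submatrix_equiv_self, Matrix.adjugate_fin_two,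
    Matrix.trace_fin_two, Ring.inverse_eq_inv]
  simp only [Matrix.smul_apply, Matrix.mul_apply, Fin.sum_univ_two, Matrix.of_apply,
    Matrix.cons_val_zero, Matrix.cons_val_one, Matrix.cons_val', Matrix.cons_val_fin_one,
    Matrix.submatrix_apply, hentry, mixedDisc, smul_eq_mul,
    form_symm (frameVec x 1) (frameVec x 0) hm, form_symm (frameVec x 1) (frameVec x 0) hq]
  ring

lemma gramDet_eq (hm : m.IsSymm) (hmx : ∀ w, form m (x : E3) w = 0) (u v : E3) :
    gramDet m u v = (frameGram m x).det * ⟪(x : E3), cross u v⟫ ^ 2 := by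
  have hpolar := mixedDisc_eq_frameVec hm hm hmx hmx u v
  rw [mixedDisc_self, mixedDisc_self] at hpolar
  rw [det_frameGram hm]
  linarith

lemma frameTrace_mul_gramDet (hm : m.IsSymm) (hq : q.IsSymm) (hmx : ∀ w, form m (x : E3) w = 0)
    (hqx : ∀ w, form q (x : E3) w = 0) (hdet : (frameGram m x).det ≠ 0) (u v : E3) :
    frameTrace m q x * gramDet m u v = mixedDisc m q u v := by
  rw [frameTrace_eq hm hq, gramDet_eq hm hmx, mixedDisc_eq_frameVec hm hq hmx hqx u v, ← mul_assoc,
    div_mul_cancel₀ _ hdet]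

lemma det_frameGram_pos (hm : m.IsSymm)
    (hpos : ∀ w : E3, ⟪(x : E3), w⟫ = 0 → w ≠ 0 → 0 < form m w w) : 0 < (frameGram m x).det := by
  have ho := orthonormal_iff_ite.1 (orthonormal_frameVec x)
  have hne := (orthonormal_frameVec x).ne_zero
  have hx := inner_coe_frameVec x
  rw [det_frameGram hm]
  generalize frameVec x = b at ho hne hx
  have hb0 : 0 < form m (b 0) (b 0) := hpos _ (hx 0) (hne 0)
  -- the component of `b 1` orthogonal to `b 0`, rescaled, has length `m(b 0, b 0)` times the
  -- Gram determinant
  set w := form m (b 0) (b 0) • b 1 - form m (b 0) (b 1) • b 0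
  have hw : ⟪b 1, w⟫ = form m (b 0) (b 0) := by
    simp only [w, inner_sub_right, real_inner_smul_right, ho]
    simp
  have hwpos : 0 < form m w w := by
    refine hpos w ?_ fun h => hb0.ne' (by rw [← hw, h, inner_zero_right])
    simp only [w, inner_sub_right, real_inner_smul_right, hx, mul_zero, sub_zero]
  have hww : form m w w = form m (b 0) (b 0) * gramDet m (b 0) (b 1) := by
    simp only [w, gramDet, form_sub_left, form_sub_right, form_smul_left, form_smul_right,
      form_symm (b 1) (b 0) hm]
    ring
  exact pos_of_mul_pos_right (hww ▸ hwpos) hb0.le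

end Frame

/-! ### Surfaces in spaces of constant curvature -/

/-- Near `x`, the forms `γ` and `A` along `S²` are the first and second fundamental forms of the
map `f` into the metric `(s, G)` of constant curvature `κ`, with unit normal `n`. -/
structure IsLocalRep (κ : ℝ) (s : Set E3) (G : E3 → Matrix (Fin 3) (Fin 3) ℝ) (f n : S2 → E3)
    (γ A : S2 → Matrix (Fin 3) (Fin 3) ℝ) (x : S2) : Prop where
  metric : IsMetricOn s G
  curv : HasConstCurv s G κ
  smooth : ContDiffAt ℝ 3 (radialExt f) (x : E3)
  normal_smooth : ContDiffAt ℝ 2 (radialExt n) (x : E3)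
  mem : ∀ᶠ z in 𝓝 x, f z ∈ s
  unit : ∀ᶠ z in 𝓝 x, form (G (f z)) (n z) (n z) = 1
  normal : ∀ᶠ z in 𝓝 x, ∀ u, form (G (f z)) (n z) (sD f z u) = 0
  first : ∀ᶠ z in 𝓝 x, ∀ u v, form (γ z) u v = form (G (f z)) (sD f z u) (sD f z v)
  second : ∀ᶠ z in 𝓝 x, ∀ u v, form (A z) u v = secondFF s G f (n z) z u v

lemma isSymm_of_form_comm {m : Matrix (Fin 3) (Fin 3) ℝ} (h : ∀ u v, form m u v = form m v u) :
    m.IsSymm :=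
  Matrix.IsSymm.ext fun i j => by rw [← form_stdVec m, h, form_stdVec]

lemma contDiffAt_comp_of_mem {k : ℕ∞ω} {s : Set E3} {f : E3 → ℝ} {F : E3 → E3} {y : E3}
    (hf : ContDiffWithinAt ℝ k f s (F y)) (hF : ContDiffAt ℝ k F y) (hFs : ∀ᶠ z in 𝓝 y, F z ∈ s) :
    ContDiffAt ℝ k (fun z => f (F z)) y := by
  rw [← contDiffWithinAt_univ] at hF ⊢
  exact hf.comp_of_preimage_mem_nhdsWithin y hF (by rwa [nhdsWithin_univ])

lemma contDiffAt_form {E : Type*} [NormedAddCommGroup E] [NormedSpace ℝ E] {k : ℕ∞ω}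
    {M : E → Matrix (Fin 3) (Fin 3) ℝ} {P Q : E → E3} {y : E}
    (hM : ∀ i j, ContDiffAt ℝ k (fun z => M z i j) y) (hP : ContDiffAt ℝ k P y)
    (hQ : ContDiffAt ℝ k Q y) : ContDiffAt ℝ k (fun z => form (M z) (P z) (Q z)) y := by
  have hP' : ∀ i, ContDiffAt ℝ k (fun z => P z i) y := contDiffAt_euclidean.1 hP
  have hQ' : ∀ i, ContDiffAt ℝ k (fun z => Q z i) y := contDiffAt_euclidean.1 hQ
  exact ContDiffAt.sum fun i _ => ContDiffAt.sum fun j _ => ((hM i j).mul (hP' i)).mul (hQ' j)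

lemma contDiffAt_fderiv_apply {f : E3 → E3} {y : E3} (hf : ContDiffAt ℝ 2 f y) (b : E3) :
    ContDiffAt ℝ 1 (fun z => fderiv ℝ f z b) y :=
  (hf.fderiv_right (m := 1) (by norm_num)).clm_apply contDiffAt_const

lemma contDiffAt_cov {s : Set E3} {G : E3 → Matrix (Fin 3) (Fin 3) ℝ} {F P : E3 → E3} {y : E3}
    (hM : IsMetricOn s G) (hF : ContDiffAt ℝ 2 F y) (hFs : ∀ᶠ z in 𝓝 y, F z ∈ s)
    (hP : ContDiffAt ℝ 2 P y) (b : E3) : ContDiffAt ℝ 1 (fun z => cov s G F P z b) y := by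
  refine (contDiffAt_fderiv_apply hP b).add (contDiffAt_euclidean.2 fun k => ?_)
  exact contDiffAt_form (M := fun z => christoffelMat s G (F z) k)
    (fun i j => contDiffAt_comp_of_mem (hM.contDiffOn_christoffel k i j _ hFs.self_of_nhds)
      (hF.of_le one_le_two) hFs) (contDiffAt_fderiv_apply hF b) (hP.of_le one_le_two)

lemma cov_radialProj {s : Set E3} {G : E3 → Matrix (Fin 3) (Fin 3) ℝ} {f n : S2 → E3} {y : E3}
    (hy : y ≠ 0) (hf : DifferentiableAt ℝ (radialExt f) (radialProj y : E3))
    (hn : DifferentiableAt ℝ (radialExt n) (radialProj y : E3)) (u : E3) :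
    cov s G (radialExt f) (radialExt n) (radialProj y : E3) u =
      ‖y‖ • cov s G (radialExt f) (radialExt n) y u := by
  simp only [cov, ← sD_eq_fderiv, fderiv_radialExt hy hf, fderiv_radialExt hy hn, radialExt_coe,
    christoffelVec_eq_vecForm, vecForm_smul_left, smul_add, smul_inv_smul₀ (norm_ne_zero_iff.2 hy)]
  rfl

namespace IsLocalRep

variable {κ : ℝ} {s : Set E3} {G : E3 → Matrix (Fin 3) (Fin 3) ℝ} {f n : S2 → E3}
  {γ A : S2 → Matrix (Fin 3) (Fin 3) ℝ} {x : S2} (h : IsLocalRep κ s G f n γ A x)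

include h

lemma eventually : ∀ᶠ z in 𝓝 x, IsLocalRep κ s G f n γ A z := by
  filter_upwards [eventually_coe (h.smooth.eventually (by simp)),
    eventually_coe (h.normal_smooth.eventually (by simp)), h.mem.eventually_nhds,
    h.unit.eventually_nhds, h.normal.eventually_nhds, h.first.eventually_nhds,
    h.second.eventually_nhds] with z hf hn hmem hunit hnormal hfirst hsecond
  exact ⟨h.metric, h.curv, hf, hn, hmem, hunit, hnormal, hfirst, hsecond⟩

lemma eventually_radial :
    ∀ᶠ y in 𝓝 (x : E3), y ≠ 0 ∧ IsLocalRep κ s G f n γ A (radialProj y) :=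
  (eventually_ne_zero x).and (eventually_radialProj h.eventually)

lemma smooth_two : ContDiffAt ℝ 2 (radialExt f) (x : E3) := h.smooth.of_le (by norm_num)

lemma differentiableAt : DifferentiableAt ℝ (radialExt f) (x : E3) :=
  h.smooth.differentiableAt (by norm_num)

lemma normal_differentiableAt : DifferentiableAt ℝ (radialExt n) (x : E3) :=
  h.normal_smooth.differentiableAt (by norm_num)

lemma radialExt_mem : ∀ᶠ y in 𝓝 (x : E3), radialExt f y ∈ s := eventually_radialProj h.mem

lemma posDef : (G (f x)).PosDef := h.metric.posDef _ h.mem.self_of_nhds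

lemma radialExt_normal : ∀ᶠ y in 𝓝 (x : E3), ∀ u,
    form (G (radialExt f y)) (radialExt n y) (fderiv ℝ (radialExt f) y u) = 0 := by
  filter_upwards [h.eventually_radial] with y ⟨hy, hr⟩ u
  rw [fderiv_radialExt hy hr.differentiableAt, form_smul_right]
  exact mul_eq_zero_of_right _ (hr.normal.self_of_nhds u)

lemma first_eq : ∀ᶠ y in 𝓝 (x : E3), ∀ u v, form (radialExt γ y) u v = ‖y‖ ^ 2 *
    form (G (radialExt f y)) (fderiv ℝ (radialExt f) y u) (fderiv ℝ (radialExt f) y v) := by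
  filter_upwards [h.eventually_radial] with y ⟨hy, hr⟩ u v
  rw [radialExt, hr.first.self_of_nhds, fderiv_radialExt hy hr.differentiableAt,
    fderiv_radialExt hy hr.differentiableAt, form_smul_left, form_smul_right, radialExt]
  field_simp

lemma second_self (u v : E3) :
    form (A x) u v = form (G (f x)) (cov s G (radialExt f) (radialExt n) x u) (sD f x v) := by
  have horth := form_cov_add_eq_zero h.metric h.differentiableAt h.radialExt_mem
    h.normal_differentiableAt (differentiableAt_fderiv_apply h.smooth_two v)
    (h.radialExt_normal.mono fun y hy => hy v) u
  have hcov : cov s G (radialExt f) (fun z => fderiv ℝ (radialExt f) z v) x u =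
      sD2 f x u v + christoffelVec s G (f x) (sD f x u) (sD f x v) := by
    rw [cov, fderiv_fderiv_apply_comm h.smooth_two, radialExt_coe]
    rfl
  rw [hcov, radialExt_coe, radialExt_coe, form_symm (n x) _ (isSymm_of_posDef h.posDef)] at horth
  rw [h.second.self_of_nhds, secondFF]
  exact (eq_neg_of_add_eq_zero_left horth).symm

lemma second_eq : ∀ᶠ y in 𝓝 (x : E3), ∀ u v, form (radialExt A y) u v = ‖y‖ ^ 2 *
    form (G (radialExt f y)) (cov s G (radialExt f) (radialExt n) y u)
      (fderiv ℝ (radialExt f) y v) := by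
  filter_upwards [h.eventually_radial] with y ⟨hy, hr⟩ u v
  rw [radialExt, hr.second_self, cov_radialProj hy hr.differentiableAt hr.normal_differentiableAt,
    fderiv_radialExt hy hr.differentiableAt, form_smul_left, form_smul_right, radialExt]
  field_simp

lemma contDiffAt_metric (i j : Fin 3) :
    ContDiffAt ℝ 1 (fun z => G (radialExt f z) i j) (x : E3) :=
  contDiffAt_comp_of_mem
    (((h.metric.contDiffOn i j).of_le one_le_two) _ h.radialExt_mem.self_of_nhds)
    (h.smooth.of_le (by norm_num)) h.radialExt_mem

lemma contDiffAt_first (i j : Fin 3) : ContDiffAt ℝ 1 (fun y => radialExt γ y i j) (x : E3) := by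
  refine ContDiffAt.congr_of_eventuallyEq ((contDiff_norm_sq ℝ).contDiffAt.mul
    (contDiffAt_form h.contDiffAt_metric (contDiffAt_fderiv_apply h.smooth_two (stdVec i))
      (contDiffAt_fderiv_apply h.smooth_two (stdVec j)))) ?_
  exact h.first_eq.mono fun y hy => (form_stdVec _ i j).symm.trans (hy _ _)

lemma contDiffAt_second (i j : Fin 3) : ContDiffAt ℝ 1 (fun y => radialExt A y i j) (x : E3) := by
  refine ContDiffAt.congr_of_eventuallyEq ((contDiff_norm_sq ℝ).contDiffAt.mul
    (contDiffAt_form h.contDiffAt_metric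
      (contDiffAt_cov h.metric h.smooth_two h.radialExt_mem h.normal_smooth (stdVec i))
      (contDiffAt_fderiv_apply h.smooth_two (stdVec j)))) ?_
  exact h.second_eq.mono fun y hy => (form_stdVec _ i j).symm.trans (hy _ _)

lemma isSymm_first : (γ x).IsSymm := by
  refine isSymm_of_form_comm fun u v => ?_
  rw [h.first.self_of_nhds, h.first.self_of_nhds, form_symm _ _ (isSymm_of_posDef h.posDef)]

lemma isSymm_second : (A x).IsSymm := by
  refine isSymm_of_form_comm fun u v => ?_
  have hsD2 : sD2 f x u v = sD2 f x v u := fderiv_fderiv_apply_comm h.smooth_two v u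
  rw [h.second.self_of_nhds, h.second.self_of_nhds, secondFF, secondFF, hsD2,
    christoffelVec_symm h.metric h.mem.self_of_nhds]

lemma first_coe (u : E3) : form (γ x) x u = 0 := by
  rw [h.first.self_of_nhds, sD_self h.differentiableAt, form_zero_left]

lemma second_coe (u : E3) : form (A x) x u = 0 := by
  rw [form_symm _ _ h.isSymm_second, h.second_self, sD_self h.differentiableAt, form_zero_right]

lemma meanCurv_eq : meanCurv s G f (n x) x = frameTrace (γ x) (A x) x := by
  simp only [meanCurv, frameTrace, frameGram, h.first.self_of_nhds, h.second.self_of_nhds]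

end IsLocalRep

lemma cov_fderiv_apply {s : Set E3} {G : E3 → Matrix (Fin 3) (Fin 3) ℝ} {F P : E3 → E3} {y : E3}
    (hM : IsMetricOn s G) (hF : ContDiffAt ℝ 2 F y) (hFs : ∀ᶠ z in 𝓝 y, F z ∈ s)
    (hP : DifferentiableAt ℝ P y) (c : E3) : cov s G F (fun z => fderiv ℝ F z (P z)) y c =
      cov s G F (fun z => fderiv ℝ F z c) y (P y) + fderiv ℝ F y (fderiv ℝ P y c) := by
  have hd := (hF.fderiv_right (m := 1) (by norm_num)).differentiableAt one_ne_zero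
  rw [← cov_fderiv_comm hM hF hFs]
  simp only [cov, fderiv_clm_apply hd hP, fderiv_clm_apply hd (differentiableAt_const _)]
  simp
  abel

lemma fderiv_norm_sq_mul {φ : E3 → ℝ} {x : S2} (hφ : DifferentiableAt ℝ φ (x : E3)) {d : E3}
    (hd : ⟪(x : E3), d⟫ = 0) :
    fderiv ℝ (fun y : E3 => ‖y‖ ^ 2 * φ y) (x : E3) d = fderiv ℝ φ (x : E3) d := by
  have hnorm : HasFDerivAt (fun z : E3 => ‖z‖ ^ 2) (2 • innerSL ℝ (x : E3)) (x : E3) :=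
    (hasStrictFDerivAt_norm_sq (x : E3)).hasFDerivAt
  refine (congrArg (· d) (hnorm.mul hφ.hasFDerivAt).fderiv).trans ?_
  simp [hd]

/-- The image `df(X)` of the field `X` under the differential of `f`, extended off `S²` through the
radial extensions of `f` and `X`. -/
def pushforward (f X : S2 → E3) (y : E3) : E3 := fderiv ℝ (radialExt f) y (radialExt X y)

lemma pushforward_coe (f X : S2 → E3) (x : S2) : pushforward f X x = sD f x (X x) := by
  rw [pushforward, radialExt_coe, sD_eq_fderiv]

lemma contDiffAt_pushforward {f X : S2 → E3} {y : E3} (hf : ContDiffAt ℝ 2 (radialExt f) y)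
    (hX : ContDiffAt ℝ 1 (radialExt X) y) : ContDiffAt ℝ 1 (pushforward f X) y :=
  (hf.fderiv_right (m := 1) (by norm_num)).clm_apply hX

lemma IsLocalRep.lieDeriv_eq {κ : ℝ} {s : Set E3} {G : E3 → Matrix (Fin 3) (Fin 3) ℝ}
    {f n X : S2 → E3} {γ A : S2 → Matrix (Fin 3) (Fin 3) ℝ} {x : S2}
    (h : IsLocalRep κ s G f n γ A x) (hX : DifferentiableAt ℝ (radialExt X) (x : E3))
    (hXt : ⟪(x : E3), X x⟫ = 0) (c d : E3) : lieDeriv (radialExt γ) X x c d =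
      form (G (f x)) (cov s G (radialExt f) (pushforward f X) x c) (sD f x d)
        + form (G (f x)) (sD f x c) (cov s G (radialExt f) (pushforward f X) x d) := by
  have hcov (c : E3) : cov s G (radialExt f) (pushforward f X) x c = _ :=
    cov_fderiv_apply h.metric h.smooth_two h.radialExt_mem hX c
  have hdf (b : E3) := differentiableAt_fderiv_apply h.smooth_two b
  have hsD : sD (fun y : S2 => form (radialExt γ y) c d) x (X x) =
      fderiv ℝ (fun y => form (G (radialExt f y)) (fderiv ℝ (radialExt f) y c)
        (fderiv ℝ (radialExt f) y d)) x (X x) := by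
    have hext : (fun y => form (radialExt γ y) c d) =ᶠ[𝓝 (x : E3)] fun y => ‖y‖ ^ 2 *
        form (G (radialExt f y)) (fderiv ℝ (radialExt f) y c) (fderiv ℝ (radialExt f) y d) :=
      h.first_eq.mono fun y hy => hy c d
    rw [← fderiv_norm_sq_mul ((contDiffAt_form h.contDiffAt_metric
      (contDiffAt_fderiv_apply h.smooth_two c)
      (contDiffAt_fderiv_apply h.smooth_two d)).differentiableAt one_ne_zero) hXt, ← hext.fderiv_eq]
    simp only [sD, radialExt_coe]
    rfl
  rw [lieDeriv, hsD, fderiv_form_comp h.metric h.differentiableAt h.radialExt_mem (hdf c) (hdf d),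
    hcov, hcov]
  simp only [radialExt_coe, form_add_left, form_add_right, h.first.self_of_nhds, ← sD_eq_fderiv]
  ring

/-- A surface immersed in spaces of constant curvature `κ` and parametrized by `S²`, given by its
first and second fundamental forms `γ` and `A`. Only the values of the forms on tangent vectors of
`S²` are meaningful; both vanish on the radial direction. -/
structure IsSurface (κ : ℝ) (γ A : S2 → Matrix (Fin 3) (Fin 3) ℝ) : Prop where
  rep : ∀ x, ∃ s G f n, IsLocalRep κ s G f n γ A x
  pos : ∀ (x : S2) (u : E3), ⟪(x : E3), u⟫ = 0 → u ≠ 0 → 0 < form (γ x) u u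

/-- The mean curvature of the surface with first and second fundamental forms `γ` and `A`. -/
def surfaceMeanCurv (γ A : S2 → Matrix (Fin 3) (Fin 3) ℝ) (x : S2) : ℝ :=
  frameTrace (γ x) (A x) x

/-- The traceless second fundamental form `A - ½ H γ`. -/
def tracelessForm (γ A : S2 → Matrix (Fin 3) (Fin 3) ℝ) (x : S2) : Matrix (Fin 3) (Fin 3) ℝ :=
  A x + (-(1 / 2) * surfaceMeanCurv γ A x) • γ x

/-- The vector representing the linear form `m(u, ·)`. -/
def flat (m : Matrix (Fin 3) (Fin 3) ℝ) (u : E3) : E3 := WithLp.toLp 2 (Matrix.vecMul u.ofLp m)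

/-- The field `X` rotated by a right angle with respect to the metric `γ`. -/
def rotate (γ : S2 → Matrix (Fin 3) (Fin 3) ℝ) (X : S2 → E3) (x : S2) : E3 :=
  (areaDensity (radialExt γ) x)⁻¹ • cross (x : E3) (flat (γ x) (X x))

/-- The field `η × x`, where `η` represents the one-form `A(JX, ·) - ½ H γ(JX, ·)` and `J` is the
rotation by a right angle. Its divergence is a multiple of `X(H) dV_γ`. -/
def balancingField (γ A : S2 → Matrix (Fin 3) (Fin 3) ℝ) (X : S2 → E3) (x : S2) : E3 :=
  cross (flat (tracelessForm γ A x) (rotate γ X x)) (x : E3)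

lemma inner_flat (m : Matrix (Fin 3) (Fin 3) ℝ) (u v : E3) : ⟪flat m u, v⟫ = form m u v := by
  rw [inner_eq_dotProduct, form_eq_dotProduct, Matrix.dotProduct_mulVec, flat]

lemma flat_zero (m : Matrix (Fin 3) (Fin 3) ℝ) : flat m 0 = 0 :=
  ext_inner_right ℝ fun v => by rw [inner_flat, form_zero_left, inner_zero_left]

lemma form_tracelessForm (γ A : S2 → Matrix (Fin 3) (Fin 3) ℝ) (x : S2) (u v : E3) :
    form (tracelessForm γ A x) u v =
      form (A x) u v + -(1 / 2) * surfaceMeanCurv γ A x * form (γ x) u v := by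
  simp only [form_eq_dotProduct, tracelessForm, Matrix.add_mulVec, Matrix.smul_mulVec,
    dotProduct_add, dotProduct_smul, smul_eq_mul]

lemma contDiffAt_flat {k : ℕ∞ω} {m : E3 → Matrix (Fin 3) (Fin 3) ℝ} {P : E3 → E3} {y : E3}
    (hm : ∀ i j, ContDiffAt ℝ k (fun z => m z i j) y) (hP : ContDiffAt ℝ k P y) :
    ContDiffAt ℝ k (fun z => flat (m z) (P z)) y := by
  refine contDiffAt_euclidean.2 fun j => ?_
  simp only [← inner_stdVec, inner_flat]
  exact contDiffAt_form hm hP contDiffAt_const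

lemma inner_coe_rotate (γ : S2 → Matrix (Fin 3) (Fin 3) ℝ) (X : S2 → E3) (x : S2) :
    ⟪(x : E3), rotate γ X x⟫ = 0 := by
  rw [rotate, real_inner_smul_right, inner_cross_self_left, mul_zero]

lemma balancingField_eq_zero {γ A : S2 → Matrix (Fin 3) (Fin 3) ℝ} {X : S2 → E3} {x : S2}
    (hX : X x = 0) : balancingField γ A X x = 0 := by
  simp [balancingField, rotate, hX, flat_zero]

lemma sum_inner_cross_stdVec_sq (x : E3) :
    ∑ i : Fin 3, ⟪x, cross (stdVec i) (stdVec (i + 1))⟫ ^ 2 = ⟪x, x⟫ := by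
  have hcross : ∀ i : Fin 3, cross (stdVec i) (stdVec (i + 1)) = stdVec (i + 2) := fun i => by
    ext j
    fin_cases i <;> fin_cases j <;> simp [ofLp_cross, cross_apply]
  simp only [hcross, inner_eq_dotProduct, dotProduct, Fin.sum_univ_three]
  simp
  ring

namespace IsSurface

variable {κ : ℝ} {γ A : S2 → Matrix (Fin 3) (Fin 3) ℝ} (h : IsSurface κ γ A) {X : S2 → E3} (x : S2)

include h

lemma isSymm_first : (γ x).IsSymm :=
  let ⟨_, _, _, _, hr⟩ := h.rep x
  hr.isSymm_first

lemma isSymm_second : (A x).IsSymm :=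
  let ⟨_, _, _, _, hr⟩ := h.rep x
  hr.isSymm_second

lemma first_coe (u : E3) : form (γ x) x u = 0 :=
  let ⟨_, _, _, _, hr⟩ := h.rep x
  hr.first_coe u

lemma second_coe (u : E3) : form (A x) x u = 0 :=
  let ⟨_, _, _, _, hr⟩ := h.rep x
  hr.second_coe u

lemma contDiffAt_first (i j : Fin 3) : ContDiffAt ℝ 1 (fun y => radialExt γ y i j) (x : E3) :=
  let ⟨_, _, _, _, hr⟩ := h.rep x
  hr.contDiffAt_first i j

lemma contDiffAt_second (i j : Fin 3) : ContDiffAt ℝ 1 (fun y => radialExt A y i j) (x : E3) :=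
  let ⟨_, _, _, _, hr⟩ := h.rep x
  hr.contDiffAt_second i j

lemma det_pos : 0 < (frameGram (γ x) x).det := det_frameGram_pos (h.isSymm_first x) (h.pos x)

omit h in
lemma areaDensity_radialExt : areaDensity (radialExt γ) x = √(frameGram (γ x) x).det := by
  simp only [areaDensity, radialExt_coe, frameGram]

lemma area_pos : 0 < areaDensity (radialExt γ) x := by
  rw [areaDensity_radialExt]
  exact Real.sqrt_pos.2 (h.det_pos x)

lemma gramDet_first (u v : E3) :
    gramDet (γ x) u v = areaDensity (radialExt γ) x ^ 2 * ⟪(x : E3), cross u v⟫ ^ 2 := by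
  rw [areaDensity_radialExt, Real.sq_sqrt (h.det_pos x).le,
    gramDet_eq (h.isSymm_first x) (h.first_coe x)]

lemma meanCurv_mul_gramDet (u v : E3) :
    surfaceMeanCurv γ A x * gramDet (γ x) u v = mixedDisc (γ x) (A x) u v :=
  frameTrace_mul_gramDet (h.isSymm_first x) (h.isSymm_second x) (h.first_coe x) (h.second_coe x)
    (h.det_pos x).ne' u v

lemma area_sq :
    areaDensity (radialExt γ) x ^ 2 = ∑ i, gramDet (γ x) (stdVec i) (stdVec (i + 1)) := by
  simp only [h.gramDet_first, ← Finset.mul_sum, sum_inner_cross_stdVec_sq, x.inner_self, mul_one]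

lemma contDiffAt_area :
    ContDiffAt ℝ 1 (radialExt fun z : S2 => areaDensity (radialExt γ) z) (x : E3) := by
  have hform (u v : E3) := contDiffAt_form (h.contDiffAt_first x) (contDiffAt_const (c := u))
    (contDiffAt_const (c := v))
  have hsum : ContDiffAt ℝ 1
      (fun y => ∑ i, gramDet (radialExt γ y) (stdVec i) (stdVec (i + 1))) (x : E3) :=
    ContDiffAt.sum fun i _ => ((hform _ _).mul (hform _ _)).sub ((hform _ _).pow 2)
  refine (hsum.sqrt ?_).congr_of_eventuallyEq (Eventually.of_forall fun y => ?_)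
  · rw [radialExt_coe, ← h.area_sq]
    exact (pow_pos (h.area_pos x) 2).ne'
  · simp only [radialExt]
    rw [← h.area_sq, Real.sqrt_sq (h.area_pos _).le]

lemma contDiffAt_meanCurv : ContDiffAt ℝ 1 (radialExt (surfaceMeanCurv γ A)) (x : E3) := by
  have hγ (u v : E3) := contDiffAt_form (h.contDiffAt_first x) (contDiffAt_const (c := u))
    (contDiffAt_const (c := v))
  have hA (u v : E3) := contDiffAt_form (h.contDiffAt_second x) (contDiffAt_const (c := u))
    (contDiffAt_const (c := v))
  have hsum : ContDiffAt ℝ 1 (fun y => ∑ i,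
      mixedDisc (radialExt γ y) (radialExt A y) (stdVec i) (stdVec (i + 1))) (x : E3) :=
    ContDiffAt.sum fun i _ => (((hA _ _).mul (hγ _ _)).add ((hA _ _).mul (hγ _ _))).sub
      ((contDiffAt_const.mul (hA _ _)).mul (hγ _ _))
  refine (hsum.div ((h.contDiffAt_area x).pow 2) ?_).congr_of_eventuallyEq
    (Eventually.of_forall fun y => ?_)
  · rw [radialExt_coe]
    exact (pow_pos (h.area_pos x) 2).ne'
  · simp only [radialExt]
    refine (eq_div_iff (pow_pos (h.area_pos _) 2).ne').2 ?_
    rw [h.area_sq, Finset.mul_sum]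
    exact Finset.sum_congr rfl fun i _ => h.meanCurv_mul_gramDet _ _ _

end IsSurface

/-! ### The balancing condition -/

lemma IsLocalRep.form_cov_pushforward {κ : ℝ} {s : Set E3} {G : E3 → Matrix (Fin 3) (Fin 3) ℝ}
    {f n X : S2 → E3} {γ A : S2 → Matrix (Fin 3) (Fin 3) ℝ} {x : S2}
    (h : IsLocalRep κ s G f n γ A x) (hX : IsConformalKilling (radialExt γ) X) {u v : E3}
    (hu : ⟪(x : E3), u⟫ = 0) (hv : ⟪(x : E3), v⟫ = 0) (huv : form (γ x) u v = 0)
    (hvv : form (γ x) v v = form (γ x) u u) :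
    form (G (f x)) (cov s G (radialExt f) (pushforward f X) x u) (sD f x u) =
        form (G (f x)) (cov s G (radialExt f) (pushforward f X) x v) (sD f x v) ∧
      form (G (f x)) (cov s G (radialExt f) (pushforward f X) x u) (sD f x v) =
        -form (G (f x)) (cov s G (radialExt f) (pushforward f X) x v) (sD f x u) := by
  obtain ⟨μ, hμ⟩ := hX.conformal
  have hXd := (contMDiff_iff_radialExt.1 hX.contMDiff x).differentiableAt one_ne_zero
  have hlie (c d : E3) := h.lieDeriv_eq hXd (hX.tangent x) c d
  have hsymm (p q : E3) : form (G (f x)) p q = form (G (f x)) q p :=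
    form_symm p q (isSymm_of_posDef h.posDef)
  have huu := (hlie u u).symm.trans (hμ x u u hu hu)
  have hvv' := (hlie v v).symm.trans (hμ x v v hv hv)
  have huv' := (hlie u v).symm.trans (hμ x u v hu hv)
  rw [radialExt_coe] at huu hvv' huv'
  rw [hsymm (sD f x u)] at huu huv'
  rw [hsymm (sD f x v)] at hvv'
  rw [hvv] at hvv'
  rw [huv, mul_zero] at huv'
  exact ⟨by linarith, by linarith⟩

namespace IsSurface

variable {κ : ℝ} {γ A : S2 → Matrix (Fin 3) (Fin 3) ℝ} (h : IsSurface κ γ A) {X : S2 → E3} {x : S2}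

omit h in
lemma form_rotate : form (γ x) (X x) (rotate γ X x) = 0 := by
  rw [← inner_flat, rotate, real_inner_smul_right, inner_cross_self_right, mul_zero]

include h

lemma inner_cross_rotate : ⟪(x : E3), cross (X x) (rotate γ X x)⟫ =
    (areaDensity (radialExt γ) x)⁻¹ * form (γ x) (X x) (X x) := by
  have hradial : ⟪(x : E3), flat (γ x) (X x)⟫ = 0 := by
    rw [real_inner_comm, inner_flat, form_symm _ _ (h.isSymm_first x), h.first_coe]
  rw [rotate, map_smul, real_inner_smul_right, cross_cross_right, inner_sub_right,
    real_inner_smul_right, real_inner_smul_right, hradial, x.inner_self,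
    real_inner_comm (flat (γ x) (X x)), inner_flat]
  ring

lemma form_rotate_rotate (hX : ⟪(x : E3), X x⟫ = 0) :
    form (γ x) (rotate γ X x) (rotate γ X x) = form (γ x) (X x) (X x) := by
  by_cases h0 : X x = 0
  · simp [rotate, h0, flat_zero]
  · have hgram := h.gramDet_first x (X x) (rotate γ X x)
    have hpos := (h.pos x _ hX h0).ne'
    have harea := (h.area_pos x).ne'
    rw [gramDet, form_rotate, h.inner_cross_rotate] at hgram
    field_simp at hgram
    exact mul_left_cancel₀ hpos (by linear_combination hgram)

lemma contDiffAt_rotate (hX : ContDiffAt ℝ 1 (radialExt X) (x : E3)) :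
    ContDiffAt ℝ 1 (radialExt (rotate γ X)) (x : E3) := by
  have harea := (h.contDiffAt_area x).inv (by rw [radialExt_coe]; exact (h.area_pos x).ne')
  have hflat := contDiffAt_flat (h.contDiffAt_first x) hX
  exact harea.smul (((cross.contDiff.contDiffAt).comp (x : E3)
    (contDiffAt_radialProj x.ne_zero)).clm_apply hflat)

lemma isSymm_tracelessForm (x : S2) : (tracelessForm γ A x).IsSymm :=
  (h.isSymm_second x).add ((h.isSymm_first x).smul _)

lemma contDiffAt_flat_tracelessForm_rotate (hX : ContDiffAt ℝ 1 (radialExt X) (x : E3)) :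
    ContDiffAt ℝ 1 (radialExt fun z => flat (tracelessForm γ A z) (rotate γ X z)) (x : E3) := by
  refine contDiffAt_flat (m := radialExt (tracelessForm γ A)) (fun i j => ?_)
    (h.contDiffAt_rotate hX)
  exact (h.contDiffAt_second x i j).add
    ((contDiffAt_const.mul (h.contDiffAt_meanCurv x)).mul (h.contDiffAt_first x i j))

lemma contMDiff_balancingField (hX : ContMDiff (𝓡 2) 𝓘(ℝ, E3) 1 X) :
    ContMDiff (𝓡 2) 𝓘(ℝ, E3) 1 (balancingField γ A X) :=
  contMDiff_iff_radialExt.2 fun x =>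
    ((cross.contDiff.contDiffAt).comp (x : E3) (h.contDiffAt_flat_tracelessForm_rotate
      (contMDiff_iff_radialExt.1 hX x))).clm_apply (contDiffAt_radialProj x.ne_zero)

lemma contMDiff_meanCurv : ContMDiff (𝓡 2) 𝓘(ℝ, ℝ) 1 (surfaceMeanCurv γ A) :=
  contMDiff_iff_radialExt.2 h.contDiffAt_meanCurv

lemma continuous_sD_meanCurv_mul_area (hX : Continuous X) :
    Continuous fun x => sD (surfaceMeanCurv γ A) x (X x) * areaDensity (radialExt γ) x :=
  ((continuous_fderiv_radialExt h.contMDiff_meanCurv).clm_apply hX).mul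
    (contMDiff_iff_radialExt.2 h.contDiffAt_area).continuous

variable {s : Set E3} {G : E3 → Matrix (Fin 3) (Fin 3) ℝ} {f n : S2 → E3}

lemma inner_sD_flat_tracelessForm_rotate (hr : IsLocalRep κ s G f n γ A x)
    (hX : ContDiffAt ℝ 1 (radialExt X) (x : E3)) (c : E3) {d : E3} (hd : ⟪(x : E3), d⟫ = 0) :
    ⟪sD (fun z => flat (tracelessForm γ A z) (rotate γ X z)) x d, c⟫ =
      fderiv ℝ (fun z => form (G (radialExt f z))
        (tracelessShape s G (radialExt f) (radialExt n) (radialExt (surfaceMeanCurv γ A)) z c)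
        (pushforward f (rotate γ X) z)) x d := by
  have hη := (h.contDiffAt_flat_tracelessForm_rotate hX).differentiableAt one_ne_zero
  have hshape : ContDiffAt ℝ 1 (fun z => tracelessShape s G (radialExt f) (radialExt n)
      (radialExt (surfaceMeanCurv γ A)) z c) (x : E3) :=
    (contDiffAt_cov hr.metric hr.smooth_two hr.radialExt_mem hr.normal_smooth c).add
      ((contDiffAt_const.mul (h.contDiffAt_meanCurv x)).smul
        (contDiffAt_fderiv_apply hr.smooth_two c))
  rw [← fderiv_norm_sq_mul ((contDiffAt_form hr.contDiffAt_metric hshape (contDiffAt_pushforward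
    hr.smooth_two (h.contDiffAt_rotate hX))).differentiableAt one_ne_zero) hd]
  have hinner : fderiv ℝ (fun z => ⟪radialExt (fun z => flat (tracelessForm γ A z)
      (rotate γ X z)) z, c⟫) x d =
      ⟪sD (fun z => flat (tracelessForm γ A z) (rotate γ X z)) x d, c⟫ := by
    rw [(hη.hasFDerivAt.inner ℝ (hasFDerivAt_const c (x : E3))).fderiv, sD_eq_fderiv]
    simp [fderivInnerCLM_apply]
  rw [← hinner]
  congr 1
  refine Filter.EventuallyEq.fderiv_eq ?_
  filter_upwards [hr.first_eq, hr.second_eq] with y hfirst hsecond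
  simp only [radialExt] at hfirst hsecond ⊢
  rw [inner_flat, form_symm _ _ (h.isSymm_tracelessForm _), form_tracelessForm, hfirst,
    hsecond, tracelessShape, form_add_left, form_smul_left]
  simp only [radialExt, pushforward]
  ring

lemma fderiv_form_tracelessShape_pushforward (hr : IsLocalRep κ s G f n γ A x)
    (hX : IsConformalKilling (radialExt γ) X) (h0 : X x ≠ 0) :
    fderiv ℝ (fun z => form (G (radialExt f z)) (tracelessShape s G (radialExt f)
          (radialExt n) (radialExt (surfaceMeanCurv γ A)) z (rotate γ X x))
          (pushforward f (rotate γ X) z)) x (X x)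
        - fderiv ℝ (fun z => form (G (radialExt f z)) (tracelessShape s G (radialExt f)
          (radialExt n) (radialExt (surfaceMeanCurv γ A)) z (X x))
          (pushforward f (rotate γ X) z)) x (rotate γ X x) =
      -(1 / 2) * sD (surfaceMeanCurv γ A) x (X x) * form (γ x) (X x) (X x) := by
  have hXs := contMDiff_iff_radialExt.1 hX.contMDiff x
  have hXt := hX.tangent x
  have hfirst := hr.first.self_of_nhds
  have hnormal := hr.normal.self_of_nhds
  have hYY := h.form_rotate_rotate hXt
  obtain ⟨hconf, hconf'⟩ :=
    hr.form_cov_pushforward hX hXt (inner_coe_rotate γ X x) form_rotate hYY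
  have hstructure := fderiv_form_tracelessShape_rotated (V := pushforward f X) hr.metric
    hr.smooth_two hr.radialExt_mem hr.normal_smooth
    ((contDiffAt_pushforward hr.smooth_two (h.contDiffAt_rotate hXs)).differentiableAt one_ne_zero)
    ((h.contDiffAt_meanCurv x).differentiableAt one_ne_zero) hr.curv
    ((contDiffAt_pushforward hr.smooth_two hXs).differentiableAt one_ne_zero)
    (pushforward_coe f X x) (pushforward_coe f (rotate γ X) x) (eventually_radialProj hr.unit)
  simp only [radialExt_coe, pushforward_coe, ← hfirst, ← hr.second_self, hnormal,
    forall_const] at hstructure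
  refine hstructure ?_ ?_ hconf hconf' (form_symm _ _ hr.isSymm_second) ?_ ?_
  · filter_upwards [hr.first_eq, eventually_ne_zero x] with y hy hy0
    have hYX := (form_symm (rotate γ X (radialProj y)) _ (h.isSymm_first _)).trans form_rotate
    exact (mul_eq_zero.1 ((hy _ _).symm.trans hYX)).resolve_left
      (pow_ne_zero 2 (norm_ne_zero_iff.2 hy0))
  · filter_upwards [hr.first_eq, eventually_ne_zero x] with y hy hy0
    have hrot := h.form_rotate_rotate (hX.tangent (radialProj y))
    exact mul_left_cancel₀ (pow_ne_zero 2 (norm_ne_zero_iff.2 hy0))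
      ((hy _ _).symm.trans (hrot.trans (hy _ _)))
  · have htrace := h.meanCurv_mul_gramDet x (X x) (rotate γ X x)
    simp only [gramDet, mixedDisc, hYY, form_rotate] at htrace
    refine mul_right_cancel₀ (h.pos x _ hXt h0).ne' ?_
    linear_combination -htrace
  · intro hzero
    have hpos := h.pos x _ hXt h0
    rw [hfirst, hzero, form_zero_left] at hpos
    exact hpos.false

/-- Away from the zeros of `X`, the frame `X, JX` computes the divergence of `balancingField` as the
exterior derivative of a one-form. -/
lemma sDiv_balancingField_of_ne_zero (hX : IsConformalKilling (radialExt γ) X) (h0 : X x ≠ 0) :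
    sDiv (balancingField γ A X) x =
      -(1 / 2) * (sD (surfaceMeanCurv γ A) x (X x) * areaDensity (radialExt γ) x) := by
  obtain ⟨s, G, f, n, hr⟩ := h.rep x
  have hXs := contMDiff_iff_radialExt.1 hX.contMDiff x
  have hXt := hX.tangent x
  have hYt := inner_coe_rotate γ X x
  have hcurl := inner_cross_mul_sDiv_cross
    ((h.contDiffAt_flat_tracelessForm_rotate hXs).differentiableAt one_ne_zero) hXt hYt
  rw [h.inner_sD_flat_tracelessForm_rotate hr hXs _ hXt,
    h.inner_sD_flat_tracelessForm_rotate hr hXs _ hYt, h.inner_cross_rotate,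
    h.fderiv_form_tracelessShape_pushforward hr hX h0] at hcurl
  have harea := (h.area_pos x).ne'
  have hpos := (h.pos x _ hXt h0).ne'
  change sDiv (fun z => cross (flat (tracelessForm γ A z) (rotate γ X z)) (z : E3)) x = _
  field_simp at hcurl ⊢
  exact hcurl

lemma sDiv_balancingField (hX : IsConformalKilling (radialExt γ) X) (x : S2) :
    sDiv (balancingField γ A X) x =
      -(1 / 2) * (sD (surfaceMeanCurv γ A) x (X x) * areaDensity (radialExt γ) x) := by
  have hclosed : IsClosed {x | sDiv (balancingField γ A X) x =
      -(1 / 2) * (sD (surfaceMeanCurv γ A) x (X x) * areaDensity (radialExt γ) x)} :=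
    isClosed_eq (continuous_sDiv (h.contMDiff_balancingField hX.contMDiff))
      (continuous_const.mul (h.continuous_sD_meanCurv_mul_area hX.contMDiff.continuous))
  by_contra hx
  have hX0 : ∀ᶠ z in 𝓝 x, X z = 0 :=
    (hclosed.isOpen_compl.eventually_mem hx).mono fun z hz =>
      by_contra fun h0 => hz (h.sDiv_balancingField_of_ne_zero hX h0)
  have hderiv : fderiv ℝ (radialExt (balancingField γ A X)) (x : E3) = 0 := by
    have hzero : radialExt (balancingField γ A X) =ᶠ[𝓝 (x : E3)] fun _ => 0 :=
      eventually_radialProj (hX0.mono fun z hz => balancingField_eq_zero hz)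
    rw [hzero.fderiv_eq, fderiv_fun_const, Pi.zero_apply]
  exact hx (by simp [sDiv, sD_eq_fderiv, hderiv, hX0.self_of_nhds])

theorem balancing (hX : IsConformalKilling (radialExt γ) X) :
    Integrable (fun x => sD (surfaceMeanCurv γ A) x (X x) * areaDensity (radialExt γ) x) roundArea ∧
      ∫ x, sD (surfaceMeanCurv γ A) x (X x) * areaDensity (radialExt γ) x ∂roundArea = 0 := by
  refine ⟨integrable_of_continuous (h.continuous_sD_meanCurv_mul_area hX.contMDiff.continuous), ?_⟩
  have hdiv := integral_sDiv_eq_zero (h.contMDiff_balancingField hX.contMDiff)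
    fun x => inner_cross_self_right _ _
  simp only [h.sDiv_balancingField hX, integral_const_mul] at hdiv
  exact (mul_eq_zero.1 hdiv).resolve_left (by norm_num)

end IsSurface

/-! ### Monotone functions of a height -/

section Height

variable {H : S2 → ℝ} {a : E3}

/-- The gradient on the round sphere of the height function `⟪a, ·⟫`. -/
def heightGrad (a : E3) (x : S2) : E3 := a - ⟪a, (x : E3)⟫ • (x : E3)

lemma inner_coe_heightGrad (a : E3) (x : S2) : ⟪(x : E3), heightGrad a x⟫ = 0 := by
  rw [heightGrad, inner_sub_right, real_inner_smul_right, x.inner_self, real_inner_comm, mul_one,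
    sub_self]

lemma inner_heightGrad (a : E3) (x : S2) : ⟪a, heightGrad a x⟫ = ‖heightGrad a x‖ ^ 2 := by
  have ha : a = heightGrad a x + ⟪a, (x : E3)⟫ • (x : E3) := (sub_add_cancel _ _).symm
  nth_rw 1 [ha]
  rw [inner_add_left, real_inner_smul_left, inner_coe_heightGrad, mul_zero, add_zero,
    real_inner_self_eq_norm_sq]

lemma contMDiff_heightGrad {k : ℕ∞ω} (a : E3) : ContMDiff (𝓡 2) 𝓘(ℝ, E3) k (heightGrad a) := by
  refine contMDiff_iff_radialExt.2 fun x => ?_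
  have hproj := contDiffAt_radialProj (n := k) x.ne_zero
  exact contDiffAt_const.sub ((contDiffAt_const.inner ℝ hproj).smul hproj)

lemma sD_inner_coe (a : E3) (x : S2) {u : E3} (hu : ⟪(x : E3), u⟫ = 0) :
    sD (fun z : S2 => ⟪a, (z : E3)⟫) x u = ⟪a, u⟫ := by
  have hproj := (hasFDerivAt_const a (x : E3)).inner ℝ (hasFDerivAt_radialProj_coe x)
  rw [sD, hproj.fderiv]
  simp [hu, fderivInnerCLM_apply]

lemma sD_heightGrad (a : E3) (x : S2) {u : E3} (hu : ⟪(x : E3), u⟫ = 0) :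
    sD (heightGrad a) x u = -⟪a, u⟫ • (x : E3) - ⟪a, (x : E3)⟫ • u := by
  have hproj := hasFDerivAt_radialProj_coe x
  have hgrad : HasFDerivAt (radialExt (heightGrad a)) _ (x : E3) :=
    (hasFDerivAt_const a (x : E3)).sub (((hasFDerivAt_const a (x : E3)).inner ℝ hproj).smul hproj)
  rw [sD_eq_fderiv, hgrad.fderiv]
  simp [hu, fderivInnerCLM_apply]
  abel

theorem isConformalKilling_heightGrad {γ : S2 → Matrix (Fin 3) (Fin 3) ℝ} {ρ : S2 → ℝ}
    (hρ : ∀ x : S2, ρ x ≠ 0) (hdiff : ∀ x : S2, DifferentiableAt ℝ (radialExt ρ) (x : E3))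
    (hγ : ∀ (x : S2) u v, form (γ x) u v = ρ x * (⟪u, v⟫ - ⟪(x : E3), u⟫ * ⟪(x : E3), v⟫))
    (a : E3) : IsConformalKilling (radialExt γ) (heightGrad a) where
  contMDiff := contMDiff_heightGrad a
  tangent := inner_coe_heightGrad a
  conformal := by
    refine ⟨fun x => (sD ρ x (heightGrad a x) - 2 * ρ x * ⟪a, (x : E3)⟫) / ρ x,
      fun x u v hu hv => ?_⟩
    have hproj := hasFDerivAt_radialProj_coe x
    have hform : HasFDerivAt (radialExt fun z => form (γ z) u v) _ (x : E3) :=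
      ((hdiff x).hasFDerivAt.mul (((hproj.inner ℝ (hasFDerivAt_const u (x : E3))).mul
        (hproj.inner ℝ (hasFDerivAt_const v (x : E3)))).const_sub
          ⟪u, v⟫)).congr_of_eventuallyEq (.of_forall fun y => hγ _ u v)
    have hderiv : sD (fun z : S2 => form (γ z) u v) x (heightGrad a x) =
        sD ρ x (heightGrad a x) * ⟪u, v⟫ := by
      rw [sD_eq_fderiv, hform.fderiv, sD_eq_fderiv]
      simp [hu, hv]
      ring
    have := hρ x
    simp only [lieDeriv, radialExt_coe, hderiv]
    simp only [sD_heightGrad a x hu, sD_heightGrad a x hv, hγ, inner_sub_left, inner_sub_right,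
      real_inner_smul_left, real_inner_smul_right, hu, hv,
      x.inner_self, real_inner_comm (x : E3) u]
    field_simp
    ring

lemma sD_nonneg_of_monotoneOn_height (hH : ContMDiff (𝓡 2) 𝓘(ℝ, ℝ) 1 H) (ha : ‖a‖ = 1)
    {f : ℝ → ℝ} (hf : MonotoneOn f (Icc (-1) 1)) (hHf : ∀ x : S2, H x = f ⟪a, (x : E3)⟫) (x : S2)
    {u : E3} (hu : ⟪(x : E3), u⟫ = 0) (hau : 0 < ⟪a, u⟫) : 0 ≤ sD H x u := by
  have hline : HasDerivAt (fun t : ℝ => (x : E3) + t • u) u 0 := by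
    simpa using ((hasDerivAt_id (0 : ℝ)).smul_const u).const_add (x : E3)
  have hderiv {φ : S2 → ℝ} (hφ : ContMDiff (𝓡 2) 𝓘(ℝ, ℝ) 1 φ) :
      HasDerivAt (fun t : ℝ => radialExt φ ((x : E3) + t • u)) (sD φ x u) 0 :=
    ((contMDiff_iff_radialExt.1 hφ x).differentiableAt
      one_ne_zero).hasFDerivAt.comp_hasDerivAt_of_eq 0 hline (by simp)
  have hheight : ContMDiff (𝓡 2) 𝓘(ℝ, ℝ) 1 fun z : S2 => ⟪a, (z : E3)⟫ :=
    contMDiff_iff_radialExt.2 fun z =>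
      contDiffAt_const.inner ℝ (contDiffAt_radialProj z.ne_zero)
  have hmem (z : S2) : ⟪a, (z : E3)⟫ ∈ Icc (-1 : ℝ) 1 :=
    abs_le.1 (by simpa [ha] using abs_real_inner_le_norm a (z : E3))
  have hincr := (hderiv hheight).tendsto_slope.eventually
    (lt_mem_nhds ((sD_inner_coe a x hu).symm ▸ hau))
  refine ge_of_tendsto (hderiv hH).tendsto_slope (hincr.mono fun t ht => ?_)
  simp only [slope_def_field, radialExt, hHf] at ht ⊢
  have hslope := hf.slope_nonneg (hmem (radialProj ((x : E3) + (0 : ℝ) • u)))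
    (hmem (radialProj ((x : E3) + t • u)))
  rw [slope_def_field] at hslope
  have hne := (div_ne_zero_iff.1 ht.ne').1
  rw [← div_mul_div_cancel₀ hne]
  exact mul_nonneg hslope ht.le

/-- The great circle through the orthogonal unit vectors `a` and `b`. -/
def greatCircle (a b : E3) (t : ℝ) : E3 := Real.cos t • a + Real.sin t • b

lemma norm_greatCircle {b : E3} (ha : ‖a‖ = 1) (hb : ‖b‖ = 1) (hab : ⟪a, b⟫ = 0) (t : ℝ) :
    ‖greatCircle a b t‖ = 1 := by
  have hsq : ‖greatCircle a b t‖ ^ 2 = 1 := by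
    rw [greatCircle, norm_add_sq_real, real_inner_smul_left, real_inner_smul_right, hab, norm_smul,
      norm_smul, ha, hb]
    simp
  exact (pow_eq_one_iff_of_nonneg (norm_nonneg _) two_ne_zero).1 hsq

lemma inner_greatCircle {b : E3} (ha : ‖a‖ = 1) (hab : ⟪a, b⟫ = 0) (t : ℝ) :
    ⟪a, greatCircle a b t⟫ = Real.cos t := by
  simp [greatCircle, inner_add_right, real_inner_smul_right, hab, ha]

lemma hasDerivAt_greatCircle (a b : E3) (t : ℝ) :
    HasDerivAt (greatCircle a b) (-Real.sin t • a + Real.cos t • b) t :=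
  ((Real.hasDerivAt_cos t).smul_const a).add ((Real.hasDerivAt_sin t).smul_const b)

lemma sub_cos_smul_greatCircle (a b : E3) (t : ℝ) : a - Real.cos t • greatCircle a b t =
    -Real.sin t • (-Real.sin t • a + Real.cos t • b) := by
  have ha : a = (Real.cos t ^ 2 + Real.sin t ^ 2) • a := by rw [Real.cos_sq_add_sin_sq, one_smul]
  nth_rw 1 [ha]
  rw [greatCircle]
  module

/-- Half of a great circle through `a` meets every height, and along it the derivative of `H` is a
multiple of its derivative along `heightGrad a`. -/
theorem eq_of_sD_heightGrad_eq_zero (hH : ContMDiff (𝓡 2) 𝓘(ℝ, ℝ) 1 H) (ha : ‖a‖ = 1) {f : ℝ → ℝ}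
    (hHf : ∀ x : S2, H x = f ⟪a, (x : E3)⟫) (h0 : ∀ x : S2, sD H x (heightGrad a x) = 0)
    (x y : S2) : H x = H y := by
  have hpole : a ∈ sphere (0 : E3) 1 := by simpa using ha
  set b := frameVec ⟨a, hpole⟩ 0
  have hb : ‖b‖ = 1 := (orthonormal_frameVec ⟨a, hpole⟩).1 0
  have hab : ⟪a, b⟫ = 0 := inner_coe_frameVec ⟨a, hpole⟩ 0
  let c (t : ℝ) : S2 := ⟨greatCircle a b t, by simpa using norm_greatCircle ha hb hab t⟩
  have hHc (t : ℝ) : H (c t) = f (Real.cos t) := by rw [hHf, inner_greatCircle ha hab]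
  have hderiv (t : ℝ) : HasDerivAt (fun t => H (c t))
      (sD H (c t) (-Real.sin t • a + Real.cos t • b)) t := by
    refine (((contMDiff_iff_radialExt.1 hH (c t)).differentiableAt
      one_ne_zero).hasFDerivAt.comp_hasDerivAt_of_eq t (hasDerivAt_greatCircle a b t)
        rfl).congr_of_eventuallyEq (.of_forall fun t => (radialExt_coe H (c t)).symm)
  have hzero {t : ℝ} (ht : t ∈ Ioo 0 Real.pi) :
      sD H (c t) (-Real.sin t • a + Real.cos t • b) = 0 := by
    have hgrad := h0 (c t)
    rw [heightGrad, inner_greatCircle ha hab, sub_cos_smul_greatCircle, sD, map_smul, smul_eq_mul,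
      ← sD] at hgrad
    exact (mul_eq_zero.1 hgrad).resolve_left (neg_ne_zero.2 (Real.sin_pos_of_mem_Ioo ht).ne')
  have hconst {t : ℝ} (ht : t ∈ Icc 0 Real.pi) : f (Real.cos t) = f (Real.cos 0) := by
    rw [← hHc, ← hHc]
    refine ht.1.eq_or_lt.elim (fun h => by rw [h]) fun hpos => ?_
    obtain ⟨r, hr, hslope⟩ := exists_hasDerivAt_eq_slope (fun t => H (c t)) _ hpos
      (fun t _ => (hderiv t).continuousAt.continuousWithinAt) fun t _ => hderiv t
    rw [hzero ⟨hr.1, hr.2.trans_le ht.2⟩, eq_comm, div_eq_zero_iff] at hslope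
    exact sub_eq_zero.1 (hslope.resolve_right (by linarith))
  have hpoint (z : S2) : H z = f (Real.cos 0) := by
    obtain ⟨hneg, hle⟩ := abs_le.1 (by simpa [ha] using abs_real_inner_le_norm a (z : E3))
    rw [hHf, ← Real.cos_arccos hneg hle]
    exact hconst ⟨Real.arccos_nonneg _, Real.arccos_le_pi _⟩
  rw [hpoint, hpoint]

end Height

lemma eq_zero_of_integral_mul_eq_zero {φ w : S2 → ℝ} (hc : Continuous fun x => φ x * w x)
    (hw : ∀ x, 0 < w x) (hφ : ∀ x, 0 ≤ φ x) (hint : ∫ x, φ x * w x ∂roundArea = 0) (x : S2) :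
    φ x = 0 := by
  have : roundArea.IsOpenPosMeasure :=
    inferInstanceAs (Measure.IsOpenPosMeasure (Measure.toSphere _))
  rw [integral_eq_zero_iff_of_nonneg (fun x => mul_nonneg (hφ x) (hw x).le)
    (integrable_of_continuous hc)] at hint
  have hzero := (Continuous.ae_eq_iff_eq roundArea hc (continuous_const (y := (0 : ℝ)))).1 hint
  exact (mul_eq_zero.1 (congrFun hzero x)).resolve_right (hw x).ne'

lemma IsMonotoneOfHeight.exists_monotoneOn {H : S2 → ℝ} (h : IsMonotoneOfHeight H) :
    ∃ a : E3, ‖a‖ = 1 ∧ ∃ f : ℝ → ℝ, MonotoneOn f (Icc (-1) 1) ∧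
      ∀ x : S2, H x = f ⟪a, (x : E3)⟫ := by
  obtain ⟨-, a, ha, f, hf | hf, hHf⟩ := h
  · exact ⟨a, ha, f, hf, hHf⟩
  · refine ⟨-a, by simpa using ha, fun t => f (-t), fun s hs t ht hst => ?_, fun x => ?_⟩
    · exact hf ⟨by linarith [ht.2], by linarith [ht.1]⟩ ⟨by linarith [hs.2], by linarith [hs.1]⟩
        (neg_le_neg hst)
    · simp [hHf]

namespace IsSurface

variable {κ : ℝ} {γ A : S2 → Matrix (Fin 3) (Fin 3) ℝ} (h : IsSurface κ γ A)

include h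

lemma form_first_of_conformal {ρ : S2 → ℝ} (hρ : ∀ x : S2, ∀ u v : E3, ⟪(x : E3), u⟫ = 0 →
      ⟪(x : E3), v⟫ = 0 → form (radialExt γ x) u v = ρ x * ⟪u, v⟫) (x : S2) (u v : E3) :
    form (γ x) u v = ρ x * (⟪u, v⟫ - ⟪(x : E3), u⟫ * ⟪(x : E3), v⟫) := by
  have htangent (w : E3) : ⟪(x : E3), w - ⟪(x : E3), w⟫ • (x : E3)⟫ = 0 := by
    rw [inner_sub_right, real_inner_smul_right, x.inner_self, mul_one, sub_self]
  have hproj := hρ x _ _ (htangent u) (htangent v)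
  rw [radialExt_coe, inner_sub_left, real_inner_smul_left, htangent, inner_sub_right,
    real_inner_smul_right, form_sub_left, form_sub_right, form_smul_left, form_smul_right,
    h.first_coe, form_symm u (x : E3) (h.isSymm_first x), h.first_coe,
    real_inner_comm (x : E3) u] at hproj
  linear_combination hproj

theorem isConformalKilling_heightGrad (hc : IsConformalToRound (radialExt γ)) (a : E3) :
    IsConformalKilling (radialExt γ) (heightGrad a) := by
  obtain ⟨ρ, hpos, hρ⟩ := hc
  have hγ := h.form_first_of_conformal hρ
  refine Balancing.isConformalKilling_heightGrad (fun x => (hpos x).ne') (fun x => ?_) hγ a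
  have htrace (y : S2) : ρ y = 1 / 2 * ∑ i, γ y i i := by
    have hself := y.inner_self
    rw [inner_eq_dotProduct, dotProduct, Fin.sum_univ_three] at hself
    simp only [← form_stdVec (γ y), hγ, Fin.sum_univ_three, inner_stdVec]
    simp
    linear_combination 1 / 2 * ρ y * hself
  have hdiff : DifferentiableAt ℝ (fun y => 1 / 2 * ∑ i, radialExt γ y i i) (x : E3) :=
    ((ContDiffAt.sum fun i _ => h.contDiffAt_first x i i).differentiableAt one_ne_zero).const_mul _
  exact hdiff.congr_of_eventuallyEq (.of_forall fun y => htrace _)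

theorem not_isMonotoneOfHeight (hc : IsConformalToRound (radialExt γ)) :
    ¬ IsMonotoneOfHeight (surfaceMeanCurv γ A) := by
  intro hH
  obtain ⟨a, ha, f, hf, hHf⟩ := hH.exists_monotoneOn
  obtain ⟨x, y, hxy⟩ := hH.1
  have hnonneg (z : S2) : 0 ≤ sD (surfaceMeanCurv γ A) z (heightGrad a z) := by
    rcases eq_or_ne (heightGrad a z) 0 with h0 | h0
    · simp [h0, sD]
    · exact sD_nonneg_of_monotoneOn_height h.contMDiff_meanCurv ha hf hHf z
        (inner_coe_heightGrad a z) (by rw [inner_heightGrad]; positivity)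
  have hzero := eq_zero_of_integral_mul_eq_zero
    (h.continuous_sD_meanCurv_mul_area (contMDiff_heightGrad (k := 1) a).continuous) h.area_pos
    hnonneg (h.balancing (h.isConformalKilling_heightGrad hc a)).2
  exact hxy (eq_of_sD_heightGrad_eq_zero h.contMDiff_meanCurv ha hHf hzero x y)

end IsSurface

/-! ### Regularity of unit normals -/

section Sharp

variable {m : Matrix (Fin 3) (Fin 3) ℝ} {N n : E3}

/-- The vector dual to the covector `⟪N, ·⟫` with respect to the form of `m`. -/
def sharp (m : Matrix (Fin 3) (Fin 3) ℝ) (N : E3) : E3 := WithLp.toLp 2 (m⁻¹.mulVec N.ofLp)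

/-- The unit vector, with respect to the form of `m`, normal to the plane `N^⊥` and on the same side
of this plane as `N`. -/
def unitNormal (m : Matrix (Fin 3) (Fin 3) ℝ) (N : E3) : E3 :=
  (√(form m (sharp m N) (sharp m N)))⁻¹ • sharp m N

lemma form_sharp (hm : m.PosDef) (N w : E3) : form m (sharp m N) w = ⟪N, w⟫ := by
  rw [form_symm _ _ (isSymm_of_posDef hm), form_eq_dotProduct, sharp, Matrix.mulVec_mulVec,
    Matrix.mul_nonsing_inv _ hm.det_pos.ne'.isUnit, Matrix.one_mulVec, real_inner_comm,
    inner_eq_dotProduct]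

lemma form_sharp_pos (hm : m.PosDef) (hN : N ≠ 0) : 0 < form m (sharp m N) (sharp m N) := by
  refine form_pos hm fun hzero => hN (inner_self_eq_zero (𝕜 := ℝ).1 ?_)
  rw [← form_sharp hm, hzero, form_zero_left]

lemma eq_unitNormal (hm : m.PosDef) (hunit : form m n n = 1)
    (hnormal : ∀ w, ⟪N, w⟫ = 0 → form m n w = 0) (hpos : 0 < ⟪N, n⟫) : n = unitNormal m N := by
  have hN : N ≠ 0 := by
    rintro rfl
    simp at hpos
  have hW := form_sharp_pos hm hN
  have hWN : ⟪N, sharp m N⟫ = form m (sharp m N) (sharp m N) := (form_sharp hm N _).symm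
  set W := sharp m N
  set c := ⟪N, n⟫ / ⟪N, W⟫
  have hc : 0 < c := div_pos hpos (hWN ▸ hW)
  have hker : ⟪N, n - c • W⟫ = 0 := by
    rw [inner_sub_right, real_inner_smul_right, div_mul_cancel₀ _ (hWN ▸ hW).ne', sub_self]
  have hn : n = c • W := by
    by_contra hne
    refine (form_pos hm (sub_ne_zero.2 hne)).ne' ?_
    rw [form_sub_left, form_smul_left, hnormal _ hker, form_sharp hm, hker, mul_zero, sub_zero]
  rw [hn, form_smul_left, form_smul_right, ← mul_assoc, ← sq] at hunit
  have hsqrt : c * √(form m W W) = 1 := by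
    rw [← Real.sqrt_sq hc.le, ← Real.sqrt_mul (sq_nonneg c), hunit, Real.sqrt_one]
  rw [hn, unitNormal, eq_inv_of_mul_eq_one_left hsqrt]

variable {s : Set E3} {G : E3 → Matrix (Fin 3) (Fin 3) ℝ} {F N n : E3 → E3} {y : E3}
  (hM : IsMetricOn s G) (hF : ContDiffAt ℝ 2 F y) (hFs : ∀ᶠ z in 𝓝 y, F z ∈ s)
  (hN : ContDiffAt ℝ 2 N y)
include hM hF hFs hN

lemma contDiffAt_sharp : ContDiffAt ℝ 2 (fun z => sharp (G (F z)) (N z)) y := by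
  refine contDiffAt_euclidean.2 fun i => ?_
  change ContDiffAt ℝ 2 (fun z => ∑ j, (G (F z))⁻¹ i j * N z j) y
  exact ContDiffAt.sum fun j _ => (contDiffAt_comp_of_mem (contDiffOn_inv_apply hM.contDiffOn
    (fun p hp => (hM.posDef p hp).det_pos.ne') i j _ hFs.self_of_nhds) hF hFs).mul
      (contDiffAt_euclidean.1 hN j)

lemma contDiffAt_unitNormal (hne : N y ≠ 0) :
    ContDiffAt ℝ 2 (fun z => unitNormal (G (F z)) (N z)) y := by
  have hsharp := contDiffAt_sharp hM hF hFs hN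
  have hpos := form_sharp_pos (hM.posDef _ hFs.self_of_nhds) hne
  exact (((contDiffAt_form (fun i j => contDiffAt_comp_of_mem
    (hM.contDiffOn i j _ hFs.self_of_nhds) hF hFs) hsharp hsharp).sqrt hpos.ne').inv
      (Real.sqrt_pos.2 hpos).ne').smul hsharp

lemma contDiffAt_of_unit_of_normal (hunit : ∀ᶠ z in 𝓝 y, form (G (F z)) (n z) (n z) = 1)
    (hnormal : ∀ᶠ z in 𝓝 y, ∀ w, ⟪N z, w⟫ = 0 → form (G (F z)) (n z) w = 0)
    (hpos : ∀ᶠ z in 𝓝 y, 0 < ⟪N z, n z⟫) : ContDiffAt ℝ 2 n y := by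
  have hne : N y ≠ 0 := fun hzero => by simpa [hzero] using hpos.self_of_nhds
  refine (contDiffAt_unitNormal hM hF hFs hN hne).congr_of_eventuallyEq ?_
  filter_upwards [hFs, hunit, hnormal, hpos] with z hz hu hn hp
  exact eq_unitNormal (hM.posDef _ hz) hu hn hp

end Sharp

section Immersed

lemma inner_cross_self_smul (a b w : E3) : ⟪cross a b, cross a b⟫ • w =
    (⟪w, a⟫ * ⟪b, b⟫ - ⟪w, b⟫ * ⟪a, b⟫) • a + (⟪w, b⟫ * ⟪a, a⟫ - ⟪w, a⟫ * ⟪a, b⟫) • b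
      + ⟪cross a b, w⟫ • cross a b := by
  ext i
  simp only [inner_eq_dotProduct, ofLp_cross, cross_apply, dotProduct, Fin.sum_univ_three,
    PiLp.add_apply, PiLp.smul_apply, smul_eq_mul]
  fin_cases i <;> simp <;> ring

lemma form_eq_zero_of_inner_cross_eq_zero {m : Matrix (Fin 3) (Fin 3) ℝ} {n a b w : E3}
    (ha : form m n a = 0) (hb : form m n b = 0) (hab : cross a b ≠ 0) (hw : ⟪cross a b, w⟫ = 0) :
    form m n w = 0 := by
  have hform := congrArg (form m n) (inner_cross_self_smul a b w)
  rw [form_smul_right, form_add_right, form_add_right, form_smul_right, form_smul_right, ha, hb,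
    hw, zero_smul, form_zero_right] at hform
  simpa [hab] using hform

lemma inner_self_smul_of_cross_eq_zero {a b : E3} (h : cross a b = 0) :
    ⟪a, a⟫ • b = ⟪a, b⟫ • a := by
  have hdouble := cross_cross_right a a b
  rw [h, map_zero] at hdouble
  exact (sub_eq_zero.1 hdouble.symm).symm

variable {f : S2 → E3} {x : S2}

lemma cross_sD_frameVec_ne_zero (himm : ∀ u : E3, ⟪(x : E3), u⟫ = 0 → sD f x u = 0 → u = 0) :
    cross (sD f x (frameVec x 0)) (sD f x (frameVec x 1)) ≠ 0 := by
  intro hzero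
  have ho := orthonormal_iff_ite.1 (orthonormal_frameVec x)
  have hparallel := inner_self_smul_of_cross_eq_zero hzero
  set a := sD f x (frameVec x 0) with ha
  set b := sD f x (frameVec x 1) with hb
  have hker := himm (⟪a, a⟫ • frameVec x 1 - ⟪a, b⟫ • frameVec x 0)
    (by simp [inner_sub_right, real_inner_smul_right, inner_coe_frameVec])
    (by rw [sD_eq_fderiv] at ha hb ⊢; rw [map_sub, map_smul, map_smul, ← ha, ← hb, hparallel,
          sub_self])
  have haa := congrArg (fun w => ⟪frameVec x 1, w⟫) hker
  simp only [inner_sub_right, real_inner_smul_right, ho, if_true, inner_zero_right] at haa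
  refine (orthonormal_frameVec x).ne_zero 0 (himm _ (inner_coe_frameVec x 0) ?_)
  simpa using haa

lemma contDiffAt_normal_of_continuousAt {s : Set E3} {G : E3 → Matrix (Fin 3) (Fin 3) ℝ}
    {n : S2 → E3} (hM : IsMetricOn s G) (hf : ContDiffAt ℝ 3 (radialExt f) (x : E3))
    (himm : ∀ u : E3, ⟪(x : E3), u⟫ = 0 → sD f x u = 0 → u = 0) (hn : ContinuousAt n x)
    (hmem : ∀ᶠ z in 𝓝 x, f z ∈ s) (hunit : ∀ᶠ z in 𝓝 x, form (G (f z)) (n z) (n z) = 1)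
    (hnormal : ∀ᶠ z in 𝓝 x, ∀ u, form (G (f z)) (n z) (sD f z u) = 0) :
    ContDiffAt ℝ 2 (radialExt n) (x : E3) := by
  set d : Fin 2 → E3 → E3 := fun i z => fderiv ℝ (radialExt f) z (frameVec x i)
  have hd (i : Fin 2) : ContDiffAt ℝ 2 (d i) (x : E3) :=
    (hf.fderiv_right (m := 2) (by norm_num)).clm_apply contDiffAt_const
  set N : E3 → E3 := fun z => cross (d 0 z) (d 1 z)
  have hN : ContDiffAt ℝ 2 N (x : E3) := (cross.contDiff.contDiffAt.comp _ (hd 0)).clm_apply (hd 1)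
  have hNx : N x ≠ 0 := cross_sD_frameVec_ne_zero himm
  have hnormal' : ∀ᶠ z in 𝓝 (x : E3), ∀ w, ⟪N z, w⟫ = 0 →
      form (G (radialExt f z)) (radialExt n z) w = 0 := by
    have hdiff : ∀ᶠ z in 𝓝 (x : E3), DifferentiableAt ℝ (radialExt f) (radialProj z : E3) :=
      eventually_radialProj (eventually_coe ((hf.eventually (by simp)).mono fun y hy =>
        hy.differentiableAt (by norm_num)))
    filter_upwards [eventually_radialProj hnormal, hN.continuousAt.eventually_ne hNx, hdiff,
      eventually_ne_zero x] with z hz hNz hfz hz0 w hw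
    have hperp (i : Fin 2) : form (G (radialExt f z)) (radialExt n z) (d i z) = 0 := by
      simp only [d, fderiv_radialExt hz0 hfz, form_smul_right]
      exact mul_eq_zero_of_right _ (hz _)
    exact form_eq_zero_of_inner_cross_eq_zero (hperp 0) (hperp 1) hNz hw
  have hside : ⟪N x, n x⟫ ≠ 0 := fun hzero => by
    have hself := hnormal'.self_of_nhds (n x) hzero
    rw [radialExt_coe, radialExt_coe, hunit.self_of_nhds] at hself
    exact one_ne_zero hself
  have hcont : ContinuousAt (fun z => ⟪⟪N x, n x⟫ • N z, radialExt n z⟫) (x : E3) := by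
    have hext : ContinuousAt (radialExt n) (x : E3) :=
      ContinuousAt.comp (by rwa [radialProj_coe]) (continuousAt_radialProj x.ne_zero)
    exact (hN.continuousAt.const_smul ⟪N x, n x⟫).inner hext
  refine contDiffAt_of_unit_of_normal (N := fun z => ⟪N x, n x⟫ • N z) hM (hf.of_le (by norm_num))
    (eventually_radialProj hmem) (hN.const_smul _) (eventually_radialProj hunit) ?_
    (hcont.eventually (lt_mem_nhds ?_))
  · filter_upwards [hnormal'] with z hz w hw
    rw [real_inner_smul_left] at hw
    exact hz w ((mul_eq_zero.1 hw).resolve_left hside)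
  · beta_reduce
    rw [real_inner_smul_left, radialExt_coe]
    exact mul_self_pos.2 hside

end Immersed

/-! ### The fundamental forms of a map -/

section FundamentalForms

/-- The matrix of the first fundamental form of `f`. -/
def firstFF (G : E3 → Matrix (Fin 3) (Fin 3) ℝ) (f : S2 → E3) (x : S2) :
    Matrix (Fin 3) (Fin 3) ℝ :=
  Matrix.of fun i j => form (G (f x)) (sD f x (stdVec i)) (sD f x (stdVec j))

/-- The matrix of the second fundamental form of `f` with respect to the normal field `n`. -/
def secondFFMatrix (s : Set E3) (G : E3 → Matrix (Fin 3) (Fin 3) ℝ) (f n : S2 → E3) (x : S2) :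
    Matrix (Fin 3) (Fin 3) ℝ :=
  Matrix.of fun i j => secondFF s G f (n x) x (stdVec i) (stdVec j)

lemma form_of_bilinear (B : E3 →ₗ[ℝ] E3 →ₗ[ℝ] ℝ) (u v : E3) :
    form (Matrix.of fun i j => B (stdVec i) (stdVec j)) u v = B u v := by
  have hbasis (w : E3) : w = ∑ i, w i • stdVec i := by
    simpa using ((EuclideanSpace.basisFun (Fin 3) ℝ).sum_repr w).symm
  conv_rhs => rw [hbasis u, hbasis v]
  simp only [form, Matrix.of_apply, map_sum, map_smul, LinearMap.sum_apply, LinearMap.smul_apply,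
    smul_eq_mul, Finset.mul_sum]
  rw [Finset.sum_comm]
  exact Finset.sum_congr rfl fun i _ => Finset.sum_congr rfl fun j _ => by ring

variable {s : Set E3} {G : E3 → Matrix (Fin 3) (Fin 3) ℝ} {f : S2 → E3} {x : S2}

lemma form_firstFF (u v : E3) :
    form (firstFF G f x) u v = form (G (f x)) (sD f x u) (sD f x v) :=
  form_of_bilinear (LinearMap.mk₂ ℝ (fun u v => form (G (f x)) (sD f x u) (sD f x v))
    (by simp [sD, form_add_left]) (by simp [sD, form_smul_left]) (by simp [sD, form_add_right])
    (by simp [sD, form_smul_right])) u v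

lemma sD2_eq (hf : ContDiffAt ℝ 2 (radialExt f) (x : E3)) (u v : E3) :
    sD2 f x u v = fderiv ℝ (fderiv ℝ (radialExt f)) (x : E3) v u := by
  have hd := (hf.fderiv_right (m := 1) (by norm_num)).differentiableAt one_ne_zero
  refine (congrArg (· v) (fderiv_clm_apply hd (differentiableAt_const u))).trans ?_
  simp

lemma form_secondFFMatrix {n : S2 → E3} (hf : ContDiffAt ℝ 2 (radialExt f) (x : E3)) (u v : E3) :
    form (secondFFMatrix s G f n x) u v = secondFF s G f (n x) x u v := by
  refine form_of_bilinear (LinearMap.mk₂ ℝ (secondFF s G f (n x) x) ?_ ?_ ?_ ?_) u v <;> intros <;>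
    simp only [secondFF, sD2_eq hf, sD_eq_fderiv, christoffelVec_eq_vecForm, map_add, map_smul,
      add_apply, smul_apply, vecForm_add_left, vecForm_add_right, vecForm_smul_left,
      vecForm_smul_right, form_add_left, form_smul_left, smul_eq_mul] <;> ring

end FundamentalForms

/-! ### The boundary of the ball -/

lemma S2.mem_B3 (x : S2) : (x : E3) ∈ B3 := sphere_subset_closedBall x.2

lemma sD_coe_eq_heightGrad (x : S2) (u : E3) :
    sD (fun z : S2 => (z : E3)) x u = heightGrad u x := by
  rw [sD_coe, heightGrad, real_inner_comm]

lemma heightGrad_of_tangent {x : S2} {u : E3} (hu : ⟪(x : E3), u⟫ = 0) : heightGrad u x = u := by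
  rw [heightGrad, real_inner_comm, hu, zero_smul, sub_zero]

lemma heightGrad_sD_of_tangent {X : S2 → E3} {x : S2}
    (hX : DifferentiableAt ℝ (radialExt X) (x : E3)) (htan : ∀ z : S2, ⟪(z : E3), X z⟫ = 0)
    {u : E3} (hu : ⟪(x : E3), u⟫ = 0) :
    heightGrad (sD X x u) x = sD X x u + ⟪u, X x⟫ • (x : E3) := by
  have hinner := (hasFDerivAt_radialProj_coe x).inner ℝ hX.hasFDerivAt
  have hzero : HasFDerivAt (fun y => ⟪(radialProj y : E3), radialExt X y⟫) (0 : E3 →L[ℝ] ℝ) x :=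
    (hasFDerivAt_const (0 : ℝ) (x : E3)).congr_of_eventuallyEq
      (.of_forall fun y => htan (radialProj y))
  have hu' := congrArg (· u) (hinner.unique hzero)
  simp only [ContinuousLinearMap.comp_apply, ContinuousLinearMap.prod_apply, fderivInnerCLM_apply,
    sub_apply, ContinuousLinearMap.id_apply, ContinuousLinearMap.smulRight_apply,
    innerSL_apply_apply, hu, zero_smul, sub_zero, radialProj_coe, radialExt_coe, zero_apply,
    ← sD_eq_fderiv] at hu'
  rw [heightGrad, real_inner_comm, eq_neg_of_add_eq_zero_left hu', neg_smul, sub_neg_eq_add]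

section Ball

variable {G : E3 → Matrix (Fin 3) (Fin 3) ℝ}

/-- The first fundamental form of `∂B³`, extended to `ℝ³` by the value zero on the radial
direction. -/
def boundaryFirst (G : E3 → Matrix (Fin 3) (Fin 3) ℝ) : S2 → Matrix (Fin 3) (Fin 3) ℝ :=
  firstFF G fun z : S2 => (z : E3)

/-- The second fundamental form of `∂B³`. -/
def boundarySecond (G : E3 → Matrix (Fin 3) (Fin 3) ℝ) (ν : S2 → E3) :
    S2 → Matrix (Fin 3) (Fin 3) ℝ :=
  secondFFMatrix B3 G (fun z : S2 => (z : E3)) ν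

lemma form_boundaryFirst (x : S2) (u v : E3) :
    form (boundaryFirst G x) u v = form (G x) (heightGrad u x) (heightGrad v x) := by
  rw [boundaryFirst, form_firstFF, sD_coe_eq_heightGrad, sD_coe_eq_heightGrad]

lemma form_boundaryFirst_of_tangent {x : S2} {u v : E3} (hu : ⟪(x : E3), u⟫ = 0)
    (hv : ⟪(x : E3), v⟫ = 0) : form (boundaryFirst G x) u v = form (G x) u v := by
  rw [form_boundaryFirst, heightGrad_of_tangent hu, heightGrad_of_tangent hv]

lemma areaDensity_boundaryFirst : areaDensity (radialExt (boundaryFirst G)) = areaDensity G := by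
  ext x
  simp only [areaDensity, radialExt_coe,
    form_boundaryFirst_of_tangent (inner_coe_of_mem_tangent _) (inner_coe_of_mem_tangent _)]

lemma isConformalToRound_boundaryFirst (hc : IsConformalToRound G) :
    IsConformalToRound (radialExt (boundaryFirst G)) := by
  obtain ⟨ρ, hpos, hρ⟩ := hc
  refine ⟨ρ, hpos, fun x u v hu hv => ?_⟩
  rw [radialExt_coe, form_boundaryFirst_of_tangent hu hv, hρ x u v hu hv]

variable {κ : ℝ} {ν : S2 → E3} (hG : IsConstCurvMetricOnBall G κ)
include hG

lemma IsConstCurvMetricOnBall.isMetricOn : IsMetricOn B3 G where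
  uniqueDiffOn := uniqueDiffOn_convex (convex_closedBall _ _) (by
    rw [interior_closedBall _ one_ne_zero]
    exact nonempty_ball.2 one_pos)
  subset_closure := by rw [interior_closedBall _ one_ne_zero, closure_ball _ one_ne_zero]
  contDiffOn := hG.contDiffOn
  posDef := hG.posDef

lemma lieDeriv_boundaryFirst {X : S2 → E3} {x : S2}
    (hX : DifferentiableAt ℝ (radialExt X) (x : E3)) (htan : ∀ z : S2, ⟪(z : E3), X z⟫ = 0)
    {u v : E3} (hu : ⟪(x : E3), u⟫ = 0) (hv : ⟪(x : E3), v⟫ = 0) :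
    lieDeriv (radialExt (boundaryFirst G)) X x u v = lieDeriv G X x u v := by
  have hF : DifferentiableAt ℝ (radialExt fun z : S2 => (z : E3)) (x : E3) :=
    (hasFDerivAt_radialProj_coe x).differentiableAt
  have hFs : ∀ᶠ y in 𝓝 (x : E3), radialExt (fun z : S2 => (z : E3)) y ∈ B3 :=
    .of_forall fun y => (radialProj y).mem_B3
  have hgrad (w : E3) : DifferentiableAt ℝ (radialExt (heightGrad w)) (x : E3) :=
    (contMDiff_iff_radialExt.1 (contMDiff_heightGrad (k := 1) w) x).differentiableAt one_ne_zero
  have hfirst : sD (fun z : S2 => form (boundaryFirst G z) u v) x (X x) = _ :=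
    (congrArg (fun φ => fderiv ℝ φ (x : E3) (X x)) (funext fun y =>
      form_boundaryFirst (radialProj y) u v)).trans
        (fderiv_form_comp hG.isMetricOn hF hFs (hgrad u) (hgrad v) (X x))
  have hmetric : sD (fun z : S2 => form (G z) u v) x (X x) = _ :=
    fderiv_form_comp hG.isMetricOn hF hFs (differentiableAt_const u) (differentiableAt_const v)
      (X x)
  simp only [lieDeriv, radialExt_coe]
  rw [hfirst, hmetric]
  simp only [cov, ← sD_eq_fderiv, radialExt_coe, form_boundaryFirst, sD_heightGrad _ x (htan x),
    heightGrad_of_tangent hu, heightGrad_of_tangent hv]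
  simp only [heightGrad_sD_of_tangent hX htan hu, heightGrad_sD_of_tangent hX htan hv,
    real_inner_comm (x : E3), hu, hv, zero_smul, sub_zero, fderiv_fun_const, Pi.zero_apply,
    zero_apply, zero_add, form_add_left, form_add_right, form_smul_left, form_smul_right]
  ring

lemma isConformalKilling_boundaryFirst {X : S2 → E3} (hX : IsConformalKilling G X) :
    IsConformalKilling (radialExt (boundaryFirst G)) X where
  contMDiff := hX.contMDiff
  tangent := hX.tangent
  conformal := by
    obtain ⟨μ, hμ⟩ := hX.conformal
    refine ⟨μ, fun x u v hu hv => ?_⟩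
    rw [lieDeriv_boundaryFirst hG ((contMDiff_iff_radialExt.1 hX.contMDiff x).differentiableAt
      one_ne_zero) hX.tangent hu hv, hμ x u v hu hv, radialExt_coe,
      form_boundaryFirst_of_tangent hu hv]

variable (hν : IsOutwardUnitNormal G ν)
include hν

lemma contDiffAt_outwardUnitNormal (x : S2) : ContDiffAt ℝ 2 (radialExt ν) (x : E3) :=
  have hcoe : ContDiffAt ℝ 2 (radialExt fun z : S2 => (z : E3)) (x : E3) :=
    contDiffAt_radialProj x.ne_zero
  contDiffAt_of_unit_of_normal hG.isMetricOn hcoe (.of_forall fun y => (radialProj y).mem_B3) hcoe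
    (.of_forall fun y => hν.unit (radialProj y)) (.of_forall fun y => hν.normal (radialProj y))
    (.of_forall fun y => hν.outward (radialProj y))

theorem isLocalRep_boundary (x : S2) : IsLocalRep κ B3 G (fun z : S2 => (z : E3)) ν
    (boundaryFirst G) (boundarySecond G ν) x where
  metric := hG.isMetricOn
  curv := hG.constCurv
  smooth := contDiffAt_radialProj x.ne_zero
  normal_smooth := contDiffAt_outwardUnitNormal hG hν x
  mem := .of_forall S2.mem_B3
  unit := .of_forall hν.unit
  normal := .of_forall fun z u => by
    rw [sD_coe_eq_heightGrad]
    exact hν.normal z _ (inner_coe_heightGrad u z)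
  first := .of_forall fun z u v => form_firstFF u v
  second := .of_forall fun z u v => form_secondFFMatrix (contDiffAt_radialProj z.ne_zero) u v

theorem isSurface_boundary : IsSurface κ (boundaryFirst G) (boundarySecond G ν) where
  rep x := ⟨_, _, _, _, isLocalRep_boundary hG hν x⟩
  pos x u hu hne := by
    rw [form_boundaryFirst_of_tangent hu hu]
    exact form_pos (hG.posDef _ x.mem_B3) hne

lemma boundaryMeanCurv_eq :
    boundaryMeanCurv G ν = surfaceMeanCurv (boundaryFirst G) (boundarySecond G ν) :=
  funext fun x => (isLocalRep_boundary hG hν x).meanCurv_eq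

theorem contMDiff_boundaryMeanCurv : ContMDiff (𝓡 2) 𝓘(ℝ, ℝ) 1 (boundaryMeanCurv G ν) :=
  boundaryMeanCurv_eq hG hν ▸ (isSurface_boundary hG hν).contMDiff_meanCurv

theorem balancing_boundaryMeanCurv {X : S2 → E3} (hX : IsConformalKilling G X) :
    Integrable (fun x => sD (boundaryMeanCurv G ν) x (X x) * areaDensity G x) roundArea ∧
      ∫ x, sD (boundaryMeanCurv G ν) x (X x) * areaDensity G x ∂roundArea = 0 := by
  rw [boundaryMeanCurv_eq hG hν, ← areaDensity_boundaryFirst]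
  exact (isSurface_boundary hG hν).balancing (isConformalKilling_boundaryFirst hG hX)

theorem not_isMonotoneOfHeight_boundaryMeanCurv (hc : IsConformalToRound G) :
    ¬ IsMonotoneOfHeight (boundaryMeanCurv G ν) := by
  rw [boundaryMeanCurv_eq hG hν]
  exact (isSurface_boundary hG hν).not_isMonotoneOfHeight (isConformalToRound_boundaryFirst hc)

end Ball

/-! ### Changes of coordinates -/

section Isometry

variable {s s' : Set E3} {G G' : E3 → Matrix (Fin 3) (Fin 3) ℝ} {ψ : E3 → E3}

section

variable {p : E3} (hM : IsMetricOn s G) (hM' : IsMetricOn s' G') (hs : s ∈ 𝓝 p)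
  (hs' : ∀ᶠ y in 𝓝 p, ψ y ∈ s') (hψ : ContDiffAt ℝ 2 ψ p)
  (hG : ∀ᶠ y in 𝓝 p, ∀ v w,
    form (G y) v w = form (G' (ψ y)) (fderiv ℝ ψ y v) (fderiv ℝ ψ y w))
include hM hM' hs hs' hψ hG

lemma form_christoffelVec_of_isometry (a v w : E3) :
    form (G p) (christoffelVec s G p a v) w = form (G' (ψ p))
      (cov s' G' ψ (fun y => fderiv ℝ ψ y v) p a) (fderiv ℝ ψ p w) := by
  have hp := mem_of_mem_nhds hs
  -- The difference of the two sides is symmetric in `a, v` and antisymmetric in `v, w`.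
  set T : E3 → E3 → E3 → ℝ := fun a v w => form (G p) (christoffelVec s G p a v) w -
    form (G' (ψ p)) (cov s' G' ψ (fun y => fderiv ℝ ψ y v) p a) (fderiv ℝ ψ p w) with hT
  have hsymm (a v w : E3) : T a v w = T v a w := by
    simp only [hT, christoffelVec_symm hM hp a v, cov_fderiv_comm hM' hψ hs' a v]
  have hanti (a v w : E3) : T a v w + T a w v = 0 := by
    have hψ' := fderiv_form_comp hM' (hψ.differentiableAt two_ne_zero) hs'
      (differentiableAt_fderiv_apply hψ v) (differentiableAt_fderiv_apply hψ w) a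
    have hid := fderiv_form_comp hM differentiableAt_id hs (differentiableAt_const v)
      (differentiableAt_const w) a
    have heq := congrArg (· a) (EventuallyEq.fderiv_eq (𝕜 := ℝ) (hG.mono fun y hy => hy v w))
    simp only [id_eq, cov, fderiv_fun_const, Pi.zero_apply, zero_apply, zero_add, fderiv_id,
      ContinuousLinearMap.id_apply, hM.form_symm hp v] at hid
    rw [hM'.form_symm hs'.self_of_nhds (fderiv ℝ ψ p v)] at hψ'
    simp only [hT]
    linarith
  refine sub_eq_zero.1 (?_ : T a v w = 0)
  linarith [hanti a v w, hsymm a w v, hanti w a v, hsymm w v a, hanti v w a, hsymm a v w]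

end

lemma form_cov_of_isometry {F P : E3 → E3} {y : E3} (hM : IsMetricOn s G) (hM' : IsMetricOn s' G')
    (hs : s ∈ 𝓝 (F y)) (hs' : ∀ᶠ z in 𝓝 (F y), ψ z ∈ s') (hψ : ContDiffAt ℝ 2 ψ (F y))
    (hG : ∀ᶠ z in 𝓝 (F y), ∀ v w,
      form (G z) v w = form (G' (ψ z)) (fderiv ℝ ψ z v) (fderiv ℝ ψ z w))
    (hF : DifferentiableAt ℝ F y) (hP : DifferentiableAt ℝ P y) (u w : E3) :
    form (G' (ψ (F y))) (cov s' G' (ψ ∘ F) (fun z => fderiv ℝ ψ (F z) (P z)) y u)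
      (fderiv ℝ ψ (F y) w) = form (G (F y)) (cov s G F P y u) w := by
  have hdψ : DifferentiableAt ℝ (fderiv ℝ ψ) (F y) :=
    (hψ.fderiv_right (m := 1) (by norm_num)).differentiableAt one_ne_zero
  have hcov : cov s' G' (ψ ∘ F) (fun z => fderiv ℝ ψ (F z) (P z)) y u =
      fderiv ℝ ψ (F y) (fderiv ℝ P y u)
        + cov s' G' ψ (fun z => fderiv ℝ ψ z (P y)) (F y) (fderiv ℝ F y u) := by
    rw [cov, cov, fderiv_comp y (hψ.differentiableAt two_ne_zero) hF,
      fderiv_clm_apply (hdψ.fun_comp' y hF) hP, fderiv_clm_apply hdψ (differentiableAt_const _),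
      fderiv_fun_comp y hdψ hF]
    simp [add_assoc]
  rw [hcov, cov.eq_def s G F P, form_add_left, form_add_left, ← hG.self_of_nhds,
    form_christoffelVec_of_isometry hM hM' hs hs' hψ hG]

variable {f : S2 → E3} {x : S2}

lemma secondFF_eq_cov (hM : IsMetricOn s G) (hx : f x ∈ s) (n u v : E3) :
    secondFF s G f n x u v = -form (G (radialExt f x))
      (cov s G (radialExt f) (fun y => fderiv ℝ (radialExt f) y u) x v) n := by
  rw [secondFF, cov, radialExt_coe, christoffelVec_symm hM hx]
  rfl

lemma secondFF_of_isometry (hM : IsMetricOn s G) (hM' : IsMetricOn s' G') (hs : s ∈ 𝓝 (f x))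
    (hs' : ∀ᶠ y in 𝓝 (f x), ψ y ∈ s') (hψ : ContDiffAt ℝ 2 ψ (f x))
    (hG : ∀ᶠ y in 𝓝 (f x), ∀ v w,
      form (G y) v w = form (G' (ψ y)) (fderiv ℝ ψ y v) (fderiv ℝ ψ y w))
    (hf : ContDiffAt ℝ 2 (radialExt f) (x : E3)) (n u v : E3) :
    secondFF s' G' (ψ ∘ f) (fderiv ℝ ψ (f x) n) x u v = secondFF s G f n x u v := by
  have hfderiv : (fun y => fderiv ℝ (radialExt (ψ ∘ f)) y u) =ᶠ[𝓝 (x : E3)]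
      fun y => fderiv ℝ ψ (radialExt f y) (fderiv ℝ (radialExt f) y u) := by
    rw [← radialExt_coe f x] at hψ
    filter_upwards [hf.continuousAt.eventually (hψ.eventually (by simp)),
      hf.eventually (by simp)] with y hψy hfy
    exact congrArg (· u) (fderiv_comp y (hψy.differentiableAt two_ne_zero)
      (hfy.differentiableAt two_ne_zero))
  rw [secondFF_eq_cov hM (mem_of_mem_nhds hs), secondFF_eq_cov hM' hs'.self_of_nhds, cov,
    hfderiv.fderiv_eq, show fderiv ℝ (radialExt (ψ ∘ f)) x u = _ from hfderiv.self_of_nhds]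
  rw [← radialExt_coe f x] at hs hs' hψ hG ⊢
  exact congrArg Neg.neg (form_cov_of_isometry hM hM' hs hs' hψ hG
    (hf.differentiableAt two_ne_zero) (differentiableAt_fderiv_apply hf u) v n)

lemma secondFF_congr {f' : S2 → E3} (h : f =ᶠ[𝓝 x] f') (n u v : E3) :
    secondFF s G f n x u v = secondFF s G f' n x u v := by
  have hext : radialExt f =ᶠ[𝓝 (x : E3)] radialExt f' := eventually_radialProj h
  have hsD (w : E3) : sD f x w = sD f' x w := congrArg (fun L : E3 →L[ℝ] E3 => L w) hext.fderiv_eq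
  have hsD2 : sD2 f x u v = sD2 f' x u v :=
    congrArg (fun L : E3 →L[ℝ] E3 => L v) (EventuallyEq.fderiv_eq
      (hext.fderiv.mono fun _ hy => congrArg (fun L : E3 →L[ℝ] E3 => L u) hy))
  rw [secondFF, secondFF, hsD, hsD, hsD2, h.self_of_nhds]

end Isometry

/-! ### Immersions in three-manifolds -/

lemma form_of_comp (B : E3 →L[ℝ] E3 →L[ℝ] ℝ) (L : E3 →L[ℝ] E3) (u v : E3) :
    form (Matrix.of fun i j => B (L (stdVec i)) (L (stdVec j))) u v = B (L u) (L v) :=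
  form_of_bilinear (LinearMap.mk₂ ℝ (fun u v => B (L u) (L v)) (by simp) (by simp) (by simp)
    (by simp)) u v

section Chart

variable {N : Type*} [TopologicalSpace N] [ChartedSpace E3 N] [IsManifold (𝓡 3) ∞ N]
  {φ : OpenPartialHomeomorph N E3} (hφ : φ ∈ atlas E3 N)

/-- The inner product `g_p` as a bilinear form on the model space `ℝ³`, which the tangent space
at `p` is by definition. -/
def modelInner (g : SmoothMetric N) (p : N) : E3 →L[ℝ] E3 →L[ℝ] ℝ := g.inner p

/-- The differential of a chart, as a map of model spaces. -/
def dChart (φ : OpenPartialHomeomorph N E3) (p : N) : E3 →L[ℝ] E3 := mfderiv (𝓡 3) (𝓡 3) φ p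

/-- The differential of the inverse of a chart, as a map of model spaces. -/
def dChartSymm (φ : OpenPartialHomeomorph N E3) (y : E3) : E3 →L[ℝ] E3 :=
  mfderiv (𝓡 3) (𝓡 3) φ.symm y

lemma form_metricInChart (g : SmoothMetric N) (φ : OpenPartialHomeomorph N E3) (y u v : E3) :
    form (metricInChart g φ y) u v =
      modelInner g (φ.symm y) (dChartSymm φ y u) (dChartSymm φ y v) :=
  form_of_comp _ _ u v

include hφ

lemma contMDiffOn_chart_symm : ContMDiffOn (𝓡 3) (𝓡 3) ∞ φ.symm φ.target :=
  contMDiffOn_symm_of_mem_maximalAtlas (IsManifold.subset_maximalAtlas hφ)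

lemma contMDiffOn_chart : ContMDiffOn (𝓡 3) (𝓡 3) ∞ φ φ.source :=
  contMDiffOn_of_mem_maximalAtlas (IsManifold.subset_maximalAtlas hφ)

lemma mdifferentiable_chart : φ.MDifferentiable (𝓡 3) (𝓡 3) :=
  mdifferentiable_of_mem_atlas hφ

lemma contMDiffAt_dChartSymm {y : E3} (hy : y ∈ φ.target) (e : E3) :
    ContMDiffAt (𝓡 3) (𝓡 3).tangent 2
      (fun z : E3 => (⟨φ.symm z, dChartSymm φ z e⟩ : TangentBundle (𝓡 3) N)) y := by
  have htangentMap : ContMDiffOn (𝓡 3).tangent (𝓡 3).tangent 2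
      (tangentMapWithin (𝓡 3) (𝓡 3) φ.symm φ.target) (Bundle.TotalSpace.proj ⁻¹' φ.target) :=
    (contMDiffOn_chart_symm hφ).contMDiffOn_tangentMapWithin (by norm_cast)
      φ.open_target.uniqueMDiffOn
  have hconst : ContMDiff (𝓡 3) (𝓡 3).tangent 2 fun z : E3 => (⟨z, e⟩ : TangentBundle (𝓡 3) E3) :=
    fun z => contMDiffAt_vectorSpace_iff_contDiffAt.2 contDiffAt_const
  refine ((htangentMap.contMDiffAt (x := (⟨y, e⟩ : TangentBundle (𝓡 3) E3))
    ((φ.open_target.preimage (FiberBundle.continuous_proj E3 _)).mem_nhds hy)).comp y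
      hconst.contMDiffAt).congr_of_eventuallyEq ?_
  filter_upwards [φ.open_target.mem_nhds hy] with z hz
  simp only [Function.comp_def, tangentMapWithin]
  rw [mfderivWithin_of_isOpen φ.open_target hz]
  rfl

lemma contDiffOn_metricInChart (g : SmoothMetric N) (i j : Fin 3) :
    ContDiffOn ℝ 2 (fun y => metricInChart g φ y i j) φ.target := fun y hy => by
  have hg : ContMDiffAt (𝓡 3) _ 2 _ y := (g.contMDiff.of_le (by norm_cast)).contMDiffAt.comp y
    (((contMDiffOn_chart_symm hφ).contMDiffAt (φ.open_target.mem_nhds hy)).of_le (by norm_cast))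
  have happly := ContMDiffAt.clm_bundle_apply₂ (F₁ := E3) (F₂ := E3)
    (E₁ := fun p : N => TangentSpace (𝓡 3) p) (E₂ := fun p : N => TangentSpace (𝓡 3) p)
    (E₃ := Bundle.Trivial N ℝ) hg (contMDiffAt_dChartSymm hφ hy (stdVec i))
    (contMDiffAt_dChartSymm hφ hy (stdVec j))
  exact (Bundle.contMDiffAt_totalSpace.1 happly).2.contDiffAt.contDiffWithinAt

lemma isMetricOn_metricInChart (g : SmoothMetric N) : IsMetricOn φ.target (metricInChart g φ) where
  uniqueDiffOn := φ.open_target.uniqueDiffOn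
  subset_closure := φ.open_target.interior_eq.symm ▸ subset_closure
  contDiffOn := contDiffOn_metricInChart hφ g
  posDef y hy := by
    refine .of_dotProduct_mulVec_pos (Matrix.ext fun i j => g.symm _ _ _) fun u hu => ?_
    have hform := form_metricInChart g φ y (WithLp.toLp 2 u) (WithLp.toLp 2 u)
    rw [form_eq_dotProduct] at hform
    refine lt_of_lt_of_eq (g.pos _ _ fun hzero => hu ?_) hform.symm
    exact congrArg WithLp.ofLp ((mdifferentiable_chart hφ).symm.mfderiv_injective hy
      (hzero.trans (map_zero _).symm))

variable {p : N} (hp : p ∈ φ.source)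
include hp

lemma dChartSymm_dChart (v : E3) : dChartSymm φ (φ p) (dChart φ p v) = v :=
  congrArg (fun L : E3 →L[ℝ] E3 => L v) ((mdifferentiable_chart hφ).symm_comp_deriv hp)

lemma form_metricInChart_chart (g : SmoothMetric N) (u v : E3) :
    form (metricInChart g φ (φ p)) (dChart φ p u) (dChart φ p v) = modelInner g p u v := by
  rw [form_metricInChart, dChartSymm_dChart hφ hp, dChartSymm_dChart hφ hp, φ.left_inv hp]

omit hp
variable {φ' : OpenPartialHomeomorph N E3} (hφ' : φ' ∈ atlas E3 N) {y : E3} (hy : y ∈ φ.target)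
  (hy' : φ.symm y ∈ φ'.source)
include hφ' hy hy'

lemma contDiffAt_transition : ContDiffAt ℝ ∞ (φ' ∘ φ.symm) y :=
  (((contMDiffOn_chart hφ').contMDiffAt (φ'.open_source.mem_nhds hy')).comp y
    ((contMDiffOn_chart_symm hφ).contMDiffAt (φ.open_target.mem_nhds hy))).contDiffAt

lemma fderiv_transition (v : E3) :
    fderiv ℝ (φ' ∘ φ.symm) y v = dChart φ' (φ.symm y) (dChartSymm φ y v) :=
  congrArg (fun L : E3 →L[ℝ] E3 => L v) (mfderiv_eq_fderiv.symm.trans (mfderiv_comp (I' := 𝓡 3) y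
    ((mdifferentiable_chart hφ').mdifferentiableAt hy')
    ((mdifferentiable_chart hφ).mdifferentiableAt_symm hy)))

lemma form_metricInChart_transition (g : SmoothMetric N) (v w : E3) :
    form (metricInChart g φ y) v w = form (metricInChart g φ' ((φ' ∘ φ.symm) y))
      (fderiv ℝ (φ' ∘ φ.symm) y v) (fderiv ℝ (φ' ∘ φ.symm) y w) := by
  rw [fderiv_transition hφ hφ' hy hy', fderiv_transition hφ hφ' hy hy', Function.comp_apply,
    form_metricInChart_chart hφ' hy', form_metricInChart]

end Chart

section Immersion

variable {N : Type*} [TopologicalSpace N] [ChartedSpace E3 N] [IsManifold (𝓡 3) ∞ N]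
  {φ φ' : OpenPartialHomeomorph N E3} {g : SmoothMetric N} {F : S2 → N} {x : S2}

lemma secondFF_chart (hφ : φ ∈ atlas E3 N) (hφ' : φ' ∈ atlas E3 N) (hF : ContinuousAt F x)
    (hx : F x ∈ φ.source) (hx' : F x ∈ φ'.source)
    (hf : ContDiffAt ℝ 2 (radialExt (φ ∘ F)) (x : E3)) (n u v : E3) :
    secondFF φ'.target (metricInChart g φ') (φ' ∘ F) (dChart φ' (F x) n) x u v =
      secondFF φ.target (metricInChart g φ) (φ ∘ F) (dChart φ (F x) n) x u v := by
  have hy : φ (F x) ∈ φ.target := φ.map_source hx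
  have hy' : φ.symm (φ (F x)) ∈ φ'.source := by rwa [φ.left_inv hx]
  have hdom : ∀ᶠ y in 𝓝 (φ (F x)), y ∈ φ.target ∧ φ.symm y ∈ φ'.source :=
    .and (φ.open_target.mem_nhds hy)
      ((φ.continuousAt_symm hy).eventually (φ'.open_source.mem_nhds hy'))
  have htransition : φ' ∘ F =ᶠ[𝓝 x] (φ' ∘ φ.symm) ∘ (φ ∘ F) := by
    filter_upwards [hF.eventually (φ.open_source.mem_nhds hx)] with z hz
    simp only [Function.comp_apply, φ.left_inv hz]
  have hfderiv : fderiv ℝ (φ' ∘ φ.symm) ((φ ∘ F) x) (dChart φ (F x) n) = dChart φ' (F x) n :=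
    (fderiv_transition hφ hφ' hy hy' _).trans (by rw [dChartSymm_dChart hφ hx, φ.left_inv hx])
  have hiso := secondFF_of_isometry (ψ := φ' ∘ φ.symm) (f := φ ∘ F) (isMetricOn_metricInChart hφ g)
    (isMetricOn_metricInChart hφ' g) (φ.open_target.mem_nhds hy)
    (hdom.mono fun y h => φ'.map_source h.2)
    ((contDiffAt_transition hφ hφ' hy hy').of_le (by norm_cast))
    (hdom.mono fun y h => form_metricInChart_transition hφ hφ' h.1 h.2 g) hf
    (dChart φ (F x) n) u v
  rw [← hiso, hfderiv, secondFF_congr htransition]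

/-- The differential of a map from the sphere, as a map of model spaces. -/
def dSphere (F : S2 → N) (x : S2) : EuclideanSpace ℝ (Fin 2) →L[ℝ] E3 := mfderiv (𝓡 2) (𝓡 3) F x

/-- The differential of the radial projection at a point of the sphere, as a map of model spaces;
on tangent vectors it is inverse to the differential of the inclusion. -/
def dRadial (x : S2) : E3 →L[ℝ] EuclideanSpace ℝ (Fin 2) :=
  mfderiv 𝓘(ℝ, E3) (𝓡 2) radialProj (x : E3)

/-- The differential of the inclusion of the sphere, as a map of model spaces. -/
def dCoe (x : S2) : EuclideanSpace ℝ (Fin 2) →L[ℝ] E3 :=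
  mfderiv (𝓡 2) 𝓘(ℝ, E3) (fun y : S2 => (y : E3)) x

lemma hasFDerivAt_radialExt {f : S2 → E3} {L : EuclideanSpace ℝ (Fin 2) →L[ℝ] E3}
    (h : HasMFDerivAt (𝓡 2) 𝓘(ℝ, E3) f x L) :
    HasFDerivAt (radialExt f) (L.comp (dRadial x)) (x : E3) := by
  have hproj : ∀ y : S2, y = x → HasMFDerivAt (𝓡 2) 𝓘(ℝ, E3) f y L := by
    rintro y rfl
    exact h
  have hradial := (contMDiffAt_radialProj (n := 1) x.ne_zero).mdifferentiableAt one_ne_zero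
  exact ((hproj _ (radialProj_coe x)).comp (x : E3) hradial.hasMFDerivAt).hasFDerivAt

lemma dCoe_dRadial (u : E3) : dCoe x (dRadial x u) = heightGrad u x := by
  rw [← sD_coe_eq_heightGrad, sD_eq_fderiv, (hasFDerivAt_radialExt
    ((contMDiff_coe_sphere (m := 1) x).mdifferentiableAt one_ne_zero).hasMFDerivAt).fderiv]
  rfl

lemma dRadial_ne_zero {u : E3} (hu : ⟪(x : E3), u⟫ = 0) (hne : u ≠ 0) : dRadial x u ≠ 0 :=
  fun h => hne (by rw [← heightGrad_of_tangent hu, ← dCoe_dRadial, h, map_zero])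

lemma sD_chart (hφ : φ ∈ atlas E3 N) (hF : MDifferentiableAt (𝓡 2) (𝓡 3) F x)
    (hx : F x ∈ φ.source) (u : E3) :
    sD (φ ∘ F) x u = dChart φ (F x) (dSphere F x (dRadial x u)) :=
  congrArg (fun L : E3 →L[ℝ] E3 => L u) (hasFDerivAt_radialExt
    (((mdifferentiable_chart hφ).mdifferentiableAt hx).hasMFDerivAt.comp x hF.hasMFDerivAt)).fderiv

/-- The matrix of the first fundamental form `F^* g`, extended to `ℝ³` by the value zero on the
radial direction. -/
def immersionFirst (g : SmoothMetric N) (F : S2 → N) (x : S2) : Matrix (Fin 3) (Fin 3) ℝ :=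
  Matrix.of fun i j => modelInner g (F x) (dSphere F x (dRadial x (stdVec i)))
    (dSphere F x (dRadial x (stdVec j)))

lemma form_immersionFirst (u v : E3) : form (immersionFirst g F x) u v =
    modelInner g (F x) (dSphere F x (dRadial x u)) (dSphere F x (dRadial x v)) :=
  form_of_comp _ ((dSphere F x).comp (dRadial x)) u v

lemma form_immersionFirst_pos (hF : Function.Injective (mfderiv (𝓡 2) (𝓡 3) F x)) {u : E3}
    (hu : ⟪(x : E3), u⟫ = 0) (hne : u ≠ 0) : 0 < form (immersionFirst g F x) u u := by
  rw [form_immersionFirst]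
  exact g.pos _ _ fun h => dRadial_ne_zero hu hne (hF (h.trans (map_zero _).symm))

variable {ν : ∀ x : S2, TangentSpace (𝓡 3) (F x)} {κ : ℝ}

/-- The coordinates of a vector field along `F` in a chart. -/
def chartField (φ : OpenPartialHomeomorph N E3) (ν : ∀ x : S2, TangentSpace (𝓡 3) (F x))
    (x : S2) : E3 :=
  dChart φ (F x) (ν x)

/-- The matrix of the second fundamental form of an immersion, computed at `x` in the preferred
chart at `F x`. -/
def immersionSecond (g : SmoothMetric N) (F : S2 → N) (ν : ∀ x : S2, TangentSpace (𝓡 3) (F x))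
    (x : S2) : Matrix (Fin 3) (Fin 3) ℝ :=
  secondFFMatrix (chartAt E3 (F x)).target (metricInChart g (chartAt E3 (F x)))
    (chartAt E3 (F x) ∘ F) (chartField (chartAt E3 (F x)) ν) x

lemma continuousAt_chartField (hφ : φ ∈ atlas E3 N)
    (hν : Continuous fun x : S2 => (⟨F x, ν x⟩ : TangentBundle (𝓡 3) N)) (hx : F x ∈ φ.source) :
    ContinuousAt (chartField φ ν) x := by
  have hopen : IsOpen (Bundle.TotalSpace.proj ⁻¹' φ.source : Set (TangentBundle (𝓡 3) N)) :=
    φ.open_source.preimage (FiberBundle.continuous_proj E3 _)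
  have htangentMap : ContinuousOn (tangentMapWithin (𝓡 3) (𝓡 3) φ φ.source)
      (Bundle.TotalSpace.proj ⁻¹' φ.source) :=
    (contMDiffOn_chart hφ).continuousOn_tangentMapWithin (by norm_cast) φ.open_source.uniqueMDiffOn
  have hcomp := (htangentMap.continuousAt (x := (⟨F x, ν x⟩ : TangentBundle (𝓡 3) N))
    (hopen.mem_nhds hx)).comp (f := fun x : S2 => (⟨F x, ν x⟩ : TangentBundle (𝓡 3) N))
      hν.continuousAt
  have hsnd : Continuous (fun p : TangentBundle (𝓡 3) E3 => (p.2 : E3)) :=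
    (contMDiff_snd_tangentBundle_modelSpace (n := 0) E3 (𝓡 3)).continuous
  refine (hsnd.continuousAt.comp hcomp).congr ?_
  filter_upwards [(hopen.preimage hν).mem_nhds hx] with z hz
  exact congrArg (fun L : E3 →L[ℝ] E3 => L (ν z)) (mfderivWithin_of_isOpen φ.open_source hz)

section UnitNormal

variable (hF : ContMDiff (𝓡 2) (𝓡 3) 3 F) (hφ : φ ∈ atlas E3 N) (hx : F x ∈ φ.source)
include hF hφ hx

lemma contDiffAt_radialExt_chart : ContDiffAt ℝ 3 (radialExt (φ ∘ F)) (x : E3) :=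
  contMDiffAt_iff_radialExt.1 ((((contMDiffOn_chart hφ).contMDiffAt
    (φ.open_source.mem_nhds hx)).of_le (by norm_cast)).comp x (hF x))

lemma form_immersionFirst_chart (u v : E3) : form (immersionFirst g F x) u v =
    form (metricInChart g φ (φ (F x))) (sD (φ ∘ F) x u) (sD (φ ∘ F) x v) := by
  have hd := (hF x).mdifferentiableAt (by norm_num)
  rw [sD_chart hφ hd hx, sD_chart hφ hd hx, form_metricInChart_chart hφ hx, form_immersionFirst]

lemma form_immersionSecond_chart (u v : E3) : form (immersionSecond g F ν x) u v =
    secondFF φ.target (metricInChart g φ) (φ ∘ F) (chartField φ ν x) x u v := by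
  have hat := contDiffAt_radialExt_chart hF (chart_mem_atlas E3 (F x)) (mem_chart_source E3 (F x))
  rw [immersionSecond, form_secondFFMatrix (hat.of_le (by norm_num))]
  exact secondFF_chart hφ (chart_mem_atlas E3 (F x)) hF.continuous.continuousAt hx
    (mem_chart_source E3 (F x)) ((contDiffAt_radialExt_chart hF hφ hx).of_le (by norm_num)) _ u v

lemma isLocalRep_immersion (hκ : IsConstCurvMetric g κ)
    (hinj : Function.Injective (mfderiv (𝓡 2) (𝓡 3) F x)) (hν : IsUnitNormalAlong g F ν) :
    IsLocalRep κ φ.target (metricInChart g φ) (φ ∘ F) (chartField φ ν) (immersionFirst g F)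
      (immersionSecond g F ν) x := by
  have hsource : ∀ᶠ z in 𝓝 x, F z ∈ φ.source :=
    hF.continuous.continuousAt.eventually (φ.open_source.mem_nhds hx)
  have hmem : ∀ᶠ z in 𝓝 x, φ (F z) ∈ φ.target := hsource.mono fun z hz => φ.map_source hz
  have hunit : ∀ᶠ z in 𝓝 x,
      form (metricInChart g φ (φ (F z))) (chartField φ ν z) (chartField φ ν z) = 1 :=
    hsource.mono fun z hz => (form_metricInChart_chart hφ hz g _ _).trans (hν.unit z)
  have hnormal : ∀ᶠ z in 𝓝 x, ∀ u,
      form (metricInChart g φ (φ (F z))) (chartField φ ν z) (sD (φ ∘ F) z u) = 0 :=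
    hsource.mono fun z hz u => by
      rw [sD_chart hφ ((hF z).mdifferentiableAt (by norm_num)) hz]
      exact (form_metricInChart_chart hφ hz g _ _).trans (hν.normal z (dRadial z u))
  have himm (u : E3) (hu : ⟪(x : E3), u⟫ = 0) (hsD : sD (φ ∘ F) x u = 0) : u = 0 := by
    by_contra hne
    have hpos := form_immersionFirst_pos (g := g) hinj hu hne
    rw [form_immersionFirst_chart hF hφ hx, hsD, form_zero_left] at hpos
    exact hpos.false
  exact {
    metric := isMetricOn_metricInChart hφ g
    curv := hκ φ hφ
    smooth := contDiffAt_radialExt_chart hF hφ hx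
    normal_smooth := contDiffAt_normal_of_continuousAt (isMetricOn_metricInChart hφ g)
      (contDiffAt_radialExt_chart hF hφ hx) himm (continuousAt_chartField hφ hν.continuous hx) hmem
      hunit hnormal
    mem := hmem
    unit := hunit
    normal := hnormal
    first := hsource.mono fun z hz => form_immersionFirst_chart hF hφ hz
    second := hsource.mono fun z hz => form_immersionSecond_chart hF hφ hz }

end UnitNormal

section Surface

variable (hF : ContMDiff (𝓡 2) (𝓡 3) 3 F)
  (hinj : ∀ x, Function.Injective (mfderiv (𝓡 2) (𝓡 3) F x)) (hκ : IsConstCurvMetric g κ)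
  (hν : IsUnitNormalAlong g F ν)
include hF hinj hκ hν

theorem isSurface_immersion : IsSurface κ (immersionFirst g F) (immersionSecond g F ν) where
  rep x := ⟨_, _, _, _, isLocalRep_immersion hF (chart_mem_atlas E3 (F x))
    (mem_chart_source E3 (F x)) hκ (hinj x) hν⟩
  pos x _ hu hne := form_immersionFirst_pos (hinj x) hu hne

lemma HasMeanCurv.eq_surfaceMeanCurv {H : S2 → ℝ} (hH : HasMeanCurv g F ν H) :
    H = surfaceMeanCurv (immersionFirst g F) (immersionSecond g F ν) :=
  funext fun x => (hH _ (chart_mem_atlas E3 (F x)) x (mem_chart_source E3 (F x))).trans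
    (isLocalRep_immersion hF (chart_mem_atlas E3 (F x)) (mem_chart_source E3 (F x)) hκ (hinj x)
      hν).meanCurv_eq

end Surface

namespace IsConformalImmersion

variable (hF : IsConformalImmersion g F)
include hF

lemma exists_modelInner_eq : ∃ ρ : S2 → ℝ, (∀ x, 0 < ρ x) ∧
    ∀ (x : S2) (u v : EuclideanSpace ℝ (Fin 2)),
      modelInner g (F x) (dSphere F x u) (dSphere F x v) = ρ x * ⟪dCoe x u, dCoe x v⟫ :=
  hF.conformal

lemma mfderiv_injective (x : S2) : Function.Injective (mfderiv (𝓡 2) (𝓡 3) F x) := by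
  obtain ⟨ρ, hpos, hρ⟩ := hF.exists_modelInner_eq
  refine (injective_iff_map_eq_zero (dSphere F x)).2 fun w hw => ?_
  have hself := hρ x w w
  rw [hw, map_zero, eq_comm, mul_eq_zero_iff_left (hpos x).ne', inner_self_eq_zero] at hself
  exact injective_mvfderiv_subtypeVal_sphere x (hself.trans (map_zero (dCoe x)).symm)

lemma isConformalToRound : IsConformalToRound (radialExt (immersionFirst g F)) := by
  obtain ⟨ρ, hpos, hρ⟩ := hF.exists_modelInner_eq
  refine ⟨ρ, hpos, fun x u v hu hv => ?_⟩
  rw [radialExt_coe, form_immersionFirst, hρ, dCoe_dRadial, dCoe_dRadial, heightGrad_of_tangent hu,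
    heightGrad_of_tangent hv]

theorem not_isMonotoneOfHeight {H : S2 → ℝ} (hκ : IsConstCurvMetric g κ)
    (hν : IsUnitNormalAlong g F ν) (hH : HasMeanCurv g F ν H) : ¬ IsMonotoneOfHeight H := by
  rw [hH.eq_surfaceMeanCurv hF.contMDiff hF.mfderiv_injective hκ hν]
  exact (isSurface_immersion hF.contMDiff hF.mfderiv_injective hκ hν).not_isMonotoneOfHeight
    hF.isConformalToRound

end IsConformalImmersion

end Immersion

end Balancing

end

theorem mainTheorem4 (κ : ℝ) :
    -- the balancing condition for the boundary data of constant curvature metrics on the ball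
    (∀ (G : Balancing.E3 → Matrix (Fin 3) (Fin 3) ℝ) (ν : Balancing.S2 → Balancing.E3),
      Balancing.IsConstCurvMetricOnBall G κ → Balancing.IsOutwardUnitNormal G ν →
      ContMDiff (𝓡 2) 𝓘(ℝ, ℝ) 1 (Balancing.boundaryMeanCurv G ν) ∧
      ∀ X : Balancing.S2 → Balancing.E3, Balancing.IsConformalKilling G X →
        Integrable (fun x => Balancing.sD (Balancing.boundaryMeanCurv G ν) x (X x)
          * Balancing.areaDensity G x) Balancing.roundArea ∧
        ∫ x, Balancing.sD (Balancing.boundaryMeanCurv G ν) x (X x)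
          * Balancing.areaDensity G x ∂Balancing.roundArea = 0) ∧
    -- monotone functions of a height function are not mean curvatures of such metrics
    (∀ (G : Balancing.E3 → Matrix (Fin 3) (Fin 3) ℝ) (ν : Balancing.S2 → Balancing.E3),
      Balancing.IsConstCurvMetricOnBall G κ → Balancing.IsOutwardUnitNormal G ν →
      Balancing.IsConformalToRound G →
      ¬ Balancing.IsMonotoneOfHeight (Balancing.boundaryMeanCurv G ν)) ∧
    -- nor of conformal immersions of the round sphere in space forms
    (∀ (N : Type*) [TopologicalSpace N] [ChartedSpace Balancing.E3 N] [IsManifold (𝓡 3) ∞ N]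
      (g : Balancing.SmoothMetric N) (F : Balancing.S2 → N)
      (ν : ∀ x : Balancing.S2, TangentSpace (𝓡 3) (F x)) (H : Balancing.S2 → ℝ),
      Balancing.IsConstCurvMetric g κ → Balancing.IsConformalImmersion g F →
      Balancing.IsUnitNormalAlong g F ν → Balancing.HasMeanCurv g F ν H →
      ¬ Balancing.IsMonotoneOfHeight H) := by
  refine ⟨fun G ν hG hν => ⟨Balancing.contMDiff_boundaryMeanCurv hG hν, fun X hX =>
    Balancing.balancing_boundaryMeanCurv hG hν hX⟩, fun G ν hG hν hround => ?_,
    fun N _ _ _ g F ν H hκ hF hν hH => ?_⟩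
  · exact Balancing.not_isMonotoneOfHeight_boundaryMeanCurv hG hν hround
  · exact hF.not_isMonotoneOfHeight hκ hν hH
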